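/- Let $n\ge 1$, let $p_1,\dots,p_n$ be nonzero integers, and let $S^1=\{t\in\mathbb C: |t|=1\}$ act on the unit sphere $S^{2n-1}\subset\mathbb{C}^n$ by $$\psi:\quad t\cdot(z_1,\dots,z_n)=(t^{p_1}z_1,\dots,t^{p_n}z_n).$$ Write $t=e^{2\pi i\theta}$ and let $\underline X$ be the fundamental vector field of $\partial/\partial\theta$, that is $\underline X_x=\frac{d}{d\theta}\big|_{\theta=0}\,e^{2\pi i\theta}\cdot x$. A normalized connection form is a smooth $S^1$-invariant real $1$-form $\alpha$ on $S^{2n-1}$ with $\alpha(\underline X)=1$. Let $B=S^{2n-1}/S^1$ be the quotient orbifold and $q:S^{2n-1}\to B$ the quotient map; differential forms on $B$ are identified, via $q^*$, with the $S^1$-invariant horizontal forms on $S^{2n-1}$, and $H^*(B;\mathbb R)$ is their de Rham cohomology. The sphere is oriented as the boundary of the unit ball, and $B$ is oriented so that $\underline X$ followed by an oriented frame of $B$ is an oriented frame of the sphere. The pairing with $[B]$ is orbifold integration: over an orbifold chart $D/\Gamma$, where $\Gamma$ is the isotropy group (including its ineffective part, if any), the integral is $\frac1{|\Gamma|}\int_D$,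 and charts are combined by a partition of unity. Then there is exactly one class $c_1(S^{2n-1},\psi)\in H^2(B;\mathbb R)$ which is represented by a closed $2$-form $\Theta_\alpha$ on $B$ with $q^*\Theta_\alpha=d\alpha$ for some normalized connection form $\alpha$, and for every normalized connection form $\alpha$ $$\big\langle c_1(S^{2n-1},\psi)^{\,n-1},[B]\big\rangle=\int_{S^{2n-1}}\alpha\wedge(d\alpha)^{n-1}=\frac{1}{\prod_{i=1}^n p_i}.$$ -/

import Mathlib

noncomputable section

namespace LinearCircleAction

open MeasureTheory Metric Set
open scoped ContDiff RealInnerProductSpace TensorProduct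

/-! ### The sphere `S^{2m+1} ⊂ ℂ^{m+1}` and its differential forms -/

/-- The complex vector space `ℂ^{m+1}`, with its Euclidean structure `⟪z, w⟫ = Re ∑ z̄_j w_j`;
the sphere `S^{2m+1}` is its unit sphere `sphere 0 1`. -/
abbrev Cn (m : ℕ) : Type := EuclideanSpace ℂ (Fin (m + 1))

/-- Ambient differential `k`-forms on `ℂ^{m+1}`. A smooth `k`-form on the sphere is represented by
an ambient form which is smooth at the points of the sphere; only its values on vectors tangent to
the sphere matter, see `SphereEq`. -/
abbrev Form (m k : ℕ) : Type := Cn m → Cn m [⋀^Fin k]→L[ℝ] ℝ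

/-- The vectors `v i` are all tangent at `x` to the sphere through `x`. -/
def Tangent {m k : ℕ} (x : Cn m) (v : Fin k → Cn m) : Prop := ∀ i, ⟪x, v i⟫ = 0

/-- `η` restricts to a smooth form on the unit sphere. -/
def SmoothOnSphere {m k : ℕ} (η : Form m k) : Prop :=
  ∀ x ∈ sphere (0 : Cn m) 1, ContDiffAt ℝ ∞ η x

/-- `η` and `β` restrict to the same form on the unit sphere. -/
def SphereEq {m k : ℕ} (η β : Form m k) : Prop :=
  ∀ x ∈ sphere (0 : Cn m) 1, ∀ v : Fin k → Cn m, Tangent x v → η x v = β x v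

/-- Exterior product of alternating forms, `(a ∧ b)(v) = ∑ sign σ • a(v_σ') b(v_σ'')`, the sum
running over the `(k, l)`-shuffles `σ`. -/
def wedge {m k l : ℕ} (a : Cn m [⋀^Fin k]→L[ℝ] ℝ) (b : Cn m [⋀^Fin l]→L[ℝ] ℝ) :
    Cn m [⋀^Fin (k + l)]→L[ℝ] ℝ :=
  { ((LinearMap.mul' ℝ ℝ).compAlternatingMap
      (a.toAlternatingMap.domCoprod b.toAlternatingMap)).domDomCongr finSumFinEquiv with
    cont := by
      change Continuous fun v : Fin (k + l) → Cn m => LinearMap.mul' ℝ ℝ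
        ((∑ σ : Equiv.Perm.ModSumCongr (Fin k) (Fin l),
          AlternatingMap.domCoprod.summand a.toAlternatingMap b.toAlternatingMap σ)
            (fun i => v (finSumFinEquiv i)))
      simp only [sum_apply, map_sum]
      refine continuous_finsetSum _ fun σ _ => ?_
      induction σ using Quotient.inductionOn' with
      | h σ =>
        change Continuous fun v : Fin (k + l) → Cn m => LinearMap.mul' ℝ ℝ
          (Equiv.Perm.sign σ • (a (fun i => v (finSumFinEquiv (σ (Sum.inl i)))) ⊗ₜ[ℝ]
            b (fun i => v (finSumFinEquiv (σ (Sum.inr i))))))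
        simp only [Units.smul_def, map_zsmul, LinearMap.mul'_apply]
        refine Continuous.zsmul (Continuous.mul ?_ ?_) _
        · exact a.cont.comp (continuous_pi fun i => continuous_apply _)
        · exact b.cont.comp (continuous_pi fun i => continuous_apply _) }

/-- The `r`-fold exterior power `η ∧ ⋯ ∧ η` of an alternating `2`-form, equal to `1` for `r = 0`. -/
def wedgePow {m : ℕ} (η : Cn m [⋀^Fin 2]→L[ℝ] ℝ) : (r : ℕ) → Cn m [⋀^Fin (2 * r)]→L[ℝ] ℝ
  | 0 => ContinuousAlternatingMap.constOfIsEmpty ℝ (Cn m) (Fin 0) 1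
  | r + 1 => wedge (wedgePow η r) η

/-- The standard oriented orthonormal frame `e_0, i e_0, e_1, i e_1, …` of `ℂ^{m+1}`,
as the values of `realFrame m` at `0, 1, …, 2m + 1`. -/
def realFrame (m : ℕ) (k : ℕ) : Cn m :=
  EuclideanSpace.single (Fin.ofNat (m + 1) (k / 2)) (if k % 2 = 0 then 1 else Complex.I)

/-- The covector `⟪x, ·⟫`; for `x` in the sphere it is dual to the outward unit normal. -/
def conormal {m : ℕ} (x : Cn m) : Cn m [⋀^Fin 1]→L[ℝ] ℝ :=
  ContinuousAlternatingMap.ofSubsingleton ℝ (Cn m) ℝ (0 : Fin 1) (innerSL ℝ x)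

/-- The integral `∫_{S^{2m+1}} η` of a form of top degree. The sphere is oriented as boundary of the
unit ball (outward normal first), so `η = f · dσ` with `σ` the surface measure and `f(x)` the value
of `⟪x, ·⟫ ∧ η_x` on the oriented orthonormal frame. -/
def sphereIntegral {m : ℕ} (η : Form m (1 + 2 * m)) : ℝ :=
  ∫ x : sphere (0 : Cn m) 1, wedge (conormal (x : Cn m)) (η x) (fun k => realFrame m k)
    ∂(volume : Measure (Cn m)).toSphere

/-! ### The linear circle action and its connection forms -/

/-- The action `t · (z_0, …, z_m) = (t^{p_0} z_0, …, t^{p_m} z_m)`. For fixed `t` this is linear,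
so it is also the action on tangent vectors. -/
def act {m : ℕ} (p : Fin (m + 1) → ℤ) (t : Circle) (z : Cn m) : Cn m :=
  WithLp.toLp 2 fun j => (t : ℂ) ^ p j * z j

/-- The fundamental vector field of the generator `X = ∂/∂θ` of the kernel of `exp : 𝔰¹ → S¹`,
where `S¹` is parametrised by `t = e^{2π i θ}`. -/
def fundField {m : ℕ} (p : Fin (m + 1) → ℤ) (x : Cn m) : Cn m :=
  deriv (fun θ : ℝ => act p (Circle.exp (2 * Real.pi * θ)) x) 0

/-- `η` restricts to an `S¹`-invariant form on the sphere. -/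
def Invariant {m k : ℕ} (p : Fin (m + 1) → ℤ) (η : Form m k) : Prop :=
  ∀ t : Circle, ∀ x ∈ sphere (0 : Cn m) 1, ∀ v : Fin k → Cn m, Tangent x v →
    η (act p t x) (fun i => act p t (v i)) = η x v

/-- `η` restricts to a horizontal form on the sphere: it vanishes as soon as one of its arguments
is the fundamental vector field. -/
def Horizontal {m k : ℕ} (p : Fin (m + 1) → ℤ) (η : Form m k) : Prop :=
  ∀ x ∈ sphere (0 : Cn m) 1, ∀ v : Fin k → Cn m, Tangent x v →
    (∃ i, v i = fundField p x) → η x v = 0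

/-- `α` is a normalized connection form on the sphere: a smooth invariant `1`-form taking the
value `1` on the fundamental vector field of `∂/∂θ`. -/
structure IsNormalizedConnection {m : ℕ} (p : Fin (m + 1) → ℤ) (α : Form m 1) : Prop where
  smooth : SmoothOnSphere α
  invariant : Invariant p α
  normalized : ∀ x ∈ sphere (0 : Cn m) 1, α x (fun _ => fundField p x) = 1

/-! ### The orbifold `B = S^{2m+1} / S¹`: differential forms and de Rham cohomology

A differential form `Θ` on the orbifold `B` is identified with its pull-back `q^* Θ` along the
quotient map; the forms arising in this way are the basic (invariant and horizontal) ones. -/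

/-- The differential `k`-forms on `B`. -/
def basicForms {m : ℕ} (p : Fin (m + 1) → ℤ) (k : ℕ) : Submodule ℝ (Form m k) where
  carrier := {η | SmoothOnSphere η ∧ Invariant p η ∧ Horizontal p η}
  add_mem' := by
    rintro η β ⟨h1, h2, h3⟩ ⟨g1, g2, g3⟩
    refine ⟨fun x hx => (h1 x hx).add (g1 x hx), fun t x hx v hv => ?_, fun x hx v hv hi => ?_⟩
    · simp [h2 t x hx v hv, g2 t x hx v hv]
    · simp [h3 x hx v hv hi, g3 x hx v hv hi]
  zero_mem' := ⟨fun _ _ => contDiffAt_const, fun _ _ _ _ _ => rfl, fun _ _ _ _ _ => rfl⟩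
  smul_mem' := by
    rintro c η ⟨h1, h2, h3⟩
    refine ⟨fun x hx => (h1 x hx).const_smul c, fun t x hx v hv => ?_, fun x hx v hv hi => ?_⟩
    · simp [h2 t x hx v hv]
    · simp [h3 x hx v hv hi]

theorem SmoothOnSphere.differentiableAt {m k : ℕ} {η : Form m k} (h : SmoothOnSphere η) {x : Cn m}
    (hx : x ∈ sphere (0 : Cn m) 1) : DifferentiableAt ℝ η x :=
  (h x hx).differentiableAt (by simp)

/-- The closed differential `k`-forms on `B`. -/
def closedForms {m : ℕ} (p : Fin (m + 1) → ℤ) (k : ℕ) : Submodule ℝ (Form m k) where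
  carrier := {η | η ∈ basicForms p k ∧ SphereEq (extDeriv η) 0}
  add_mem' := by
    rintro η β ⟨h1, h2⟩ ⟨g1, g2⟩
    refine ⟨add_mem h1 g1, fun x hx v hv => ?_⟩
    rw [extDeriv_add (h1.1.differentiableAt hx) (g1.1.differentiableAt hx)]
    simp [h2 x hx v hv, g2 x hx v hv]
  zero_mem' := by
    refine ⟨zero_mem _, fun x _ v _ => ?_⟩
    have h := extDeriv_smul (x := x) (0 : ℝ) (0 : Form m k)
    rw [zero_smul, zero_smul] at h
    rw [h]; rfl
  smul_mem' := by
    rintro c η ⟨h1, h2⟩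
    refine ⟨Submodule.smul_mem _ c h1, fun x hx v hv => ?_⟩
    rw [extDeriv_smul]
    simp [h2 x hx v hv]

instance closedFormsAddCommGroup {m : ℕ} (p : Fin (m + 1) → ℤ) (k : ℕ) :
    AddCommGroup (closedForms p k) :=
  (closedForms p k).addCommGroup

/-- The exact differential `k`-forms on `B`. -/
def exactForms {m : ℕ} (p : Fin (m + 1) → ℤ) : (k : ℕ) → Submodule ℝ (Form m k)
  | 0 =>
    { carrier := {η | SphereEq η 0}
      add_mem' := by
        intro η β h g x hx v hv
        simp [h x hx v hv, g x hx v hv]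
      zero_mem' := fun _ _ _ _ => rfl
      smul_mem' := by
        intro c η h x hx v hv
        simp [h x hx v hv] }
  | k + 1 =>
    { carrier := {η | ∃ γ ∈ basicForms p k, SphereEq η (extDeriv γ)}
      add_mem' := by
        rintro η β ⟨γ, hγ, h⟩ ⟨δ, hδ, g⟩
        refine ⟨γ + δ, add_mem hγ hδ, fun x hx v hv => ?_⟩
        rw [extDeriv_add (hγ.1.differentiableAt hx) (hδ.1.differentiableAt hx)]
        simp [h x hx v hv, g x hx v hv]
      zero_mem' := by
        refine ⟨0, zero_mem _, fun x _ v _ => ?_⟩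
        have h := extDeriv_smul (x := x) (0 : ℝ) (0 : Form m k)
        rw [zero_smul, zero_smul] at h
        rw [h]; rfl
      smul_mem' := by
        rintro c η ⟨γ, hγ, h⟩
        refine ⟨c • γ, Submodule.smul_mem _ c hγ, fun x hx v hv => ?_⟩
        rw [extDeriv_smul]
        simp [h x hx v hv] }

/-- The de Rham cohomology `H^k(B; ℝ)`, closed forms modulo exact forms. -/
abbrev DeRham {m : ℕ} (p : Fin (m + 1) → ℤ) (k : ℕ) : Type :=
  closedForms p k ⧸ (exactForms p k).submoduleOf (closedForms p k)

/-- The cohomology class of a closed form on `B`. -/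
def deRhamClass {m k : ℕ} (p : Fin (m + 1) → ℤ) (η : closedForms p k) : DeRham p k :=
  Submodule.Quotient.mk η

/-- `c` is the first Chern class `c_1(S^{2m+1}, ψ)`: the class of the closed `2`-form `Θ_α` on `B`
with `q^* Θ_α = dα` for some normalized connection form `α`. -/
def IsFirstChernClass {m : ℕ} (p : Fin (m + 1) → ℤ) (c : DeRham p 2) : Prop :=
  ∃ α : Form m 1, IsNormalizedConnection p α ∧
    ∃ Θ : closedForms p 2, SphereEq (Θ : Form m 2) (extDeriv α) ∧ deRhamClass p Θ = c

/-- `C` is the cup power `c^r`: it is the class of `Θ ∧ ⋯ ∧ Θ` for a closed form `Θ` of class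
`c`. -/
def IsCupPower {m : ℕ} (p : Fin (m + 1) → ℤ) (c : DeRham p 2) (r : ℕ)
    (C : DeRham p (2 * r)) : Prop :=
  ∃ (Θ : closedForms p 2) (Ω : closedForms p (2 * r)), deRhamClass p Θ = c ∧
    SphereEq (Ω : Form m (2 * r)) (fun x => wedgePow ((Θ : Form m 2) x) r) ∧ deRhamClass p Ω = C

/-! ### Integration over the orbifold `B` -/

/-- The model `ℝ^{2m}` of orbifold charts of `B`. -/
abbrev Model (m : ℕ) : Type := EuclideanSpace ℝ (Fin (2 * m))

/-- The images of the standard basis of `ℝ^{2m}` under the derivative of `φ` at `u`. -/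
def pushFrame {m : ℕ} (φ : Model m → Cn m) (u : Model m) (k : Fin (2 * m)) : Cn m :=
  fderiv ℝ φ u (EuclideanSpace.single k 1)

/-- The determinant of the `2m + 2` vectors `φ(u)` (the outward normal), the fundamental vector field
at `φ(u)` and the derivatives of `φ` at `u`, relative to the standard oriented frame. -/
def transverseDet {m : ℕ} (p : Fin (m + 1) → ℤ) (φ : Model m → Cn m) (u : Model m) : ℝ :=
  Matrix.det (Matrix.of fun a b : Fin (2 * m + 2) =>
    ⟪realFrame m a,
      (Matrix.vecCons (φ u) (Matrix.vecCons (fundField p (φ u)) (pushFrame φ u)) :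
        Fin (2 * m + 2) → Cn m) b⟫)

/-- An orbifold chart of `B`, given by a slice of the action: an open `D ⊆ ℝ^{2m}` and an injective
immersion `φ : D → S^{2m+1}` transverse to the orbits, such that `t · φ(D)` equals `φ(D)` for `t` in
the cyclic group `Γ ⊂ S¹` of order `order` and is disjoint from it for all other `t`. So
`S¹ ×_Γ D` is an invariant open set in the sphere, and `D / Γ` an open set in `B`. -/
structure SliceChart {m : ℕ} (p : Fin (m + 1) → ℤ) where
  D : Set (Model m)
  φ : Model m → Cn m
  order : ℕ
  isOpen : IsOpen D
  smooth : ContDiffOn ℝ ∞ φ D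
  mem_sphere : ∀ u ∈ D, φ u ∈ sphere (0 : Cn m) 1
  injOn : InjOn φ D
  transverse : ∀ u ∈ D, transverseDet p φ u ≠ 0
  order_pos : 0 < order
  slice : ∀ u ∈ D, ∀ t : Circle, act p t (φ u) ∈ φ '' D ↔ t ^ order = 1

/-- A finite atlas of orbifold charts of `B` with a smooth partition of unity (by invariant
functions on the sphere) whose members have compact support in the charts. -/
structure ChartPartition {m : ℕ} (p : Fin (m + 1) → ℤ) where
  N : ℕ
  chart : Fin N → SliceChart p
  χ : Fin N → Cn m → ℝ
  smooth : ∀ i, ∀ x ∈ sphere (0 : Cn m) 1, ContDiffAt ℝ ∞ (χ i) x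
  invariant : ∀ i, ∀ t : Circle, ∀ x ∈ sphere (0 : Cn m) 1, χ i (act p t x) = χ i x
  nonneg : ∀ i, ∀ x ∈ sphere (0 : Cn m) 1, 0 ≤ χ i x
  sum_eq_one : ∀ x ∈ sphere (0 : Cn m) 1, ∑ i, χ i x = 1
  support : ∀ i, ∃ K ⊆ (chart i).D, IsCompact K ∧ ∀ x ∈ sphere (0 : Cn m) 1, χ i x ≠ 0 →
    ∃ t : Circle, act p t x ∈ (chart i).φ '' K

/-- The orbifold integral `∫_B η = ∑_i (1 / |Γ_i|) ∫_{D_i} φ_i^*(χ_i η)` of a form of top degree.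
`B` is oriented so that (fundamental vector field, `B`) is the orientation of the sphere; `D_i`
carries this orientation through the sign of `transverseDet`. -/
def ChartPartition.integral {m : ℕ} {p : Fin (m + 1) → ℤ} (P : ChartPartition p)
    (η : Form m (2 * m)) : ℝ :=
  ∑ i, (1 / ((P.chart i).order : ℝ)) * ∫ u in (P.chart i).D,
    (SignType.sign (transverseDet p (P.chart i).φ u) : ℝ) *
      (P.χ i ((P.chart i).φ u) * η ((P.chart i).φ u) (pushFrame (P.chart i).φ u))

/-- `⟨C, [B]⟩ = r` for a class `C ∈ H^{2m}(B; ℝ)` and the fundamental class of `B`: the integral over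
`B` of each closed form of class `C`, computed with any atlas and partition of unity, is `r`. -/
def HasPairing {m : ℕ} (p : Fin (m + 1) → ℤ) (C : DeRham p (2 * m)) (r : ℝ) : Prop :=
  Nonempty (ChartPartition p) ∧
    ∀ (P : ChartPartition p) (Ω : closedForms p (2 * m)), deRhamClass p Ω = C →
      P.integral (Ω : Form m (2 * m)) = r

end LinearCircleAction

end

noncomputable section

namespace LinearCircleAction

open MeasureTheory Metric Set
open scoped ContDiff RealInnerProductSpace TensorProduct

/-! ### The signed shuffle algebra of functions on lists -/

/-! Write `n = m + 1`, let `X` be the fundamental field, and let `ν = ⟪x, ·⟫` be the conormal. All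
three assertions rest on one principle: a top-degree form on the sphere whose contraction with `X`
vanishes is zero, because `X` has no zeros when all `p i ≠ 0` (`normalCoch_mul_eq_zero_of_contr`).
Together with Stokes' theorem it gives `∫ α ∧ dδ = ∫ dα ∧ δ = 0` for a connection `α` and a
horizontal `δ` of degree `2m - 1` (`integral_connection_mul_extD`). The curvature `dα` is itself
horizontal, by `ι_X dα = L_X α - d(ι_X α) = 0` (`IsNormalizedConnection.contr_extD`).

Two connections `α`, `β` differ by a basic form, so their curvatures are cohomologous on `B`, which
gives uniqueness of the Chern class. Moreover `(dα)^m - (dβ)^m = d((α - β) ∧ ∑ (dα)^i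
(dβ)^(m-1-i))`, so `∫ α ∧ (dα)^m` does not depend on `α` (`integral_connection_eq`). It is computed
for `α = ∑ (x_j dy_j - y_j dx_j) / (2π p_j)`. The curvature `ω = ∑ dx_j ∧ dy_j / (π p_j)` is
constant, the density of `α ∧ ω^m` on the sphere is the constant `(m!/2) ∏ 1/(π p_j)`, and the area
is `2 π^(m+1) / m!` (`integral_stdConn`).

The orbifold integral of a basic top form `η` equals `∫ α ∧ η` over the sphere
(`ChartPartition.integral_eq`). In the coordinates `(r, θ, u) ↦ r e^{2πiθ} φ(u)` the orbit parameter
runs over an interval of length `1/|Γ|`, which is the weight of the chart, and `α(X) = 1`. Any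
representative of the Chern class agrees on the sphere with the curvature of some connection, so the
pairing becomes the integral already computed. Atlases exist by the slice theorem
(`exists_sliceChart`) and by averaging bump functions over orbits (`nonempty_chartPartition`).

The exterior algebra is carried out in `Coch`, the functions on lists with the signed shuffle
product. There the product and the exterior derivative are recursive in the first argument, so
identities reduce to inductions on lists and degrees need no casts. The bridges to forms are
`ofForm_wedge` and `extD_ofForm`. Stokes' theorem on the sphere comes from the rotation invariance
of the surface measure, without charts. -/

/-- Functions on finite lists of vectors; alternating forms of all degrees embed into them. -/
def Coch (E : Type*) : Type _ := List E → ℝ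

namespace Coch

variable {E : Type*}

instance : AddCommGroup (Coch E) := inferInstanceAs (AddCommGroup (List E → ℝ))
instance : Module ℝ (Coch E) := inferInstanceAs (Module ℝ (List E → ℝ))

@[ext] theorem ext {f g : Coch E} (h : ∀ l, f l = g l) : f = g := funext h

@[simp] theorem add_apply (f g : Coch E) (l : List E) : (f + g) l = f l + g l := rfl
@[simp] theorem sub_apply (f g : Coch E) (l : List E) : (f - g) l = f l - g l := rfl
@[simp] theorem neg_apply (f : Coch E) (l : List E) : (-f) l = -f l := rfl
@[simp] theorem zero_apply (l : List E) : (0 : Coch E) l = 0 := rfl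
@[simp] theorem smul_apply (c : ℝ) (f : Coch E) (l : List E) : (c • f) l = c * f l := rfl

/-- Contraction with `v` in the first slot. -/
def contr (v : E) : Coch E →ₗ[ℝ] Coch E where
  toFun f := fun l => f (v :: l)
  map_add' _ _ := rfl
  map_smul' _ _ := rfl

@[simp] theorem contr_apply (v : E) (f : Coch E) (l : List E) : contr v f l = f (v :: l) := rfl

/-- The sign involution, `(-1)^k` in degree `k`. -/
def hat : Coch E →ₗ[ℝ] Coch E where
  toFun f := fun l => (-1) ^ l.length * f l
  map_add' f g := ext fun l => mul_add _ (f l) (g l)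
  map_smul' c f := ext fun l => mul_left_comm _ c (f l)

theorem hat_apply (f : Coch E) (l : List E) : hat f l = (-1) ^ l.length * f l := rfl

@[simp] theorem hat_nil (f : Coch E) : hat f [] = f [] := by simp [hat_apply]

@[simp] theorem contr_hat (v : E) (f : Coch E) : contr v (hat f) = -hat (contr v f) := by
  ext l; simp [hat_apply, pow_succ]

@[simp] theorem hat_hat (f : Coch E) : hat (hat f) = f := by
  ext l; simp [hat_apply, ← mul_assoc, ← mul_pow]

/-- The signed shuffle product. -/
def shuffle : List E → Coch E → Coch E → ℝ
  | [], f, g => f [] * g []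
  | v :: l, f, g => shuffle l (contr v f) g + shuffle l (hat f) (contr v g)

instance : Mul (Coch E) := ⟨fun f g l => shuffle l f g⟩

@[simp] theorem mul_nil (f g : Coch E) : (f * g) [] = f [] * g [] := rfl

/-- Contraction is an antiderivation by definition of the product. With the value on `[]` this
determines the product, and the algebraic laws below follow by induction on the list of arguments.
-/
theorem contr_mul (v : E) (f g : Coch E) :
    contr v (f * g) = contr v f * g + hat f * contr v g := rfl

theorem mul_cons (f g : Coch E) (v : E) (l : List E) :
    (f * g) (v :: l) = (contr v f * g) l + (hat f * contr v g) l := rfl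

instance : One (Coch E) := ⟨fun l => if l = [] then 1 else 0⟩

@[simp] theorem one_nil : (1 : Coch E) [] = 1 := rfl
@[simp] theorem contr_one (v : E) : contr v (1 : Coch E) = 0 := rfl
@[simp] theorem hat_one : hat (1 : Coch E) = 1 := by
  ext l
  cases l with
  | nil => simp
  | cons v l => exact mul_zero _

theorem ext_contr {f g : Coch E} (h0 : f [] = g []) (h : ∀ v, contr v f = contr v g) : f = g := by
  ext l
  cases l with
  | nil => exact h0
  | cons v l => exact congrFun (h v) l

theorem add_mul' (f g h : Coch E) : (f + g) * h = f * h + g * h := by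
  ext l
  induction l generalizing f g h with
  | nil => simp [add_mul]
  | cons v l ih => simp only [mul_cons, add_apply, map_add, ih]; ring

theorem mul_add' (f g h : Coch E) : f * (g + h) = f * g + f * h := by
  ext l
  induction l generalizing f g h with
  | nil => simp [mul_add]
  | cons v l ih => simp only [mul_cons, add_apply, map_add, ih]; ring

theorem smul_mul' (c : ℝ) (f g : Coch E) : c • f * g = c • (f * g) := by
  ext l
  induction l generalizing f g with
  | nil => simp [mul_assoc]
  | cons v l ih => simp only [mul_cons, smul_apply, map_smul, ih]; ring

theorem mul_smul' (c : ℝ) (f g : Coch E) : f * c • g = c • (f * g) := by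
  ext l
  induction l generalizing f g with
  | nil => simp; ring
  | cons v l ih => simp only [mul_cons, smul_apply, map_smul, ih]; ring

theorem hat_mul (f g : Coch E) : hat (f * g) = hat f * hat g := by
  ext l
  induction l generalizing f g with
  | nil => simp
  | cons v l ih =>
    have h1 := ih (contr v f) g
    have h2 := ih (hat f) (contr v g)
    rw [← contr_apply v (hat (f * g)), contr_hat, contr_mul, map_add, mul_cons, contr_hat,
      contr_hat]
    rw [← neg_one_smul ℝ (hat (contr v f)), ← neg_one_smul ℝ (hat (contr v g)), smul_mul',
      mul_smul']
    simp only [neg_apply, add_apply, smul_apply, h1, h2]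
    ring

theorem mul_assoc' (f g h : Coch E) : f * g * h = f * (g * h) := by
  ext l
  induction l generalizing f g h with
  | nil => simp [mul_assoc]
  | cons v l ih =>
    simp only [mul_cons, contr_mul, hat_mul, add_mul', mul_add', add_apply, ih]; ring

theorem one_mul' (f : Coch E) : 1 * f = f := by
  ext l
  induction l generalizing f with
  | nil => simp
  | cons v l ih =>
    rw [mul_cons, contr_one, hat_one, ih, ← zero_smul ℝ (0 : Coch E), smul_mul']; simp

theorem mul_one' (f : Coch E) : f * 1 = f := by
  ext l
  induction l generalizing f with
  | nil => simp
  | cons v l ih =>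
    rw [mul_cons, contr_one, ih, ← zero_smul ℝ (0 : Coch E), mul_smul']; simp

instance : Ring (Coch E) where
  left_distrib := mul_add'
  right_distrib := add_mul'
  zero_mul f := by rw [← zero_smul ℝ (0 : Coch E), smul_mul']; simp
  mul_zero f := by rw [← zero_smul ℝ (0 : Coch E), mul_smul']; simp
  mul_assoc := mul_assoc'
  one_mul := one_mul'
  mul_one := mul_one'
  neg_add_cancel := neg_add_cancel
  zsmul := fun n f => n • f
  zsmul_zero' := SubNegMonoid.zsmul_zero'
  zsmul_succ' := SubNegMonoid.zsmul_succ'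
  zsmul_neg' := SubNegMonoid.zsmul_neg'

instance : Algebra ℝ (Coch E) :=
  Algebra.ofModule (fun c f g => smul_mul' c f g) (fun c f g => mul_smul' c f g)

@[simp] theorem sum_apply {ι : Type*} (s : Finset ι) (f : ι → Coch E) (l : List E) :
    (∑ i ∈ s, f i) l = ∑ i ∈ s, f i l := Finset.sum_apply l s f

/-- Even elements are central. -/
theorem mul_comm_hat (f g : Coch E) :
    (hat f = f → f * g = g * f) ∧ (hat f = -f → f * g = hat g * f) := by
  -- Contraction exchanges even and odd elements, so both cases have to go through the induction
  -- together.
  suffices h : ∀ l, ∀ f g : Coch E,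
      (hat f = f → (f * g) l = (g * f) l) ∧ (hat f = -f → (f * g) l = (hat g * f) l) from
    ⟨fun hf => ext fun l => (h l f g).1 hf, fun hf => ext fun l => (h l f g).2 hf⟩
  intro l
  induction l with
  | nil => intro f g; simp [mul_comm]
  | cons v l ih =>
    intro f g
    have hc (f : Coch E) : hat (contr v f) = -contr v (hat f) := by simp
    refine ⟨fun hf => ?_, fun hf => ?_⟩
    · rw [mul_cons, mul_cons, hf, (ih (contr v f) g).2 (by rw [hc, hf]),
        (ih f (contr v g)).1 hf, add_comm]
    · rw [mul_cons, mul_cons, hf, (ih (contr v f) g).1 (by rw [hc, hf]; simp), neg_mul, neg_apply,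
        (ih f (contr v g)).2 hf, contr_hat, neg_mul, neg_apply, hat_hat, add_comm]

theorem even_comm {f : Coch E} (hf : hat f = f) (g : Coch E) : f * g = g * f :=
  (mul_comm_hat f g).1 hf

/-- Contraction of a power of an even element. -/
theorem contr_pow_succ {f : Coch E} (hf : hat f = f) (v : E) (n : ℕ) :
    contr v (f ^ (n + 1)) = ((n : ℝ) + 1) • (contr v f * f ^ n) := by
  induction n with
  | zero => simp
  | succ n ih =>
    rw [pow_succ', contr_mul, hf, ih, Algebra.mul_smul_comm, ← mul_assoc, even_comm hf (contr v f), mul_assoc,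
      ← pow_succ', Nat.cast_succ, add_smul ((n : ℝ) + 1) (1 : ℝ), one_smul, add_comm]

/-! ### Restriction to a set of vectors -/

/-- `f` and `g` agree on lists of vectors of `T`. -/
def EqOn (T : Set E) (f g : Coch E) : Prop := ∀ l : List E, (∀ v ∈ l, v ∈ T) → f l = g l

namespace EqOn
variable {T : Set E} {f f' g g' : Coch E}

theorem refl (f : Coch E) : EqOn T f f := fun _ _ => rfl
theorem trans (h : EqOn T f g) (h' : EqOn T g g') : EqOn T f g' :=
  fun l hl => (h l hl).trans (h' l hl)
theorem add (h : EqOn T f g) (h' : EqOn T f' g') : EqOn T (f + f') (g + g') :=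
  fun l hl => by simp [h l hl, h' l hl]
theorem contr {v : E} (hv : v ∈ T) (h : EqOn T f g) : EqOn T (contr v f) (contr v g) :=
  fun l hl => h (v :: l) (by simpa using ⟨hv, hl⟩)
theorem hat (h : EqOn T f g) : EqOn T (hat f) (hat g) :=
  fun l hl => by simp [hat_apply, h l hl]
theorem sum {ι : Type*} {s : Finset ι} {f g : ι → Coch E} (h : ∀ i ∈ s, EqOn T (f i) (g i)) :
    EqOn T (∑ i ∈ s, f i) (∑ i ∈ s, g i) :=
  fun l hl => by simp only [sum_apply]; exact Finset.sum_congr rfl fun i hi => h i hi l hl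

/-- A product evaluated on a list uses its factors only on sublists. With `T` a tangent space, this
says that restriction to the sphere respects exterior products. -/
theorem mul (h : EqOn T f g) (h' : EqOn T f' g') : EqOn T (f * f') (g * g') := by
  intro l
  induction l generalizing f f' g g' with
  | nil => intro _; simp [h [] (by simp), h' [] (by simp)]
  | cons v l ih =>
    intro hl
    have hv : v ∈ T := hl v (by simp)
    have hl' : ∀ w ∈ l, w ∈ T := fun w hw => hl w (by simp [hw])
    rw [mul_cons, mul_cons, ih (h.contr hv) h' hl', ih h.hat (h'.contr hv) hl']

theorem pow (h : EqOn T f g) (n : ℕ) : EqOn T (f ^ n) (g ^ n) := by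
  induction n with
  | zero => simpa using refl 1
  | succ n ih => rw [pow_succ, pow_succ]; exact ih.mul h

end EqOn

/-- If the contractions of two elements with a vector vanish on `T`, so does that of
their product. -/
theorem contr_mul_eqOn_zero {T : Set E} {v : E} {f g : Coch E}
    (hf : EqOn T (contr v f) 0) (hg : EqOn T (contr v g) 0) : EqOn T (contr v (f * g)) 0 := by
  rw [contr_mul]
  simpa using (hf.mul (.refl g)).add ((EqOn.refl (hat f)).mul hg)

theorem contr_pow_eqOn_zero {T : Set E} {v : E} {f : Coch E}
    (hf : EqOn T (contr v f) 0) (n : ℕ) : EqOn T (contr v (f ^ n)) 0 := by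
  induction n with
  | zero => simpa using EqOn.refl 0
  | succ n ih => rw [pow_succ]; exact contr_mul_eqOn_zero ih hf

end Coch

namespace Coch

variable {E : Type*}

/-! ### Signed sums over permutations -/

/-- The signed sum of `M` over all reorderings of `v`. -/
def signedSum {n : ℕ} (M : Coch E) (v : Fin n → E) : ℝ :=
  ∑ σ : Equiv.Perm (Fin n), (Equiv.Perm.sign σ : ℤ) * M (List.ofFn fun i => v (σ i))

theorem ofFn_insertNth {n : ℕ} (p : Fin (n + 1)) (x : E) (v : Fin n → E) :
    List.ofFn (p.insertNth (α := fun _ => E) x v) = (List.ofFn v).insertIdx p x := by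
  induction n with
  | zero =>
    obtain rfl : p = 0 := Fin.eq_zero p
    simp
  | succ n ih =>
    cases p using Fin.cases with
    | zero => simp [List.ofFn_succ]
    | succ p =>
      rw [List.ofFn_succ, List.ofFn_succ (f := v), Fin.val_succ, List.insertIdx_succ_cons, ← ih]
      refine congrArg (fun w => v 0 :: List.ofFn w) (funext fun i => ?_)
      refine Fin.succAboveCases p ?_ (fun j => ?_) i
      · simp
      · rw [← Fin.succ_succAbove_succ, Fin.insertNth_apply_succAbove,
          Fin.insertNth_apply_succAbove]

/-- Insertion of `x` at position `p`. -/
def insertAt (p : ℕ) (x : E) (M : Coch E) : Coch E := fun l => M (l.insertIdx p x)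

/-- A reordering of `x, v` is a position `p` for `x` together with a reordering of `v`; moving `x`
from the front to position `p` is a cycle of sign `(-1)^p`. -/
theorem signedSum_cons {n : ℕ} (M : Coch E) (x : E) (v : Fin n → E) :
    signedSum M (Fin.cons x v : Fin (n + 1) → E) =
      ∑ p : Fin (n + 1), (-1) ^ (p : ℕ) * signedSum (insertAt p x M) v := by
  -- `p.cycleRange` sends `p` to `0` and shifts the smaller indices up; the other factor fixes `0`
  -- and permutes the rest by `q.2`.
  have hbij : Function.Bijective (fun q : Fin (n + 1) × Equiv.Perm (Fin n) =>
      Equiv.Perm.decomposeFin.symm (0, q.2) * q.1.cycleRange) := by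
    rw [Fintype.bijective_iff_injective_and_card]
    refine ⟨?_, by simp [Fintype.card_perm, Nat.factorial_succ]⟩
    rintro ⟨p, e⟩ ⟨p', e'⟩ h
    simp only at h
    have hp : ∀ (p : Fin (n + 1)) (e : Equiv.Perm (Fin n)),
        (Equiv.Perm.decomposeFin.symm (0, e) * p.cycleRange) p = 0 := by
      intro p e; simp
    obtain rfl : p = p' :=
      (Equiv.Perm.decomposeFin.symm (0, e) * p.cycleRange).injective
        ((hp p e).trans ((hp p' e').symm.trans (by rw [h])))
    have := Equiv.Perm.decomposeFin.symm.injective (mul_right_cancel h)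
    simp_all
  simp only [signedSum]
  rw [← hbij.sum_comp, Fintype.sum_prod_type]
  refine Finset.sum_congr rfl fun p _ => ?_
  rw [Finset.mul_sum]
  refine Finset.sum_congr rfl fun e _ => ?_
  have hfn : (fun i => (Fin.cons x v : Fin (n + 1) → E)
      ((Equiv.Perm.decomposeFin.symm (0, e) * p.cycleRange) i)) =
      p.insertNth (α := fun _ => E) x (fun i => v (e i)) := by
    funext i
    refine Fin.succAboveCases p ?_ (fun j => ?_) i
    · simp
    · simp [Fin.cycleRange_succAbove]
  simp only [hfn, ofFn_insertNth, insertAt]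
  simp [Equiv.Perm.decomposeFin.symm_sign, Fin.sign_cycleRange]
  ring

/-! ### Homogeneous alternating functions of lists -/

/-- `f` is concentrated in degree `k`. -/
def Homog (k : ℕ) (f : Coch E) : Prop := ∀ l : List E, l.length ≠ k → f l = 0

/-- `f` changes sign according to the position of insertion. -/
def SignAlt (f : Coch E) : Prop :=
  ∀ (p : ℕ) (u : List E) (x : E), p ≤ u.length → f (u.insertIdx p x) = (-1) ^ p * f (x :: u)

theorem Homog.contr {k : ℕ} {f : Coch E} (h : Homog (k + 1) f) (x : E) : Homog k (contr x f) :=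
  fun l hl => h (x :: l) (by simpa using hl)

theorem Homog.contr_zero {f : Coch E} (h : Homog 0 f) (x : E) : Coch.contr x f = 0 :=
  ext fun l => h (x :: l) (by simp)

theorem Homog.hat_eq {k : ℕ} {f : Coch E} (h : Homog k f) : hat f = ((-1 : ℝ) ^ k) • f := by
  ext l
  by_cases hl : l.length = k
  · simp [hat_apply, hl]
  · simp [hat_apply, h l hl]

theorem Homog.smul {k : ℕ} {f : Coch E} (h : Homog k f) (c : ℝ) : Homog k (c • f) :=
  fun l hl => by simp [h l hl]

theorem Homog.mul {k l : ℕ} {f g : Coch E} (hf : Homog k f) (hg : Homog l g) :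
    Homog (k + l) (f * g) := by
  intro u
  induction u generalizing k l f g with
  | nil =>
    intro h
    rcases Nat.eq_zero_or_pos k with rfl | hk
    · rw [mul_nil, hg [] (by simpa using h), mul_zero]
    · rw [mul_nil, hf [] (by simpa using hk.ne), zero_mul]
  | cons x u ih =>
    intro h
    rw [mul_cons]
    have h1 : (Coch.contr x f * g) u = 0 := by
      cases k with
      | zero => rw [hf.contr_zero, zero_mul, zero_apply]
      | succ k => exact ih (hf.contr x) hg (by simp at h; omega)
    have h2 : (hat f * Coch.contr x g) u = 0 := by
      cases l with
      | zero => rw [hg.contr_zero, mul_zero, zero_apply]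
      | succ l => exact ih (by rw [hf.hat_eq]; exact hf.smul _) (hg.contr x) (by simp at h; omega)
    rw [h1, h2, add_zero]

/-- The vector `x` stays in front: inserting `y` behind it costs one extra sign, which is taken back
by exchanging `x` and `y`, the case `p = 1` of the hypothesis. -/
theorem SignAlt.contr {f : Coch E} (h : SignAlt f) (x : E) : SignAlt (contr x f) := by
  intro p u y hp
  have h1 := h (p + 1) (x :: u) y (by simpa using hp)
  have h2 := h 1 (y :: u) x (by simp)
  simp only [List.insertIdx_succ_cons, List.insertIdx_zero, pow_one] at h1 h2
  change f (x :: u.insertIdx p y) = (-1) ^ p * f (x :: y :: u)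
  linear_combination h1 - (-1) ^ p * h2

/-- The tensor product of `f`, evaluated on the first `k` vectors, with `g`. -/
def tensor (k : ℕ) (f g : Coch E) : Coch E := fun l => f (l.take k) * g (l.drop k)

theorem signedSum_congr {n : ℕ} {M N : Coch E} (v : Fin n → E)
    (h : ∀ l : List E, l.length = n → M l = N l) : signedSum M v = signedSum N v :=
  Finset.sum_congr rfl fun σ _ => by rw [h _ (by simp)]

theorem signedSum_smul {n : ℕ} (c : ℝ) (M : Coch E) (v : Fin n → E) :
    signedSum (c • M) v = c * signedSum M v := by
  simp only [signedSum, smul_apply, Finset.mul_sum]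
  exact Finset.sum_congr rfl fun σ _ => by ring

theorem take_succ_insertIdx (k : ℕ) : ∀ (p : ℕ) (u : List E) (x : E), p ≤ k →
    p ≤ u.length → (u.insertIdx p x).take (k + 1) = (u.take k).insertIdx p x := by
  induction k with
  | zero => intro p u x h1 h2; obtain rfl : p = 0 := by omega
            simp
  | succ k ih =>
    intro p u x h1 h2
    cases p with
    | zero => simp
    | succ p =>
      cases u with
      | nil => simp at h2
      | cons y u => simp only [List.insertIdx_succ_cons, List.take_succ_cons]
                    rw [ih p u x (by omega) (by simpa using h2)]

theorem drop_succ_insertIdx (k : ℕ) : ∀ (p : ℕ) (u : List E) (x : E), p ≤ k →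
    p ≤ u.length → (u.insertIdx p x).drop (k + 1) = u.drop k := by
  induction k with
  | zero => intro p u x h1 h2; obtain rfl : p = 0 := by omega
            simp
  | succ k ih =>
    intro p u x h1 h2
    cases p with
    | zero => simp
    | succ p =>
      cases u with
      | nil => simp at h2
      | cons y u => simp only [List.insertIdx_succ_cons, List.drop_succ_cons]
                    rw [ih p u x (by omega) (by simpa using h2)]

theorem drop_insertIdx_add (k : ℕ) : ∀ (p : ℕ) (u : List E) (x : E), k + p ≤ u.length →
    (u.insertIdx (k + p) x).drop k = (u.drop k).insertIdx p x := by
  induction k with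
  | zero => intro p u x _; simp
  | succ k ih =>
    intro p u x h
    cases u with
    | nil => simp at h
    | cons y u =>
      rw [show k + 1 + p = (k + p) + 1 by ring, List.insertIdx_succ_cons, List.drop_succ_cons,
        List.drop_succ_cons, ih p u x (by simp at h; omega)]

/-- Sort the reorderings by the position of the first vector `x`. Each position in the first block
contributes the same multiple of `contr x f * g`, each position in the second block the same
multiple of `hat f * contr x g`, where the sign `(-1)^k` comes from passing the first block.
Counting positions turns `k!` into `(k + 1)!`, respectively `l!` into `(l + 1)!`, and the recursion
is that of the shuffle product. -/
theorem signedSum_tensor {n : ℕ} (v : Fin n → E) : ∀ {k l : ℕ} {f g : Coch E}, n = k + l →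
    Homog k f → Homog l g → SignAlt f → SignAlt g →
    signedSum (tensor k f g) v = (k.factorial * l.factorial : ℝ) * (f * g) (List.ofFn v) := by
  induction n with
  | zero =>
    intro k l f g h _ _ _ _
    obtain ⟨rfl, rfl⟩ : k = 0 ∧ l = 0 := by omega
    simp [signedSum, tensor]
  | succ n ih =>
    intro k l f g h hf hg hf' hg'
    have hv : v = Fin.cons (v 0) (Fin.tail v) := (Fin.cons_self_tail v).symm
    generalize v 0 = x at hv
    generalize Fin.tail v = w at hv
    subst hv
    have hl : List.ofFn (Fin.cons x w : Fin (n + 1) → E) = x :: List.ofFn w := by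
      simp [List.ofFn_succ]
    rw [signedSum_cons, hl, mul_cons, mul_add]
    have hsplit : ∀ F : ℕ → ℝ, ∑ p : Fin (n + 1), F p =
        ∑ p ∈ Finset.range k, F p + ∑ q ∈ Finset.range l, F (k + q) := by
      intro F
      rw [Fin.sum_univ_eq_sum_range, h, Finset.sum_range_add]
    rw [hsplit fun p => (-1) ^ p * signedSum (insertAt p x (tensor k f g)) w]
    congr 1
    · cases k with
      | zero => rw [hf.contr_zero]; simp
      | succ k =>
        have hterm : ∀ p ∈ Finset.range (k + 1),
            (-1) ^ p * signedSum (insertAt p x (tensor (k + 1) f g)) w =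
              (k.factorial * l.factorial : ℝ) * (contr x f * g) (List.ofFn w) := by
          intro p hp
          have hp : p ≤ k := by simpa [Nat.lt_succ_iff] using hp
          rw [← ih w (by omega) (hf.contr x) hg (hf'.contr x) hg', ← signedSum_smul]
          refine signedSum_congr w fun u hu => ?_
          have hpu : p ≤ u.length := by omega
          rw [smul_apply, insertAt, tensor, take_succ_insertIdx k p u x hp hpu,
            drop_succ_insertIdx k p u x hp hpu, hf' p _ x (by simp; omega), tensor, contr_apply,
            ← mul_assoc, ← mul_assoc, ← mul_pow]
          simp
        rw [Finset.sum_congr rfl hterm, Finset.sum_const, Finset.card_range, nsmul_eq_mul,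
          Nat.factorial_succ]
        push_cast; ring
    · cases l with
      | zero => rw [hg.contr_zero]; simp
      | succ l =>
        have hterm : ∀ q ∈ Finset.range (l + 1),
            (-1) ^ (k + q) * signedSum (insertAt (k + q) x (tensor k f g)) w =
              (k.factorial * l.factorial : ℝ) * (hat f * contr x g) (List.ofFn w) := by
          intro q hq
          have hq : q ≤ l := by simpa [Nat.lt_succ_iff] using hq
          rw [hf.hat_eq, smul_mul_assoc, smul_apply, mul_left_comm,
            ← ih w (by omega) hf (hg.contr x) hf' (hg'.contr x), ← signedSum_smul,
            ← signedSum_smul]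
          refine signedSum_congr w fun u hu => ?_
          rw [smul_apply, smul_apply, insertAt, tensor, drop_insertIdx_add k q u x (by omega),
            List.take_insertIdx_eq_take_of_le _ _ _ _ (by omega), hg' q _ x (by simp; omega),
            tensor, contr_apply, pow_add]
          have : ((-1 : ℝ) ^ q) * (-1) ^ q = 1 := by rw [← mul_pow]; simp
          linear_combination (-1) ^ k * f (List.take k u) * g (x :: List.drop k u) * this
        rw [Finset.sum_congr rfl hterm, Finset.sum_const, Finset.card_range, nsmul_eq_mul,
          Nat.factorial_succ]
        push_cast; ring

theorem exists_ofFn_of_length {k : ℕ} {l : List E} (h : l.length = k) :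
    ∃ v : Fin k → E, l = List.ofFn v := by
  subst h; exact ⟨l.get, (List.ofFn_get l).symm⟩

theorem Homog.ext {k : ℕ} {f g : Coch E} (hf : Homog k f) (hg : Homog k g)
    (h : ∀ v : Fin k → E, f (List.ofFn v) = g (List.ofFn v)) : f = g := by
  ext l
  by_cases hl : l.length = k
  · obtain ⟨v, rfl⟩ := exists_ofFn_of_length hl
    exact h v
  · rw [hf l hl, hg l hl]

/-! ### Alternating forms as functions on lists -/

variable [NormedAddCommGroup E] [NormedSpace ℝ E]

/-- The function on lists of an alternating form. -/
def ofForm {k : ℕ} (a : E [⋀^Fin k]→L[ℝ] ℝ) : Coch E :=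
  fun l => if h : l.length = k then a (fun i => l.get (i.cast h.symm)) else 0

theorem ofForm_ofFn {k : ℕ} (a : E [⋀^Fin k]→L[ℝ] ℝ) (v : Fin k → E) :
    ofForm a (List.ofFn v) = a v := by
  simp [ofForm]

theorem homog_ofForm {k : ℕ} (a : E [⋀^Fin k]→L[ℝ] ℝ) : Homog k (ofForm a) :=
  fun _ hl => dif_neg hl

theorem ofForm_add {k : ℕ} (a b : E [⋀^Fin k]→L[ℝ] ℝ) : ofForm (a + b) = ofForm a + ofForm b := by
  ext l
  by_cases h : l.length = k <;> simp [ofForm, h]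

theorem ofForm_sub {k : ℕ} (a b : E [⋀^Fin k]→L[ℝ] ℝ) : ofForm (a - b) = ofForm a - ofForm b := by
  ext l
  by_cases h : l.length = k <;> simp [ofForm, h]

theorem ofForm_smul {k : ℕ} (c : ℝ) (a : E [⋀^Fin k]→L[ℝ] ℝ) :
    ofForm (c • a) = c • ofForm a := by
  ext l
  by_cases h : l.length = k <;> simp [ofForm, h]

@[simp] theorem ofForm_zero {k : ℕ} : ofForm (0 : E [⋀^Fin k]→L[ℝ] ℝ) = 0 := by
  ext l
  by_cases h : l.length = k <;> simp [ofForm, h]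

theorem contr_ofForm {k : ℕ} (a : E [⋀^Fin (k + 1)]→L[ℝ] ℝ) (x : E) :
    contr x (ofForm a) = ofForm (a.curryLeft x) :=
  ((homog_ofForm a).contr x).ext (homog_ofForm _) fun v => by
    rw [ofForm_ofFn, contr_apply, ← List.ofFn_cons, ofForm_ofFn]; rfl

theorem contr_ofForm_zero (a : E [⋀^Fin 0]→L[ℝ] ℝ) (x : E) : contr x (ofForm a) = 0 :=
  (homog_ofForm a).contr_zero x

theorem signAlt_ofForm {k : ℕ} (a : E [⋀^Fin k]→L[ℝ] ℝ) : SignAlt (ofForm a) := by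
  intro p u x hp
  by_cases h : u.length + 1 = k
  · subst h
    generalize hn : u.length = n at a hp
    obtain ⟨v, rfl⟩ := exists_ofFn_of_length hn
    have := a.toAlternatingMap.map_insertNth ⟨p, Nat.lt_succ_of_le hp⟩ x v
    have h1 := ofFn_insertNth (⟨p, Nat.lt_succ_of_le hp⟩ : Fin (n + 1)) x v
    simp only at h1
    rw [← h1, ← List.ofFn_cons, ofForm_ofFn, ofForm_ofFn]
    refine this.trans ?_
    rw [zsmul_eq_mul]; push_cast; rfl
  · rw [homog_ofForm a _ (by rwa [List.length_insertIdx_of_le_length hp]),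
      homog_ofForm a _ (by simpa using h), mul_zero]

theorem EqOn.ofForm_iff {k : ℕ} {T : Set E} (a b : E [⋀^Fin k]→L[ℝ] ℝ) :
    EqOn T (ofForm a) (ofForm b) ↔ ∀ v : Fin k → E, (∀ i, v i ∈ T) → a v = b v := by
  refine ⟨fun h v hv => ?_, fun h l hl => ?_⟩
  · have := h (List.ofFn v) (by simpa [List.mem_ofFn] using hv)
    rwa [ofForm_ofFn, ofForm_ofFn] at this
  · by_cases hk : l.length = k
    · obtain ⟨v, rfl⟩ := exists_ofFn_of_length hk
      rw [ofForm_ofFn, ofForm_ofFn]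
      exact h v fun i => hl _ (by simp [List.mem_ofFn])
    · rw [homog_ofForm a l hk, homog_ofForm b l hk]

end Coch

/-! ### The exterior product of forms as a shuffle product -/

open Coch

/-- Alternating the tensor product over all permutations counts every `(k, l)`-shuffle `k! l!`
times, once for each pair of permutations of the two blocks. -/
theorem wedge_apply_eq {m k l : ℕ} (a : Cn m [⋀^Fin k]→L[ℝ] ℝ) (b : Cn m [⋀^Fin l]→L[ℝ] ℝ)
    (v : Fin (k + l) → Cn m) :
    (k.factorial * l.factorial : ℝ) * wedge a b v = signedSum (tensor k (ofForm a) (ofForm b)) v := by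
  have h := MultilinearMap.domCoprod_alternization_eq a.toAlternatingMap b.toAlternatingMap
  have h2 := congrArg (fun F => LinearMap.mul' ℝ ℝ (F fun i => v (finSumFinEquiv i))) h
  simp only [Fintype.card_fin, AlternatingMap.smul_apply, map_nsmul] at h2
  rw [MultilinearMap.alternatization_apply, map_sum] at h2
  have h3 : wedge a b v = LinearMap.mul' ℝ ℝ
      ((a.toAlternatingMap.domCoprod b.toAlternatingMap) fun i => v (finSumFinEquiv i)) := rfl
  rw [h3, ← Nat.cast_mul, ← nsmul_eq_mul, ← h2, signedSum]
  refine Fintype.sum_equiv (Equiv.permCongr finSumFinEquiv) _ _ fun σ => ?_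
  rw [Units.smul_def, map_zsmul, zsmul_eq_mul, Equiv.Perm.sign_permCongr]
  congr 1
  have e1 : (List.ofFn fun i => v ((finSumFinEquiv.permCongr σ) i)).take k =
      List.ofFn fun i : Fin k => v (finSumFinEquiv (σ (Sum.inl i))) := by
    rw [List.ofFn_add, List.take_left' (by simp)]
    simp only [Equiv.permCongr_apply]
    congr 1; funext i
    exact congrArg (fun j => v (finSumFinEquiv (σ j))) (finSumFinEquiv_symm_apply_castAdd i)
  have e2 : (List.ofFn fun i => v ((finSumFinEquiv.permCongr σ) i)).drop k =
      List.ofFn fun i : Fin l => v (finSumFinEquiv (σ (Sum.inr i))) := by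
    rw [List.ofFn_add]
    simp [Equiv.permCongr_apply]
  rw [tensor, e1, e2, ofForm_ofFn, ofForm_ofFn]
  rfl

/-- The exterior product is the shuffle product. -/
theorem ofForm_wedge {m k l : ℕ} (a : Cn m [⋀^Fin k]→L[ℝ] ℝ) (b : Cn m [⋀^Fin l]→L[ℝ] ℝ) :
    ofForm (wedge a b) = ofForm a * ofForm b := by
  refine (homog_ofForm _).ext ((homog_ofForm a).mul (homog_ofForm b)) fun v => ?_
  have h := wedge_apply_eq a b v
  rw [signedSum_tensor v rfl (homog_ofForm a) (homog_ofForm b) (signAlt_ofForm a)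
    (signAlt_ofForm b)] at h
  rw [ofForm_ofFn]
  exact mul_left_cancel₀ (by positivity) h

theorem ofForm_wedgePow {m : ℕ} (η : Cn m [⋀^Fin 2]→L[ℝ] ℝ) (r : ℕ) :
    ofForm (wedgePow η r) = ofForm η ^ r := by
  induction r with
  | zero =>
    rw [pow_zero]
    ext l
    cases l with
    | nil => rfl
    | cons x l => exact homog_ofForm _ _ (by simp)
  | succ r ih =>
    rw [pow_succ, ← ih, ← ofForm_wedge]
    rfl

/-! ### Differential calculus of families of cochains -/

namespace Coch

section Calculus

variable {E : Type*} [NormedAddCommGroup E] [NormedSpace ℝ E]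

/-- All coefficients of `ξ` are smooth at `x`. -/
def SmoothAt (ξ : E → Coch E) (x : E) : Prop := ∀ l, ContDiffAt ℝ ∞ (fun y => ξ y l) x

/-- The coefficientwise derivative in the direction `v`. -/
def dirDeriv (v : E) (ξ : E → Coch E) : E → Coch E := fun x l => fderiv ℝ (fun y => ξ y l) x v

/-- The exterior derivative, determined by `ι_v d + d ι_v = D_v` for constant `v`. -/
def extDCoeff : List E → (E → Coch E) → E → ℝ
  | [], _, _ => 0
  | v :: l, ξ, x => dirDeriv v ξ x l - extDCoeff l (fun y => contr v (ξ y)) x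

/-- The exterior derivative of a family of cochains. -/
def extD (ξ : E → Coch E) : E → Coch E := fun x l => extDCoeff l ξ x

@[simp] theorem extD_nil (ξ : E → Coch E) (x : E) : extD ξ x [] = 0 := rfl

theorem extD_cons (ξ : E → Coch E) (x v : E) (l : List E) :
    extD ξ x (v :: l) = dirDeriv v ξ x l - extD (fun y => contr v (ξ y)) x l := rfl

theorem contr_extD (ξ : E → Coch E) (x v : E) :
    contr v (extD ξ x) = dirDeriv v ξ x - extD (fun y => contr v (ξ y)) x := rfl

variable {ξ η : E → Coch E} {x : E}

theorem SmoothAt.differentiableAt (h : SmoothAt ξ x) (l : List E) :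
    DifferentiableAt ℝ (fun y => ξ y l) x := (h l).differentiableAt (by simp)

theorem SmoothAt.contr (h : SmoothAt ξ x) (v : E) : SmoothAt (fun y => contr v (ξ y)) x :=
  fun l => h (v :: l)

theorem SmoothAt.sub (h : SmoothAt ξ x) (h' : SmoothAt η x) : SmoothAt (fun y => ξ y - η y) x :=
  fun l => (h l).sub (h' l)

theorem SmoothAt.hat (h : SmoothAt ξ x) : SmoothAt (fun y => hat (ξ y)) x :=
  fun l => contDiffAt_const.mul (h l)

theorem SmoothAt.const (c : Coch E) : SmoothAt (fun _ => c) x := fun _ => contDiffAt_const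

theorem SmoothAt.sum {ι : Type*} {s : Finset ι} {ξ : ι → E → Coch E}
    (h : ∀ i ∈ s, SmoothAt (ξ i) x) : SmoothAt (fun y => ∑ i ∈ s, ξ i y) x := fun l => by
  simp only [sum_apply]
  exact ContDiffAt.sum fun i hi => h i hi l

theorem SmoothAt.mul (h : SmoothAt ξ x) (h' : SmoothAt η x) : SmoothAt (fun y => ξ y * η y) x := by
  intro l
  induction l generalizing ξ η with
  | nil => exact (h []).mul (h' [])
  | cons v l ih => exact (ih (h.contr v) h').add (ih h.hat (h'.contr v))

theorem SmoothAt.pow (h : SmoothAt ξ x) (n : ℕ) : SmoothAt (fun y => ξ y ^ n) x := by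
  induction n with
  | zero => simpa using SmoothAt.const 1
  | succ n ih => simpa only [pow_succ] using ih.mul h

theorem SmoothAt.dirDeriv (h : SmoothAt ξ x) (v : E) : SmoothAt (dirDeriv v ξ) x := fun l =>
  ((h l).fderiv_right (m := ∞) (by simp)).clm_apply contDiffAt_const

theorem SmoothAt.extD (h : SmoothAt ξ x) : SmoothAt (extD ξ) x := by
  intro l
  induction l generalizing ξ with
  | nil => exact contDiffAt_const
  | cons v l ih => exact (h.dirDeriv v l).sub (ih (h.contr v))

theorem dirDeriv_sub (h : SmoothAt ξ x) (h' : SmoothAt η x) (v : E) :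
    dirDeriv v (fun y => ξ y - η y) x = dirDeriv v ξ x - dirDeriv v η x := by
  ext l
  simp only [dirDeriv, sub_apply]
  rw [fderiv_fun_sub (h.differentiableAt l) (h'.differentiableAt l)]
  rfl

theorem dirDeriv_add (h : SmoothAt ξ x) (h' : SmoothAt η x) (v : E) :
    dirDeriv v (fun y => ξ y + η y) x = dirDeriv v ξ x + dirDeriv v η x := by
  ext l
  simp only [dirDeriv, add_apply]
  rw [fderiv_fun_add (h.differentiableAt l) (h'.differentiableAt l)]
  rfl

theorem dirDeriv_hat (h : SmoothAt ξ x) (v : E) :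
    dirDeriv v (fun y => hat (ξ y)) x = hat (dirDeriv v ξ x) := by
  ext l
  simp only [dirDeriv, hat_apply]
  rw [fderiv_const_mul (h.differentiableAt l)]
  rfl

theorem dirDeriv_mul (h : SmoothAt ξ x) (h' : SmoothAt η x) (v : E) :
    dirDeriv v (fun y => ξ y * η y) x = dirDeriv v ξ x * η x + ξ x * dirDeriv v η x := by
  ext l
  induction l generalizing ξ η with
  | nil =>
    simp only [dirDeriv, mul_nil, add_apply]
    rw [fderiv_fun_mul (h.differentiableAt []) (h'.differentiableAt [])]
    simp; ring
  | cons w l ih =>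
    have h1 := ih (h.contr w) h'
    have h2 := ih h.hat (h'.contr w)
    have h3 : dirDeriv v (fun y => ξ y * η y) x (w :: l) =
        dirDeriv v (fun y => contr w (ξ y) * η y + hat (ξ y) * contr w (η y)) x l := rfl
    rw [h3, dirDeriv_add ((h.contr w).mul h') (h.hat.mul (h'.contr w)), add_apply, h1, h2,
      dirDeriv_hat h, add_apply, add_apply, add_apply, mul_cons, mul_cons]
    change _ = (dirDeriv v (fun y => contr w (ξ y)) x * η x) l + (hat (dirDeriv v ξ x) * _) l + (_ +
      (hat (ξ x) * dirDeriv v (fun y => contr w (η y)) x) l)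
    ring

theorem extD_sub (h : SmoothAt ξ x) (h' : SmoothAt η x) :
    extD (fun y => ξ y - η y) x = extD ξ x - extD η x := by
  ext l
  induction l generalizing ξ η with
  | nil => simp
  | cons v l ih =>
    simp only [extD_cons, sub_apply, map_sub]
    rw [ih (h.contr v) (h'.contr v), dirDeriv_sub h h', sub_apply, sub_apply]
    ring

theorem extD_add (h : SmoothAt ξ x) (h' : SmoothAt η x) :
    extD (fun y => ξ y + η y) x = extD ξ x + extD η x := by
  ext l
  induction l generalizing ξ η with
  | nil => simp
  | cons v l ih =>
    simp only [extD_cons, add_apply, map_add]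
    rw [ih (h.contr v) (h'.contr v), dirDeriv_add h h', add_apply, add_apply]
    ring

theorem extD_const (c : Coch E) : extD (fun _ => c) x = 0 := by
  ext l
  induction l generalizing c with
  | nil => rfl
  | cons v l ih =>
    rw [extD_cons, ih]
    simp [dirDeriv]

theorem extD_sum {ι : Type*} {s : Finset ι} {ξ : ι → E → Coch E}
    (h : ∀ i ∈ s, SmoothAt (ξ i) x) :
    extD (fun y => ∑ i ∈ s, ξ i y) x = ∑ i ∈ s, extD (ξ i) x := by
  classical
  induction s using Finset.induction_on with
  | empty => simpa using extD_const 0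
  | insert i s hi ih =>
    simp only [Finset.sum_insert hi]
    rw [extD_add (h i (by simp)) (SmoothAt.sum fun j hj => h j (by simp [hj])),
      ih fun j hj => h j (by simp [hj])]

theorem extD_neg (h : SmoothAt ξ x) : extD (fun y => -ξ y) x = -extD ξ x := by
  have := extD_sub (SmoothAt.const 0) h
  simpa [extD_const] using this

theorem extD_hat (h : SmoothAt ξ x) : extD (fun y => hat (ξ y)) x = -hat (extD ξ x) := by
  ext l
  induction l generalizing ξ with
  | nil => simp
  | cons v l ih =>
    have h1 := ih (h.contr v)
    rw [neg_apply, ← contr_apply v (hat _), contr_hat, contr_extD, extD_cons, dirDeriv_hat h]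
    simp only [contr_hat]
    rw [extD_neg (h.contr v).hat, neg_apply, h1]
    simp only [map_sub, neg_apply, sub_apply]
    ring

/-- The Leibniz rule. -/
theorem extD_mul (h : SmoothAt ξ x) (h' : SmoothAt η x) :
    extD (fun y => ξ y * η y) x = extD ξ x * η x + hat (ξ x) * extD η x := by
  ext l
  induction l generalizing ξ η with
  | nil => simp
  | cons v l ih =>
    have h1 := ih (h.contr v) h'
    have h2 := ih h.hat (h'.contr v)
    rw [extD_hat h, hat_hat] at h2
    rw [add_apply, mul_cons, mul_cons, extD_cons, dirDeriv_mul h h']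
    simp only [contr_mul]
    rw [extD_add ((h.contr v).mul h') (h.hat.mul (h'.contr v)), add_apply, add_apply, h1, h2]
    simp only [contr_extD, contr_hat, hat_hat, sub_mul, mul_sub, neg_mul, add_apply, sub_apply,
      neg_apply]
    ring

theorem extD_pow_of_closed (h : SmoothAt ξ x) (hd : extD ξ x = 0) (n : ℕ) :
    extD (fun y => ξ y ^ n) x = 0 := by
  induction n with
  | zero => simpa using extD_const 1
  | succ n ih =>
    simp only [pow_succ]
    rw [extD_mul (h.pow n) h, ih, hd, zero_mul, mul_zero, add_zero]

/-! ### Comparison with the exterior derivative of forms -/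

theorem smoothAt_ofForm {k : ℕ} {η : E → E [⋀^Fin k]→L[ℝ] ℝ} (h : ContDiffAt ℝ ∞ η x) :
    SmoothAt (fun y => ofForm (η y)) x := by
  intro l
  by_cases hl : l.length = k
  · obtain ⟨v, rfl⟩ := exists_ofFn_of_length hl
    simp only [ofForm_ofFn]
    exact ((ContinuousAlternatingMap.apply ℝ E ℝ v).contDiff.contDiffAt).comp x h
  · simp only [homog_ofForm _ _ hl]
    exact contDiffAt_const

theorem homog_extDCoeff {k : ℕ} {ξ : E → Coch E} (h : ∀ x, Homog k (ξ x)) :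
    ∀ l : List E, ∀ x, l.length ≠ k + 1 → extD ξ x l = 0 := by
  intro l
  induction l generalizing k ξ with
  | nil => intro x _; rfl
  | cons v l ih =>
    intro x hl
    have hk : l.length ≠ k := by simpa using hl
    rw [extD_cons]
    have h1 : dirDeriv v ξ x l = 0 := by
      simp only [dirDeriv, h _ _ hk]
      simp
    cases k with
    | zero =>
      simp only [(h _).contr_zero, extD_const, h1]
      simp
    | succ k => rw [h1, ih (fun y => (h y).contr v) x hk, sub_zero]

/-- Unfolding the recursion gives the alternating sum of `extDeriv_apply`: the term of index `0` is
the derivative along `v 0`, and the others come from the form contracted with `v 0`, with indices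
lowered by one and hence opposite signs. -/
theorem extD_ofForm {k : ℕ} {η : E → E [⋀^Fin k]→L[ℝ] ℝ} (h : DifferentiableAt ℝ η x) :
    extD (fun y => ofForm (η y)) x = ofForm (extDeriv η x) := by
  refine Homog.ext (k := k + 1) (fun l hl => homog_extDCoeff (fun y => homog_ofForm (η y)) l x hl)
    (homog_ofForm _) ?_
  intro v
  rw [ofForm_ofFn]
  induction k with
  | zero =>
    rw [List.ofFn_succ, extD_cons, extDeriv_apply h]
    simp only [contr_ofForm_zero, extD_const, dirDeriv]
    have : ∀ y, ofForm (η y) (List.ofFn fun i : Fin 0 => v i.succ) = η y (fun i => v i.succ) :=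
      fun y => ofForm_ofFn _ _
    simp only [this]
    simp
    congr!
  | succ k ih =>
    have hc : DifferentiableAt ℝ (fun y => (η y).curryLeft (v 0)) x :=
      (((ContinuousLinearMap.apply ℝ (E [⋀^Fin k]→L[ℝ] ℝ) (v 0)).comp
        (ContinuousAlternatingMap.curryLeftLI (𝕜 := ℝ) (E := E) (F := ℝ)
          (n := k)).toContinuousLinearMap).differentiableAt).comp x h
    rw [List.ofFn_succ, extD_cons]
    simp only [contr_ofForm]
    rw [ih hc, extDeriv_apply h, extDeriv_apply hc, Fin.sum_univ_succ (n := k + 1)]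
    have e0 : dirDeriv (v 0) (fun y => ofForm (η y)) x (List.ofFn fun i => v i.succ) =
        fderiv ℝ (fun y => η y ((0 : Fin (k + 2)).removeNth v)) x (v 0) := by
      simp only [dirDeriv, ofForm_ofFn]
      rfl
    have e1 : ∀ i : Fin (k + 1), (fun y => η y (i.succ.removeNth v)) =
        fun y => (η y).curryLeft (v 0) (i.removeNth fun j => v j.succ) := by
      intro i
      funext y
      rw [ContinuousAlternatingMap.curryLeft_apply_apply]
      congr 1
      funext j
      refine Fin.cases ?_ (fun j => ?_) j
      · simp [Fin.removeNth]
      · simp [Fin.removeNth]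
    rw [e0]
    simp only [e1, Fin.val_zero, pow_zero, one_smul, Fin.val_succ, pow_succ]
    rw [sub_eq_add_neg, ← Finset.sum_neg_distrib]
    simp

end Calculus
end Coch

/-! ### Integration over spheres -/

open Coch

theorem continuous_on_sphere {E : Type*} [NormedAddCommGroup E] {f : E → ℝ}
    (h : ∀ x ∈ sphere (0 : E) 1, ContinuousAt f x) :
    Continuous fun x : sphere (0 : E) 1 => f x :=
  continuous_iff_continuousAt.2 fun x => (h x x.2).comp continuous_subtype_val.continuousAt

/-! ### Rotations and the conormal covector -/

section Normal

variable {E : Type*} [NormedAddCommGroup E] [InnerProductSpace ℝ E]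

/-- The generator of the rotations of the plane of `u` and `w`. -/
def rotGen (u w : E) : E →L[ℝ] E := (innerSL ℝ u).smulRight w - (innerSL ℝ w).smulRight u

/-- `rotGen u w` is skew-symmetric, so the squared norm is constant along its flow. -/
theorem exists_rotation [FiniteDimensional ℝ E] (u w : E) (s : ℝ) :
    ∃ U : E ≃ₗᵢ[ℝ] E, ∀ x, U x = NormedSpace.exp (s • rotGen u w) x := by
  have hnorm : ∀ (x : E) (s : ℝ), ‖NormedSpace.exp (s • rotGen u w) x‖ = ‖x‖ := by
    intro x s
    have hd : ∀ t : ℝ, HasDerivAt (fun t : ℝ => NormedSpace.exp (t • rotGen u w) x)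
        (rotGen u w (NormedSpace.exp (t • rotGen u w) x)) t := fun t => by
      simpa using (hasDerivAt_exp_smul_const' (𝕂 := ℝ) (rotGen u w) t).clm_apply
        (hasDerivAt_const t x)
    have hd2 : ∀ t : ℝ, HasDerivAt (fun t : ℝ => ⟪NormedSpace.exp (t • rotGen u w) x,
        NormedSpace.exp (t • rotGen u w) x⟫) 0 t := fun t => by
      refine ((hd t).inner ℝ (hd t)).congr_deriv ?_
      simp only [rotGen, _root_.sub_apply, ContinuousLinearMap.smulRight_apply,
        innerSL_apply_apply, inner_sub_left, inner_sub_right, inner_smul_left, inner_smul_right]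
      simp only [RCLike.conj_to_real]
      rw [real_inner_comm u, real_inner_comm w]
      ring
    have hc := is_const_of_deriv_eq_zero (fun t => (hd2 t).differentiableAt)
      (fun t => (hd2 t).deriv) s 0
    simp only [zero_smul, NormedSpace.exp_zero, real_inner_self_eq_norm_sq] at hc
    simpa using hc
  exact ⟨LinearIsometry.toLinearIsometryEquiv
    ⟨(NormedSpace.exp (s • rotGen u w)).toLinearMap, fun x => hnorm x s⟩ rfl, fun x => rfl⟩

/-- The cochain of the covector `⟪x, ·⟫`. -/
def normalCoch (x : E) : Coch E
  | [v] => ⟪x, v⟫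
  | _ => 0

@[simp] theorem normalCoch_nil (x : E) : normalCoch x [] = 0 := rfl

@[simp] theorem contr_normalCoch (x v : E) : contr v (normalCoch x) = ⟪x, v⟫ • (1 : Coch E) := by
  ext l
  cases l with
  | nil => simp [normalCoch]
  | cons w l => exact (mul_zero _).symm

theorem homog_normalCoch (x : E) : Homog 1 (normalCoch x) := by
  intro l hl
  match l with
  | [] => rfl
  | [v] => simp at hl
  | v :: w :: l => rfl

theorem hat_normalCoch (x : E) : hat (normalCoch x) = -normalCoch x := by
  rw [(homog_normalCoch x).hat_eq]; simp

theorem smoothAt_normalCoch (x : E) : SmoothAt (normalCoch (E := E)) x := by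
  intro l
  match l with
  | [] => exact contDiffAt_const
  | [v] => exact contDiffAt_id.inner ℝ contDiffAt_const
  | v :: w :: l => exact contDiffAt_const

theorem normalCoch_mul_cons (x v : E) (f : Coch E) (l : List E) :
    (normalCoch x * f) (v :: l) = ⟪x, v⟫ * f l - (normalCoch x * contr v f) l := by
  rw [mul_cons, contr_normalCoch, hat_normalCoch, smul_mul_assoc, one_mul, neg_mul]
  simp [sub_eq_add_neg]

end Normal

/-! ### Rotation invariance of the surface measure and Stokes' theorem -/

section Sphere

variable {E : Type*} [NormedAddCommGroup E] [InnerProductSpace ℝ E] [FiniteDimensional ℝ E]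
  [MeasurableSpace E] [BorelSpace E]

open scoped Pointwise in
-- The surface measure of a set is the dimension times the volume of the cone over it, and a linear
-- isometry maps cones to cones of the same volume.
theorem integral_toSphere_isometry (U : E ≃ₗᵢ[ℝ] E) (f : E → ℝ) :
    ∫ x : sphere (0 : E) 1, f (U x) ∂(volume : Measure E).toSphere =
      ∫ x : sphere (0 : E) 1, f x ∂(volume : Measure E).toSphere := by
  let V : sphere (0 : E) 1 ≃ₜ sphere (0 : E) 1 :=
    { toFun := fun x => ⟨U x, by simp⟩
      invFun := fun x => ⟨U.symm x, by simp⟩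
      left_inv := fun x => by simp
      right_inv := fun x => by simp
      continuous_toFun := by fun_prop
      continuous_invFun := by fun_prop }
  have hV : MeasurePreserving V (volume : Measure E).toSphere (volume : Measure E).toSphere := by
    refine ⟨V.continuous.measurable, Measure.ext fun s hs => ?_⟩
    rw [Measure.map_apply V.continuous.measurable hs, Measure.toSphere_apply' _ hs,
      Measure.toSphere_apply' _ (V.continuous.measurable hs)]
    congr 1
    have : Ioo (0 : ℝ) 1 • (Subtype.val '' (V ⁻¹' s)) =
        U ⁻¹' (Ioo (0 : ℝ) 1 • (Subtype.val '' s)) := by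
      ext y
      simp only [Set.mem_smul, mem_image, mem_preimage]
      constructor
      · rintro ⟨r, hr, _, ⟨x, hx, rfl⟩, rfl⟩
        exact ⟨r, hr, _, ⟨V x, hx, rfl⟩, by simp [V]⟩
      · rintro ⟨r, hr, _, ⟨x, hx, rfl⟩, h⟩
        refine ⟨r, hr, _, ⟨V.symm x, by simpa using hx, rfl⟩, ?_⟩
        apply U.injective
        rw [← h]; simp [V]
    rw [this]
    exact U.measurePreserving.measure_preimage_emb U.toMeasurableEquiv.measurableEmbedding _
  exact hV.integral_comp V.measurableEmbedding fun x => f x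

theorem integrable_on_sphere {f : E → ℝ} (h : ∀ x ∈ sphere (0 : E) 1, ContinuousAt f x) :
    Integrable (fun x : sphere (0 : E) 1 => f x) (volume : Measure E).toSphere :=
  (continuous_on_sphere h).integrable_of_hasCompactSupport (HasCompactSupport.of_compactSpace _)

/-- The integral over the sphere of the derivative along a rotation field vanishes. -/
theorem integral_rotGen_eq_zero {f : E → ℝ} (hf : ∀ x ∈ sphere (0 : E) 1, ContDiffAt ℝ 1 f x)
    (u w : E) : ∫ x : sphere (0 : E) 1, fderiv ℝ f x (rotGen u w x)
      ∂(volume : Measure E).toSphere = 0 := by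
  set B := rotGen u w
  have hmem : ∀ (s : ℝ) (x : sphere (0 : E) 1), NormedSpace.exp (s • B) (x : E) ∈ sphere 0 1 := by
    intro s x
    obtain ⟨U, hU⟩ := exists_rotation u w s
    rw [← hU]; simp
  have hcont : Continuous fun x : sphere (0 : E) 1 => fderiv ℝ f x (B x) := by
    refine continuous_on_sphere (f := fun x => fderiv ℝ f x (B x)) fun x hx => ?_
    exact ((hf x hx).fderiv_right (m := 0) (by simp)).continuousAt.clm_apply B.continuous.continuousAt
  obtain ⟨C, hC⟩ := isCompact_univ.exists_bound_of_continuousOn hcont.continuousOn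
  -- The integral of `f` rotated by `exp (s • B)` does not depend on `s`; differentiate it at `0`
  -- under the integral sign. The flow preserves the compact sphere, so one constant `C` dominates
  -- for all `s`.
  have hder := hasDerivAt_integral_of_dominated_loc_of_deriv_le (𝕜 := ℝ)
    (μ := (volume : Measure E).toSphere)
    (F := fun s (x : sphere (0 : E) 1) => f (NormedSpace.exp (s • B) (x : E)))
    (F' := fun s (x : sphere (0 : E) 1) => fderiv ℝ f (NormedSpace.exp (s • B) (x : E))
      (B (NormedSpace.exp (s • B) (x : E))))
    (x₀ := 0) (s := univ) (bound := fun _ => C) Filter.univ_mem ?_ ?_ ?_ ?_ ?_ ?_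
  · have h0 : HasDerivAt (fun s : ℝ => ∫ x : sphere (0 : E) 1, f (NormedSpace.exp (s • B) (x : E))
        ∂(volume : Measure E).toSphere) 0 0 := by
      have : (fun s : ℝ => ∫ x : sphere (0 : E) 1, f (NormedSpace.exp (s • B) (x : E))
          ∂(volume : Measure E).toSphere) =
          fun _ => ∫ x : sphere (0 : E) 1, f x ∂(volume : Measure E).toSphere := by
        funext s
        obtain ⟨U, hU⟩ := exists_rotation u w s
        rw [← integral_toSphere_isometry U]
        simp only [hU]; rfl
      rw [this]
      exact hasDerivAt_const _ _
    have := hder.2.unique h0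
    simpa using this
  · refine Filter.Eventually.of_forall fun s => Continuous.aestronglyMeasurable ?_
    refine continuous_iff_continuousAt.2 fun x => ?_
    exact ContinuousAt.comp (f := fun x : sphere (0 : E) 1 => NormedSpace.exp (s • B) (x : E))
      (hf _ (hmem s x)).continuousAt (by fun_prop)
  · simpa using integrable_on_sphere fun x hx => (hf x hx).continuousAt
  · simpa using hcont.aestronglyMeasurable
  · refine Filter.Eventually.of_forall fun x s _ => ?_
    exact hC ⟨_, hmem s x⟩ (mem_univ _)
  · exact integrable_const C
  · refine Filter.Eventually.of_forall fun x s _ => ?_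
    have h1 : HasDerivAt (fun t : ℝ => NormedSpace.exp (t • B) (x : E))
        (B (NormedSpace.exp (s • B) (x : E))) s := by
      simpa using (hasDerivAt_exp_smul_const' (𝕂 := ℝ) B s).clm_apply (hasDerivAt_const s (x : E))
    exact ((hf _ (hmem s x)).differentiableAt one_ne_zero).hasFDerivAt.comp_hasDerivAt s h1

/-- The rotation field of `u, w` at `x` is `⟪u, x⟫ w - ⟪w, x⟫ u`; the lemma is integration by parts
for one coefficient of `ξ`. -/
theorem integral_rotation_coeff {ξ : E → Coch E} (h : ∀ x ∈ sphere (0 : E) 1, SmoothAt ξ x)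
    (u w : E) (l : List E) : ∫ x : sphere (0 : E) 1,
      (⟪(x : E), u⟫ * dirDeriv w ξ x l - ⟪(x : E), w⟫ * dirDeriv u ξ x l)
        ∂(volume : Measure E).toSphere = 0 := by
  rw [← integral_rotGen_eq_zero (f := fun y => ξ y l)
    (fun x hx => (h x hx l).of_le (by exact_mod_cast le_top)) u w]
  congr 1
  funext x
  simp [rotGen, dirDeriv, real_inner_comm]

/-- Stokes' theorem on the sphere. -/
theorem integral_normalCoch_mul_extD {ξ : E → Coch E}
    (h : ∀ x ∈ sphere (0 : E) 1, SmoothAt ξ x) (l : List E) :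
    ∫ x : sphere (0 : E) 1, (normalCoch (x : E) * extD ξ x) l
      ∂(volume : Measure E).toSphere = 0 := by
  have hint : ∀ {ξ : E → Coch E}, (∀ x ∈ sphere (0 : E) 1, SmoothAt ξ x) → ∀ l,
      Integrable (fun x : sphere (0 : E) 1 => ξ x l) (volume : Measure E).toSphere :=
    fun h l => integrable_on_sphere fun x hx => (h x hx l).continuousAt
  have hinner : ∀ {ξ : E → Coch E}, (∀ x ∈ sphere (0 : E) 1, SmoothAt ξ x) → ∀ u l,
      Integrable (fun x : sphere (0 : E) 1 => ⟪(x : E), u⟫ * ξ x l)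
        (volume : Measure E).toSphere := fun h u l =>
    integrable_on_sphere (f := fun x => ⟪x, u⟫ * _ ) fun x hx => by
      exact ContinuousAt.mul (by fun_prop) (h x hx l).continuousAt
  -- Modulo integrals over the sphere, `⟪x, u⟫ dξ` equals `ν ∧ D_u ξ`. Peeling off an argument `w`
  -- replaces `ξ` by its contraction with `w`, at the cost of a rotation derivative in the plane of
  -- `u` and `w`, which integrates to zero.
  have aux : ∀ (u : E) (l : List E) {ξ : E → Coch E}, (∀ x ∈ sphere (0 : E) 1, SmoothAt ξ x) →
      ∫ x : sphere (0 : E) 1, (⟪(x : E), u⟫ * extD ξ x l -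
        (normalCoch (x : E) * dirDeriv u ξ x) l) ∂(volume : Measure E).toSphere = 0 := by
    intro u l
    induction l with
    | nil => intro ξ h; simp
    | cons w l ih =>
      intro ξ h
      have hc : ∀ x ∈ sphere (0 : E) 1, SmoothAt (fun y => contr w (ξ y)) x :=
        fun x hx => (h x hx).contr w
      have e : ∀ x : sphere (0 : E) 1, ⟪(x : E), u⟫ * extD ξ x (w :: l) -
          (normalCoch (x : E) * dirDeriv u ξ x) (w :: l) =
          (⟪(x : E), u⟫ * dirDeriv w ξ x l - ⟪(x : E), w⟫ * dirDeriv u ξ x l) -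
          (⟪(x : E), u⟫ * extD (fun y => contr w (ξ y)) x l -
            (normalCoch (x : E) * dirDeriv u (fun y => contr w (ξ y)) x) l) := by
        intro x
        rw [extD_cons, normalCoch_mul_cons]
        change _ - (_ - (_ * dirDeriv u (fun y => contr w (ξ y)) (x : E)) l) = _
        ring
      simp only [e]
      rw [integral_sub, integral_rotation_coeff h, ih hc, sub_zero]
      · exact (hinner (fun x hx => (h x hx).dirDeriv w) u l).sub
          (hinner (fun x hx => (h x hx).dirDeriv u) w l)
      · exact (hinner (fun x hx => (hc x hx).extD) u l).sub
          (hint (ξ := fun x => normalCoch x * dirDeriv u (fun y => contr w (ξ y)) x)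
            (fun x hx => (smoothAt_normalCoch x).mul ((hc x hx).dirDeriv u)) l)
  -- By `ι_u d = D_u - d ι_u`, contracting `ν ∧ dξ` with `u` gives `(⟪x, u⟫ dξ - ν ∧ D_u ξ) + ν ∧
  -- d(ι_u ξ)`: the bracket is covered by `aux`, the last term by induction.
  induction l generalizing ξ with
  | nil => simp
  | cons u l ih =>
    have hc : ∀ x ∈ sphere (0 : E) 1, SmoothAt (fun y => contr u (ξ y)) x :=
      fun x hx => (h x hx).contr u
    have e : ∀ x : sphere (0 : E) 1, (normalCoch (x : E) * extD ξ x) (u :: l) =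
        (⟪(x : E), u⟫ * extD ξ x l - (normalCoch (x : E) * dirDeriv u ξ x) l) +
          (normalCoch (x : E) * extD (fun y => contr u (ξ y)) x) l := by
      intro x
      rw [normalCoch_mul_cons, contr_extD, mul_sub, sub_apply]
      ring
    simp only [e]
    rw [integral_add, aux u l h, ih hc, add_zero]
    · exact (hinner (fun x hx => (h x hx).extD) u l).sub
        (hint (ξ := fun x => normalCoch x * dirDeriv u ξ x)
          (fun x hx => (smoothAt_normalCoch x).mul ((h x hx).dirDeriv u)) l)
    · exact hint (ξ := fun x => normalCoch x * extD (fun y => contr u (ξ y)) x)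
        (fun x hx => (smoothAt_normalCoch x).mul (hc x hx).extD) l

end Sphere

section

open Coch

/-! ### The standard frame and forms of top degree -/

theorem finrank_Cn (m : ℕ) : Module.finrank ℝ (Cn m) = 2 * m + 2 := by
  rw [← Module.finrank_mul_finrank ℝ ℂ (Cn m), Complex.finrank_real_complex, finrank_euclideanSpace,
    Fintype.card_fin]
  ring

theorem inner_Cn {m : ℕ} (x y : Cn m) : ⟪x, y⟫ = ∑ j, ((starRingEnd ℂ) (x j) * y j).re := by
  rw [PiLp.inner_apply]
  exact Finset.sum_congr rfl fun j _ => by rw [Complex.inner, mul_comm]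

theorem inner_single_Cn {m : ℕ} (j : Fin (m + 1)) (a : ℂ) (y : Cn m) :
    ⟪(EuclideanSpace.single j a : Cn m), y⟫ = ((starRingEnd ℂ) a * y j).re := by
  rw [inner_Cn, Finset.sum_eq_single j]
  · simp
  · intro i _ hi; simp [hi]
  · simp

theorem realFrame_even {m : ℕ} (j : Fin (m + 1)) :
    realFrame m (2 * j) = EuclideanSpace.single j 1 := by
  have h : Fin.ofNat (m + 1) (2 * (j : ℕ) / 2) = j := by
    ext; simp
  rw [realFrame, h]; simp

theorem realFrame_odd {m : ℕ} (j : Fin (m + 1)) :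
    realFrame m (2 * j + 1) = EuclideanSpace.single j Complex.I := by
  have h : Fin.ofNat (m + 1) ((2 * (j : ℕ) + 1) / 2) = j := by
    have : (2 * (j : ℕ) + 1) / 2 = j := by omega
    ext; simp [this]
  rw [realFrame, h]; simp [Nat.add_mod]

theorem orthonormal_realFrame (m : ℕ) :
    Orthonormal ℝ (fun k : Fin (2 * m + 2) => realFrame m k) := by
  have hdiv : ∀ k : Fin (2 * m + 2), ∃ j : Fin (m + 1), (k : ℕ) = 2 * j ∨ (k : ℕ) = 2 * j + 1 := by
    intro k
    refine ⟨⟨k / 2, by omega⟩, ?_⟩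
    simp only
    omega
  rw [orthonormal_iff_ite]
  intro a b
  obtain ⟨i, hi⟩ := hdiv a
  obtain ⟨j, hj⟩ := hdiv b
  have hab : a = b ↔ (a : ℕ) = b := Fin.ext_iff
  have hij : i = j ↔ (i : ℕ) = j := Fin.ext_iff
  rcases hi with hi | hi <;> rcases hj with hj | hj <;> rw [hi, hj] <;>
    simp only [realFrame_even, realFrame_odd, inner_single_Cn, hab, hi, hj] <;>
    by_cases h : i = j <;> simp [h] <;> omega

/-- The standard frame as an orthonormal basis. -/
def frameBasis (m : ℕ) : OrthonormalBasis (Fin (2 * m + 2)) ℝ (Cn m) :=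
  (basisOfOrthonormalOfCardEqFinrank (orthonormal_realFrame m)
    (by rw [finrank_Cn, Fintype.card_fin])).toOrthonormalBasis
    (by simpa using orthonormal_realFrame m)

@[simp] theorem frameBasis_apply {m : ℕ} (k : Fin (2 * m + 2)) :
    frameBasis m k = realFrame m k := by
  simp [frameBasis]

/-- The standard frame as a list. -/
def frameList (m : ℕ) : List (Cn m) := (List.range (2 * m + 2)).map (realFrame m)

theorem ofFn_realFrame (m n : ℕ) :
    (List.ofFn fun k : Fin n => realFrame m k) = (List.range n).map (realFrame m) := by
  refine List.ext_getElem (by simp) fun i h1 h2 => ?_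
  simp

/-- `f` is the cochain of an alternating form of degree `k`. -/
def IsAlt {m : ℕ} (k : ℕ) (f : Coch (Cn m)) : Prop :=
  ∃ a : Cn m [⋀^Fin k]→L[ℝ] ℝ, f = ofForm a

namespace IsAlt
variable {m k l : ℕ} {f g : Coch (Cn m)}

theorem of_form (a : Cn m [⋀^Fin k]→L[ℝ] ℝ) : IsAlt k (ofForm a) := ⟨a, rfl⟩
theorem zero : IsAlt k (0 : Coch (Cn m)) := ⟨0, ofForm_zero.symm⟩
theorem add (hf : IsAlt k f) (hg : IsAlt k g) : IsAlt k (f + g) := by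
  obtain ⟨a, rfl⟩ := hf; obtain ⟨b, rfl⟩ := hg
  exact ⟨a + b, (ofForm_add a b).symm⟩
theorem sub (hf : IsAlt k f) (hg : IsAlt k g) : IsAlt k (f - g) := by
  obtain ⟨a, rfl⟩ := hf; obtain ⟨b, rfl⟩ := hg
  exact ⟨a - b, (ofForm_sub a b).symm⟩
theorem sum {ι : Type*} {s : Finset ι} {f : ι → Coch (Cn m)} (h : ∀ i ∈ s, IsAlt k (f i)) :
    IsAlt k (∑ i ∈ s, f i) :=
  Finset.sum_induction f (IsAlt k) (fun _ _ => add) zero h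
theorem mul (hf : IsAlt k f) (hg : IsAlt l g) : IsAlt (k + l) (f * g) := by
  obtain ⟨a, rfl⟩ := hf; obtain ⟨b, rfl⟩ := hg
  exact ⟨wedge a b, (ofForm_wedge a b).symm⟩
theorem pow_two (hf : IsAlt 2 f) (r : ℕ) : IsAlt (2 * r) (f ^ r) := by
  obtain ⟨a, rfl⟩ := hf
  exact ⟨wedgePow a r, (ofForm_wedgePow a r).symm⟩
theorem cast (hf : IsAlt k f) (h : k = l) : IsAlt l f := h ▸ hf
theorem homog (hf : IsAlt k f) : Homog k f := by
  obtain ⟨a, rfl⟩ := hf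
  exact homog_ofForm a
theorem even (hf : IsAlt 2 f) : hat f = f := by
  rw [hf.homog.hat_eq]; simp
theorem odd (hf : IsAlt 1 f) : hat f = -f := by
  rw [hf.homog.hat_eq]; simp
theorem smul_cons (hf : IsAlt k f) (c : ℝ) (v : Cn m) (u : List (Cn m)) :
    f (c • v :: u) = c * f (v :: u) := by
  obtain ⟨a, rfl⟩ := hf
  cases k with
  | zero => rw [homog_ofForm a _ (by simp), homog_ofForm a _ (by simp), mul_zero]
  | succ k =>
    change contr (c • v) (ofForm a) u = c * contr v (ofForm a) u
    rw [contr_ofForm, contr_ofForm, map_smul, ofForm_smul, smul_apply]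

theorem eq_zero_of_lt (hf : IsAlt k f) (hk : 2 * m + 2 < k) : f = 0 := by
  obtain ⟨a, rfl⟩ := hf
  refine (homog_ofForm a).ext (fun _ _ => rfl) fun v => ?_
  rw [ofForm_ofFn]
  refine a.toAlternatingMap.map_linearDependent v fun hv => ?_
  have := hv.fintype_card_le_finrank
  rw [finrank_Cn, Fintype.card_fin] at this
  omega

/-- Top-degree forms are a line, so all of them scale by the same determinant; this is what later
lets one invariant volume form decide the determinant of the action. -/
theorem top_eq_det (hf : IsAlt (2 * m + 2) f) (v : Fin (2 * m + 2) → Cn m) :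
    f (List.ofFn v) =
      Matrix.det (Matrix.of fun a b : Fin (2 * m + 2) => ⟪realFrame m a, v b⟫) * f (frameList m) := by
  obtain ⟨a, rfl⟩ := hf
  rw [frameList, ← ofFn_realFrame, ofForm_ofFn, ofForm_ofFn]
  have h := congrArg (fun g => g v)
    (AlternatingMap.eq_smul_basis_det (frameBasis m).toBasis a.toAlternatingMap)
  simp only [AlternatingMap.smul_apply, smul_eq_mul] at h
  refine h.trans ?_
  rw [mul_comm, Module.Basis.det_apply]
  have e1 : (frameBasis m).toBasis.toMatrix v =
      Matrix.of fun a b : Fin (2 * m + 2) => ⟪realFrame m a, v b⟫ := by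
    ext i j
    rw [Module.Basis.toMatrix_apply, OrthonormalBasis.coe_toBasis_repr_apply,
      OrthonormalBasis.repr_apply_apply, frameBasis_apply]
    rfl
  have e2 : ⇑(frameBasis m).toBasis = fun k : Fin (2 * m + 2) => realFrame m k := by
    funext k; simp
  rw [e1, e2]
  rfl

theorem top_eq_zero (hf : IsAlt (2 * m + 2) f) (b : OrthonormalBasis (Fin (2 * m + 2)) ℝ (Cn m))
    (h : f (List.ofFn b) = 0) : f = 0 := by
  obtain ⟨a, rfl⟩ := hf
  rw [ofForm_ofFn] at h
  have h0 : a.toAlternatingMap = 0 := by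
    rw [← AlternatingMap.map_basis_eq_zero_iff b.toBasis]
    simpa using h
  have : a = 0 := ContinuousAlternatingMap.toAlternatingMap_injective h0
  rw [this, ofForm_zero]

end IsAlt

/-- The tangent space of the sphere through `x`, as a set of vectors. -/
def tangentSet {m : ℕ} (x : Cn m) : Set (Cn m) := {v | ⟪x, v⟫ = 0}

theorem sphereEq_iff {m k : ℕ} {η β : Form m k} : SphereEq η β ↔
    ∀ x ∈ sphere (0 : Cn m) 1, EqOn (tangentSet x) (ofForm (η x)) (ofForm (β x)) :=
  forall₂_congr fun x _ => (EqOn.ofForm_iff (T := tangentSet x) _ _).symm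

theorem normalCoch_eqOn_zero {m : ℕ} (x : Cn m) {T : Set (Cn m)} (hT : ∀ v ∈ T, ⟪x, v⟫ = 0) :
    EqOn T (normalCoch x) 0 := by
  intro l hl
  match l with
  | [] => rfl
  | [v] => exact hT v (hl v (by simp))
  | v :: w :: l => rfl

theorem isAlt_normalCoch {m : ℕ} (x : Cn m) : IsAlt 1 (normalCoch x) := by
  refine ⟨conormal x, (homog_normalCoch x).ext (homog_ofForm _) fun v => ?_⟩
  rw [ofForm_ofFn, conormal]
  simp [normalCoch]

theorem ofForm_conormal {m : ℕ} (x : Cn m) : ofForm (conormal x) = normalCoch x := by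
  refine (homog_ofForm _).ext (homog_normalCoch x) fun v => ?_
  rw [ofForm_ofFn, conormal]
  simp [normalCoch]

/-- `ν` vanishes on tangent vectors, so of the expansion only the term `⟪x, x⟫ = 1` survives. -/
theorem normalCoch_mul_cons_self {m : ℕ} {x : Cn m} (hx : ‖x‖ = 1) (f : Coch (Cn m))
    {l : List (Cn m)} (hl : ∀ v ∈ l, v ∈ tangentSet x) : (normalCoch x * f) (x :: l) = f l := by
  have h : (normalCoch x * contr x f) l = (0 * contr x f) l :=
    ((normalCoch_eqOn_zero x fun v hv => hv).mul (.refl (contr x f))) l hl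
  rw [normalCoch_mul_cons, h, zero_mul, real_inner_self_eq_norm_sq, hx]
  simp

/-- The exterior product with the conormal only depends on the restriction to the sphere. -/
theorem normalCoch_mul_eq_zero {m : ℕ} {x : Cn m} (hx : ‖x‖ = 1) {f : Coch (Cn m)}
    (hf : IsAlt (1 + 2 * m) f) (h : EqOn (tangentSet x) f 0) : normalCoch x * f = 0 := by
  obtain ⟨b, hb⟩ := Orthonormal.exists_orthonormalBasis_extension_of_card_eq (𝕜 := ℝ)
    (E := Cn m) (ι := Fin (2 * m + 2)) (by rw [finrank_Cn, Fintype.card_fin])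
    (v := fun _ => x) (s := {0}) (by
      refine ⟨fun i => by simpa using hx, fun i j hij => ?_⟩
      exact absurd (Subtype.ext (i.2.trans j.2.symm)) hij)
  refine (((isAlt_normalCoch x).mul hf).cast (by ring)).top_eq_zero b ?_
  have hb0 : b 0 = x := hb 0 rfl
  have hl : ∀ v ∈ List.ofFn (fun i : Fin (2 * m + 1) => b i.succ), v ∈ tangentSet x := by
    intro v hv
    obtain ⟨i, rfl⟩ := (List.mem_ofFn' _ _).1 hv
    rw [← hb0]
    exact b.orthonormal.2 (Fin.succ_ne_zero i).symm
  rw [List.ofFn_succ, hb0, normalCoch_mul_cons_self hx f hl]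
  exact h _ hl

theorem exists_adapted_basis {m : ℕ} {x X : Cn m} (hx : ‖x‖ = 1) (hX : X ≠ 0) (hxX : ⟪x, X⟫ = 0) :
    ∃ b : OrthonormalBasis (Fin (2 * m + 2)) ℝ (Cn m), b 0 = x ∧ b 1 = ‖X‖⁻¹ • X := by
  have hX' : ‖(‖X‖⁻¹ • X)‖ = 1 := norm_smul_inv_norm (𝕜 := ℝ) hX
  have h01 : (0 : Fin (2 * m + 2)) ≠ 1 := by simp
  obtain ⟨b, hb⟩ := Orthonormal.exists_orthonormalBasis_extension_of_card_eq (𝕜 := ℝ)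
    (E := Cn m) (ι := Fin (2 * m + 2)) (by rw [finrank_Cn, Fintype.card_fin])
    (v := fun i => if i = 0 then x else ‖X‖⁻¹ • X) (s := {0, 1}) (by
      constructor
      · rintro ⟨i, rfl | rfl⟩
        · simpa using hx
        · simpa using hX'
      · rintro ⟨i, rfl | rfl⟩ ⟨j, rfl | rfl⟩ hij
        · exact absurd rfl hij
        · simp [inner_smul_right, hxX]
        · simp [inner_smul_left, real_inner_comm, hxX]
        · exact absurd rfl hij)
  exact ⟨b, hb 0 (by simp), (hb 1 (by simp)).trans (if_neg h01.symm)⟩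

/-- A form of top degree on the sphere whose contraction with a nonzero tangent vector vanishes is
zero. -/
theorem normalCoch_mul_eq_zero_of_contr {m : ℕ} {x X : Cn m} (hx : ‖x‖ = 1) (hX : X ≠ 0)
    (hxX : ⟪x, X⟫ = 0) {f : Coch (Cn m)} (hf : IsAlt (1 + 2 * m) f)
    (h : EqOn (tangentSet x) (contr X f) 0) : normalCoch x * f = 0 := by
  obtain ⟨b, hb0, hb1⟩ := exists_adapted_basis hx hX hxX
  refine (((isAlt_normalCoch x).mul hf).cast (by ring)).top_eq_zero b ?_
  have hl : ∀ v ∈ List.ofFn (fun i : Fin (2 * m + 1) => b i.succ), v ∈ tangentSet x := by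
    intro v hv
    obtain ⟨i, rfl⟩ := (List.mem_ofFn' _ _).1 hv
    rw [← hb0]
    exact b.orthonormal.2 (Fin.succ_ne_zero i).symm
  rw [List.ofFn_succ, hb0, normalCoch_mul_cons_self hx f hl]
  rw [List.ofFn_succ] at hl ⊢
  have e1 : b (Fin.succ 0) = ‖X‖⁻¹ • X := hb1
  rw [e1, hf.smul_cons, ← contr_apply X f _, h _ fun v hv => hl v (List.mem_cons_of_mem _ hv)]
  simp

theorem sphereIntegral_eq {m : ℕ} (η : Form m (1 + 2 * m)) :
    sphereIntegral η = ∫ x : sphere (0 : Cn m) 1,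
      (normalCoch (x : Cn m) * ofForm (η x)) (frameList m) ∂(volume : Measure (Cn m)).toSphere := by
  rw [sphereIntegral]
  congr 1
  funext x
  rw [← ofForm_conormal, ← ofForm_wedge, ← ofForm_ofFn, ofFn_realFrame, frameList]
  congr 3
  ring

end

section

open Coch

/-! ### Diagonal operators, the action and its fundamental vector field -/

/-- The diagonal operator with entries `c`. -/
def diagOp {m : ℕ} (c : Fin (m + 1) → ℂ) : Cn m →L[ℝ] Cn m :=
  LinearMap.toContinuousLinearMap
    { toFun := fun x => WithLp.toLp 2 fun j => c j * x j
      map_add' := fun x y => by ext j; simp [mul_add]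
      map_smul' := fun r x => by ext j; simp; ring }

@[simp] theorem diagOp_apply {m : ℕ} (c : Fin (m + 1) → ℂ) (x : Cn m) (j : Fin (m + 1)) :
    diagOp c x j = c j * x j := rfl

variable {m : ℕ} (p : Fin (m + 1) → ℤ)

/-- The action of `t` as a linear operator. -/
def actOp (t : Circle) : Cn m →L[ℝ] Cn m := diagOp fun j => (t : ℂ) ^ p j

theorem act_eq (t : Circle) (x : Cn m) : act p t x = actOp p t x := rfl

@[simp] theorem actOp_apply (t : Circle) (x : Cn m) (j : Fin (m + 1)) :
    actOp p t x j = (t : ℂ) ^ p j * x j := rfl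

theorem actOp_one (x : Cn m) : actOp p 1 x = x := by ext j; simp

theorem actOp_mul (s t : Circle) (x : Cn m) : actOp p (s * t) x = actOp p s (actOp p t x) := by
  ext j; simp [mul_zpow, mul_assoc]

theorem actOp_inv_actOp (t : Circle) (x : Cn m) : actOp p t⁻¹ (actOp p t x) = x := by
  rw [← actOp_mul, inv_mul_cancel, actOp_one]

theorem inner_actOp (t : Circle) (x y : Cn m) : ⟪actOp p t x, actOp p t y⟫ = ⟪x, y⟫ := by
  rw [inner_Cn, inner_Cn]
  refine Finset.sum_congr rfl fun j _ => ?_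
  have h : (starRingEnd ℂ) ((t : ℂ) ^ p j) * (t : ℂ) ^ p j = 1 := by
    rw [mul_comm, Complex.mul_conj, Complex.normSq_eq_norm_sq, norm_zpow, Circle.norm_coe]; simp
  rw [actOp_apply, actOp_apply, map_mul]
  congr 1
  linear_combination (starRingEnd ℂ) (x j) * y j * h

theorem norm_actOp (t : Circle) (x : Cn m) : ‖actOp p t x‖ = ‖x‖ := by
  have h := inner_actOp p t x x
  rw [real_inner_self_eq_norm_sq, real_inner_self_eq_norm_sq] at h
  exact (sq_eq_sq₀ (norm_nonneg _) (norm_nonneg _)).1 h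

theorem actOp_mem_sphere {t : Circle} {x : Cn m} (hx : x ∈ sphere (0 : Cn m) 1) :
    actOp p t x ∈ sphere (0 : Cn m) 1 := by
  simpa [norm_actOp] using hx

/-- The infinitesimal generator of the action, so that `X_x = genOp p x`. -/
def genOp : Cn m →L[ℝ] Cn m := diagOp fun j => 2 * Real.pi * Complex.I * p j

@[simp] theorem genOp_apply (x : Cn m) (j : Fin (m + 1)) :
    genOp p x j = 2 * Real.pi * Complex.I * p j * x j := rfl

/-- The circle element `e^{2πiθ}`. -/
def circ (θ : ℝ) : Circle := Circle.exp (2 * Real.pi * θ)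

theorem coe_circ_zpow (θ : ℝ) (k : ℤ) :
    ((circ θ : Circle) : ℂ) ^ k = Complex.exp (2 * Real.pi * Complex.I * k * θ) := by
  rw [circ, Circle.coe_exp, ← Complex.exp_int_mul]
  congr 1
  push_cast; ring

@[simp] theorem circ_zero : circ 0 = 1 := by simp [circ]

theorem circ_add (a b : ℝ) : circ (a + b) = circ a * circ b := by
  rw [circ, mul_add, Circle.exp_add]; rfl

theorem hasDerivAt_actOp_circ (x : Cn m) (θ : ℝ) :
    HasDerivAt (fun θ => actOp p (circ θ) x) (actOp p (circ θ) (genOp p x)) θ := by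
  have h : ∀ j, HasDerivAt (fun θ : ℝ => (actOp p (circ θ) x) j)
      ((actOp p (circ θ) (genOp p x)) j) θ := by
    intro j
    simp only [actOp_apply, coe_circ_zpow, genOp_apply]
    have h1 : HasDerivAt (fun θ : ℝ => (2 * Real.pi * Complex.I * p j * θ : ℂ))
        (2 * Real.pi * Complex.I * p j) θ := by
      simpa using (Complex.ofRealCLM.hasDerivAt (x := θ)).const_mul (2 * Real.pi * Complex.I * p j : ℂ)
    refine (h1.cexp.mul_const (x j)).congr_deriv ?_
    ring
  rw [hasDerivAt_iff_hasFDerivAt, ← hasFDerivWithinAt_univ, hasFDerivWithinAt_piLp]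
  exact fun j => (h j).hasFDerivAt.hasFDerivWithinAt

theorem fundField_eq (x : Cn m) : fundField p x = genOp p x := by
  have := (hasDerivAt_actOp_circ p x 0).deriv
  rw [circ_zero, actOp_one] at this
  exact this

theorem inner_genOp_self (x : Cn m) : ⟪x, genOp p x⟫ = 0 := by
  rw [inner_Cn]
  refine Finset.sum_eq_zero fun j _ => ?_
  have : (starRingEnd ℂ) (x j) * genOp p x j =
      ((2 * Real.pi * p j * Complex.normSq (x j) : ℝ) : ℂ) * Complex.I := by
    rw [genOp_apply]
    have h := Complex.mul_conj (x j)
    push_cast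
    linear_combination (2 * Real.pi * Complex.I * p j) * h
  rw [this, Complex.re_ofReal_mul]
  simp

variable {p} in
theorem genOp_ne_zero (hp : ∀ i, p i ≠ 0) {x : Cn m} (hx : x ≠ 0) : genOp p x ≠ 0 := by
  intro h
  apply hx
  ext j
  have hj : genOp p x j = 0 := by rw [h]; rfl
  rw [genOp_apply] at hj
  have h1 : (2 * Real.pi * Complex.I * p j : ℂ) ≠ 0 := by
    have := hp j
    simp [Real.pi_ne_zero, this]
  simpa [h1] using hj

/-! ### The curvature of a connection is horizontal -/

/-- Rotating `x` in the plane of `x` and `w` gives a curve on the sphere with velocity `w` at `0`,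
along which `f` is constant. -/
theorem fderiv_tangent_eq_zero {f : Cn m → ℝ} {c : ℝ} (hc : ∀ y ∈ sphere (0 : Cn m) 1, f y = c)
    {x w : Cn m} (hx : x ∈ sphere (0 : Cn m) 1) (hf : DifferentiableAt ℝ f x) (hw : ⟪x, w⟫ = 0) :
    fderiv ℝ f x w = 0 := by
  have hc1 : HasDerivAt (fun s : ℝ => NormedSpace.exp (s • rotGen x w) x) w 0 := by
    refine ((hasDerivAt_exp_smul_const (𝕂 := ℝ) (rotGen x w) 0).clm_apply
      (hasDerivAt_const 0 x)).congr_deriv ?_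
    have hx1 : ‖x‖ = 1 := by simpa using hx
    simp [rotGen, real_inner_comm, hw, hx1]
  have h1 : HasDerivAt (fun s : ℝ => f (NormedSpace.exp (s • rotGen x w) x)) (fderiv ℝ f x w) 0 := by
    have hf' : HasFDerivAt f (fderiv ℝ f x) (NormedSpace.exp ((0 : ℝ) • rotGen x w) x) := by
      simpa using hf.hasFDerivAt
    exact hf'.comp_hasDerivAt (0 : ℝ) hc1
  have h2 : (fun s : ℝ => f (NormedSpace.exp (s • rotGen x w) x)) = fun _ => c := by
    funext s
    obtain ⟨U, hU⟩ := exists_rotation x w s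
    rw [← hU]
    exact hc _ (by simpa using hx)
  rw [h2] at h1
  exact h1.unique (hasDerivAt_const 0 c)

/-- The cochain of a one-form. -/
abbrev coch {k : ℕ} (η : Form m k) : Cn m → Coch (Cn m) := fun x => ofForm (η x)

theorem coch_one_apply (α : Form m 1) (x v : Cn m) : coch α x [v] = α x fun _ => v :=
  ofForm_ofFn (α x) fun _ => v

/-- One-forms as covectors. -/
def toCovector : (Cn m [⋀^Fin 1]→L[ℝ] ℝ) →L[ℝ] (Cn m →L[ℝ] ℝ) :=
  (ContinuousLinearMap.compL ℝ (Cn m) (Cn m [⋀^Fin 0]→L[ℝ] ℝ) ℝ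
    (ContinuousAlternatingMap.apply ℝ (Cn m) ℝ (0 : Fin 0 → Cn m))).comp
    (ContinuousAlternatingMap.curryLeftLI (𝕜 := ℝ) (E := Cn m) (F := ℝ)
      (n := 0)).toContinuousLinearMap

theorem toCovector_apply (a : Cn m [⋀^Fin 1]→L[ℝ] ℝ) (v : Cn m) :
    toCovector a v = a fun _ => v := by
  change a (Matrix.vecCons v _) = _
  congr 1
  funext i
  obtain rfl : i = 0 := Fin.eq_zero i
  rfl

variable {p}

/-- This is `L_X a = 0` evaluated on `w`, obtained by differentiating the invariance along the flow
at `θ = 0`. -/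
theorem fderiv_covector_invariant {a : Cn m → Cn m →L[ℝ] ℝ} {x w : Cn m}
    (ha : DifferentiableAt ℝ a x)
    (hinv : ∀ t : Circle, a (actOp p t x) (actOp p t w) = a x w) :
    fderiv ℝ a x (genOp p x) w + a x (genOp p w) = 0 := by
  have hda := ha.hasFDerivAt
  have hx0 := hasDerivAt_actOp_circ p x 0
  have hw0 := hasDerivAt_actOp_circ p w 0
  rw [circ_zero, actOp_one] at hx0 hw0
  have hda' : HasFDerivAt a (fderiv ℝ a x) ((fun θ => actOp p (circ θ) x) 0) := by
    simpa only [circ_zero, actOp_one] using hda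
  have hc := hda'.comp_hasDerivAt (0 : ℝ) hx0
  have hd := hc.clm_apply hw0
  have he : (fun θ : ℝ => (a ∘ fun θ => actOp p (circ θ) x) θ (actOp p (circ θ) w)) =
      fun _ => a x w := funext fun θ => hinv (circ θ)
  rw [he] at hd
  have := hd.unique (hasDerivAt_const (0 : ℝ) (a x w))
  simpa only [Function.comp_apply, circ_zero, actOp_one] using this

theorem fderiv_covector_normalized {a : Cn m → Cn m →L[ℝ] ℝ} {x w : Cn m}
    (hx : x ∈ sphere (0 : Cn m) 1) (ha : DifferentiableAt ℝ a x)
    (hnorm : ∀ y ∈ sphere (0 : Cn m) 1, a y (genOp p y) = 1) (hw : ⟪x, w⟫ = 0) :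
    fderiv ℝ a x w (genOp p x) + a x (genOp p w) = 0 := by
  have hd : HasFDerivAt (fun y => a y (genOp p y))
      ((a x).comp (genOp p) + (fderiv ℝ a x).flip (genOp p x)) x :=
    ha.hasFDerivAt.clm_apply (genOp p).hasFDerivAt
  have h0 := fderiv_tangent_eq_zero hnorm hx hd.differentiableAt hw
  rw [hd.fderiv, _root_.add_apply, ContinuousLinearMap.flip_apply,
    ContinuousLinearMap.comp_apply] at h0
  linarith

/-- Cartan's formula: `ι_X dα = L_X α - d(ι_X α) = 0`. Invariance and normalization each yield a
relation containing the term `α(genOp p w)`; subtracting them leaves `dα(X, w) = 0`. Only tangent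
`w` occur, since `α(X) = 1` is known on the sphere alone. -/
theorem IsNormalizedConnection.contr_extD {α : Form m 1} (h : IsNormalizedConnection p α)
    {x : Cn m} (hx : x ∈ sphere (0 : Cn m) 1) :
    EqOn (tangentSet x) (contr (genOp p x) (extD (coch α) x)) 0 := by
  have hdiff : DifferentiableAt ℝ α x := h.smooth.differentiableAt hx
  set a : Cn m → Cn m →L[ℝ] ℝ := fun y => toCovector (α y) with ha
  have hav : ∀ y v, a y v = α y fun _ => v := fun y v => toCovector_apply _ _
  have hda : HasFDerivAt a (fderiv ℝ a x) x :=
    ((toCovector.differentiableAt).comp x hdiff).hasFDerivAt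
  have hdir : ∀ v w, dirDeriv v (coch α) x [w] = fderiv ℝ a x v w := by
    intro v w
    have h1 : HasFDerivAt (fun y => a y w) ((fderiv ℝ a x).flip w) x :=
      (hda.clm_apply (hasFDerivAt_const w x)).congr_fderiv (by ext; simp)
    have h2 : (fun y => coch α y [w]) = fun y => a y w := by
      funext y; rw [coch_one_apply, hav]
    rw [dirDeriv, h2, h1.fderiv]
    rfl
  have key : ∀ w ∈ tangentSet x, fderiv ℝ a x (genOp p x) w = fderiv ℝ a x w (genOp p x) :=
    fun w hw => add_right_cancel ((fderiv_covector_invariant hda.differentiableAt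
      fun t => by rw [hav, hav]; exact h.invariant t x hx (fun _ => w) fun _ => hw).trans
      (fderiv_covector_normalized hx hda.differentiableAt
        (fun y hy => by rw [hav, ← fundField_eq]; exact h.normalized y hy) hw).symm)
  intro l hl
  match l with
  | [w] =>
    have e : extD (fun y => contr (genOp p x) (coch α y)) x [w] =
        dirDeriv w (coch α) x [genOp p x] - 0 := by
      rw [extD_cons]
      rfl
    rw [Coch.contr_extD, sub_apply, e, hdir, hdir, key w (hl w (by simp))]
    simp
  | [] => exact homog_extDCoeff (fun y => homog_ofForm (α y)) [genOp p x] x (by simp)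
  | v :: w :: l =>
    exact homog_extDCoeff (fun y => homog_ofForm (α y)) (genOp p x :: v :: w :: l) x (by simp)

/-! ### Integrals of connection forms against exact horizontal forms -/

/-- `A ∧ dδ = dA ∧ δ - d(A ∧ δ)`. The exact term integrates to zero by Stokes, and `dA ∧ δ` is a
top-degree form annihilated by contraction with `X`, hence zero on the sphere. -/
theorem integral_connection_mul_extD (hp : ∀ i, p i ≠ 0) {A δ : Cn m → Coch (Cn m)}
    (hA : ∀ x ∈ sphere (0 : Cn m) 1, SmoothAt A x) (hA1 : ∀ x, IsAlt 1 (A x))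
    (hAX : ∀ x ∈ sphere (0 : Cn m) 1, EqOn (tangentSet x) (contr (genOp p x) (extD A x)) 0)
    (hδ : ∀ x ∈ sphere (0 : Cn m) 1, SmoothAt δ x)
    (hδX : ∀ x ∈ sphere (0 : Cn m) 1, EqOn (tangentSet x) (contr (genOp p x) (δ x)) 0)
    (halt : ∀ x ∈ sphere (0 : Cn m) 1, IsAlt (1 + 2 * m) (extD A x * δ x)) (l : List (Cn m)) :
    ∫ x : sphere (0 : Cn m) 1, (normalCoch (x : Cn m) * (A x * extD δ x)) l
      ∂(volume : Measure (Cn m)).toSphere = 0 := by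
  have h : ∀ x : sphere (0 : Cn m) 1, (normalCoch (x : Cn m) * (A x * extD δ x)) l =
      -(normalCoch (x : Cn m) * extD (fun y => A y * δ y) x) l := by
    intro x
    have hx : ‖(x : Cn m)‖ = 1 := by simp
    have h0 := normalCoch_mul_eq_zero_of_contr hx
      (genOp_ne_zero hp (norm_ne_zero_iff.1 (by rw [hx]; exact one_ne_zero)))
      (inner_genOp_self p (x : Cn m)) (halt x x.2) (contr_mul_eqOn_zero (hAX x x.2) (hδX x x.2))
    rw [extD_mul (hA x x.2) (hδ x x.2), mul_add, h0, (hA1 x).odd, neg_mul, mul_neg]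
    simp
  simp only [h]
  rw [integral_neg, integral_normalCoch_mul_extD (fun x hx => (hA x hx).mul (hδ x hx)), neg_zero]

theorem two_le_infty : (2 : WithTop ℕ∞) ≤ ∞ := WithTop.coe_le_coe.2 (le_top : (2 : ℕ∞) ≤ ⊤)

theorem extD_extD_coch {k : ℕ} {η : Form m k} {x : Cn m} (h : ContDiffAt ℝ ∞ η x) :
    extD (extD (coch η)) x = 0 := by
  -- Smoothness of order `∞` at the point `x` need not hold on a common neighbourhood for all
  -- orders; class `C^1` near `x` suffices to identify the two derivatives there.
  have hev : ∀ᶠ y in nhds x, extD (coch η) y = coch (extDeriv η) y := by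
    have h1 : ContDiffAt ℝ 1 η x := h.of_le (by exact_mod_cast le_top)
    filter_upwards [h1.eventually (by simp)] with y hy
    exact extD_ofForm (hy.differentiableAt one_ne_zero)
  have hcongr : ∀ l : List (Cn m), ∀ {ξ ζ : Cn m → Coch (Cn m)}, (∀ᶠ y in nhds x, ξ y = ζ y) →
      extD ξ x l = extD ζ x l := by
    intro l
    induction l with
    | nil => intro ξ ζ _; rfl
    | cons v l ih =>
      intro ξ ζ hξ
      rw [extD_cons, extD_cons, ih (hξ.mono fun y hy => by rw [hy])]
      congr 1
      have : (fun y => ξ y l) =ᶠ[nhds x] fun y => ζ y l := hξ.mono fun y hy => by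
        simp only; rw [hy]
      simp only [dirDeriv]
      rw [this.fderiv_eq]
  have h2 : extD (extD (coch η)) x = extD (coch (extDeriv η)) x :=
    Coch.ext fun l => hcongr l hev
  have hd : DifferentiableAt ℝ (extDeriv η) x := by
    have h1 : DifferentiableAt ℝ (fderiv ℝ η) x :=
      (h.fderiv_right (m := 1) (by rw [one_add_one_eq_two]; exact two_le_infty)).differentiableAt
        one_ne_zero
    exact (ContinuousAlternatingMap.alternatizeUncurryFinCLM ℝ (Cn m) ℝ).differentiableAt.comp x h1
  have h2le : minSmoothness ℝ 2 ≤ (∞ : WithTop ℕ∞) := by simpa using two_le_infty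
  rw [h2, extD_ofForm hd, extDeriv_extDeriv_apply h h2le, ofForm_zero]

/-- The Chern number integral does not depend on the connection. -/
theorem integral_connection_eq (hp : ∀ i, p i ≠ 0) {α β : Form m 1}
    (hα : IsNormalizedConnection p α) (hβ : IsNormalizedConnection p β) :
    ∫ x : sphere (0 : Cn m) 1, (normalCoch (x : Cn m) *
        (coch α x * extD (coch α) x ^ m)) (frameList m) ∂(volume : Measure (Cn m)).toSphere =
      ∫ x : sphere (0 : Cn m) 1, (normalCoch (x : Cn m) *
        (coch β x * extD (coch β) x ^ m)) (frameList m) ∂(volume : Measure (Cn m)).toSphere := by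
  set A := coch α
  set B := coch β
  have sA : ∀ x ∈ sphere (0 : Cn m) 1, SmoothAt A x := fun x hx => smoothAt_ofForm (hα.smooth x hx)
  have sB : ∀ x ∈ sphere (0 : Cn m) 1, SmoothAt B x := fun x hx => smoothAt_ofForm (hβ.smooth x hx)
  have aA : ∀ x ∈ sphere (0 : Cn m) 1, IsAlt 2 (extD A x) := fun x hx =>
    ⟨_, extD_ofForm (hα.smooth.differentiableAt hx)⟩
  have aB : ∀ x ∈ sphere (0 : Cn m) 1, IsAlt 2 (extD B x) := fun x hx =>
    ⟨_, extD_ofForm (hβ.smooth.differentiableAt hx)⟩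
  have hAB : ∀ x ∈ sphere (0 : Cn m) 1,
      EqOn (tangentSet x) (contr (genOp p x) (A x - B x)) 0 := by
    intro x hx l _
    have e := hα.normalized x hx
    have e' := hβ.normalized x hx
    rw [fundField_eq] at e e'
    match l with
    | [] =>
      change coch α x [genOp p x] - coch β x [genOp p x] = 0
      rw [coch_one_apply, coch_one_apply, e, e', sub_self]
    | v :: l =>
      exact ((IsAlt.of_form (α x)).sub (IsAlt.of_form (β x))).homog (genOp p x :: v :: l) (by simp)
  -- The curvatures are even and commute, so `(dα - dβ) S` telescopes to `(dα)^m - (dβ)^m`. As `S`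
  -- is closed and horizontal, `(α - β) S` is a horizontal primitive of that difference.
  set S : Cn m → Coch (Cn m) := fun x =>
    ∑ i ∈ Finset.range m, extD A x ^ i * extD B x ^ (m - 1 - i)
  have sS : ∀ x ∈ sphere (0 : Cn m) 1, SmoothAt S x := fun x hx =>
    SmoothAt.sum fun i _ => ((sA x hx).extD.pow i).mul ((sB x hx).extD.pow _)
  have dS : ∀ x ∈ sphere (0 : Cn m) 1, extD S x = 0 := by
    intro x hx
    rw [extD_sum fun i _ => ((sA x hx).extD.pow i).mul ((sB x hx).extD.pow _)]
    refine Finset.sum_eq_zero fun i _ => ?_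
    rw [extD_mul ((sA x hx).extD.pow i) ((sB x hx).extD.pow _),
      extD_pow_of_closed (sA x hx).extD (extD_extD_coch (hα.smooth x hx)),
      extD_pow_of_closed (sB x hx).extD (extD_extD_coch (hβ.smooth x hx)), zero_mul, mul_zero,
      add_zero]
  have hS : ∀ x ∈ sphere (0 : Cn m) 1, EqOn (tangentSet x) (contr (genOp p x) (S x)) 0 := by
    intro x hx
    simp only [S, map_sum]
    have : EqOn (tangentSet x) (∑ i ∈ Finset.range m,
        contr (genOp p x) (extD A x ^ i * extD B x ^ (m - 1 - i)))
        (∑ i ∈ Finset.range m, (0 : Coch (Cn m))) :=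
      EqOn.sum fun i _ => contr_mul_eqOn_zero (contr_pow_eqOn_zero (hα.contr_extD hx) i)
        (contr_pow_eqOn_zero (hβ.contr_extD hx) _)
    simpa using this
  set δ : Cn m → Coch (Cn m) := fun x => (A x - B x) * S x
  have hδ : ∀ x ∈ sphere (0 : Cn m) 1, extD δ x = extD A x ^ m - extD B x ^ m := by
    intro x hx
    rw [extD_mul ((sA x hx).sub (sB x hx)) (sS x hx), dS x hx, mul_zero, add_zero,
      extD_sub (sA x hx) (sB x hx)]
    exact (Commute.mul_geom_sum₂ (even_comm (aA x hx).even _) m)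
  have key := integral_connection_mul_extD hp sB (fun x => IsAlt.of_form (β x))
    (fun x hx => hβ.contr_extD hx) (δ := δ) (fun x hx => ((sA x hx).sub (sB x hx)).mul (sS x hx))
    (fun x hx => contr_mul_eqOn_zero (hAB x hx) (hS x hx)) (fun x hx => by
      simp only [δ, S, Finset.mul_sum]
      refine IsAlt.sum fun i hi => ?_
      have hi : i < m := Finset.mem_range.1 hi
      exact ((aB x hx).mul (((IsAlt.of_form (α x)).sub (IsAlt.of_form (β x))).mul
        (((aA x hx).pow_two i).mul ((aB x hx).pow_two _)))).cast (by omega)) (frameList m)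
  rw [← sub_eq_zero, ← integral_sub, ← key]
  · refine integral_congr_ae (Filter.Eventually.of_forall fun x => ?_)
    have hx : ‖(x : Cn m)‖ = 1 := by simp
    have h0 := normalCoch_mul_eq_zero_of_contr hx
      (genOp_ne_zero hp (norm_ne_zero_iff.1 (by rw [hx]; exact one_ne_zero)))
      (inner_genOp_self p (x : Cn m))
      (((IsAlt.of_form (α x)).sub (IsAlt.of_form (β x))).mul ((aA x x.2).pow_two m))
      (contr_mul_eqOn_zero (hAB x x.2) (contr_pow_eqOn_zero (hα.contr_extD x.2) m))
    simp only
    rw [hδ x x.2, ← sub_apply, ← mul_sub]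
    -- The term `(α - β) ∧ (dα)^m` is a horizontal top-degree form on the sphere, hence zero; the
    -- other term is the integrand of `key`.
    have e : coch α x * extD A x ^ m - coch β x * extD B x ^ m =
        (coch α x - coch β x) * extD A x ^ m + coch β x * (extD A x ^ m - extD B x ^ m) := by
      noncomm_ring
    change (normalCoch (x : Cn m) * (coch α x * extD A x ^ m - coch β x * extD B x ^ m)) _ = _
    rw [e, mul_add, h0, zero_add]
  · exact integrable_on_sphere (f := fun x => (normalCoch x * (A x * extD A x ^ m)) (frameList m))
      fun x hx => ((smoothAt_normalCoch x).mul
        ((sA x hx).mul ((sA x hx).extD.pow m)) (frameList m)).continuousAt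
  · exact integrable_on_sphere (f := fun x => (normalCoch x * (B x * extD B x ^ m)) (frameList m))
      fun x hx => ((smoothAt_normalCoch x).mul
        ((sB x hx).mul ((sB x hx).extD.pow m)) (frameList m)).continuousAt

end

section

open Coch

/-! ### The standard connection -/

variable {m : ℕ} (p : Fin (m + 1) → ℤ)

/-- Multiplication by `i / (2 π p_j)` in the `j`-th coordinate. -/
def stdOp : Cn m →L[ℝ] Cn m := diagOp fun j => ((1 / (2 * Real.pi * p j) : ℝ) : ℂ) * Complex.I

theorem inner_stdOp (v w : Cn m) : ⟪stdOp p v, w⟫ =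
    ∑ j, 1 / (2 * Real.pi * p j) * ((starRingEnd ℂ) (v j) * w j).im := by
  rw [inner_Cn]
  refine Finset.sum_congr rfl fun j _ => ?_
  rw [stdOp, diagOp_apply, map_mul, map_mul, Complex.conj_ofReal, Complex.conj_I, mul_assoc,
    mul_assoc, Complex.re_ofReal_mul]
  simp

theorem inner_stdOp_comm (v w : Cn m) : ⟪stdOp p v, w⟫ = -⟪stdOp p w, v⟫ := by
  rw [inner_stdOp, inner_stdOp, ← Finset.sum_neg_distrib]
  refine Finset.sum_congr rfl fun j _ => ?_
  simp; ring

theorem stdOp_actOp (t : Circle) (v : Cn m) : stdOp p (actOp p t v) = actOp p t (stdOp p v) := by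
  ext j
  simp only [stdOp, diagOp_apply, actOp_apply]
  ring

variable {p} in
theorem inner_stdOp_genOp (hp : ∀ i, p i ≠ 0) (v w : Cn m) :
    ⟪stdOp p v, genOp p w⟫ = ⟪v, w⟫ := by
  rw [inner_Cn, inner_Cn]
  refine Finset.sum_congr rfl fun j _ => ?_
  rw [stdOp, diagOp_apply, genOp_apply, map_mul, map_mul, Complex.conj_ofReal, Complex.conj_I]
  congr 1
  have h1 : (p j : ℂ) ≠ 0 := by exact_mod_cast hp j
  have h2 : (Real.pi : ℂ) ≠ 0 := by exact_mod_cast Real.pi_ne_zero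
  push_cast
  field_simp
  rw [Complex.I_sq]
  ring

/-- The connection form `∑ j, (x_j dy_j - y_j dx_j) / (2 π p_j)`. -/
def stdConn : Form m 1 := fun x => conormal (stdOp p x)

theorem coch_stdConn (x : Cn m) : coch (stdConn p) x = normalCoch (stdOp p x) := ofForm_conormal _

theorem stdConn_apply (x v : Cn m) : stdConn p x (fun _ => v) = ⟪stdOp p x, v⟫ := by
  rw [← coch_one_apply, coch_stdConn]; rfl

theorem contDiff_stdConn : ContDiff ℝ ∞ (stdConn p) := by
  have : stdConn p = fun x => (ContinuousAlternatingMap.ofSubsingletonLIE (0 : Fin 1) :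
      (Cn m →L[ℝ] ℝ) ≃ₗᵢ[ℝ] _) (innerSL ℝ (stdOp p x)) := rfl
  rw [this]
  exact (LinearIsometryEquiv.contDiff _).comp
    ((innerSL ℝ).contDiff.comp (stdOp p).contDiff)

variable {p} in
theorem stdConn_isNormalizedConnection (hp : ∀ i, p i ≠ 0) :
    IsNormalizedConnection p (stdConn p) where
  smooth x _ := (contDiff_stdConn p).contDiffAt
  invariant t x _ v _ := by
    have hv : v = fun _ => v 0 := by funext i; rw [Fin.eq_zero i]
    rw [hv]
    simp only [act_eq]
    rw [stdConn_apply, stdConn_apply, stdOp_actOp, inner_actOp]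
  normalized x hx := by
    rw [stdConn_apply, fundField_eq, inner_stdOp_genOp hp, real_inner_self_eq_norm_sq,
      mem_sphere_zero_iff_norm.1 hx, one_pow]

/-- The curvature of the standard connection, a constant two-form. -/
def stdCurv : Coch (Cn m)
  | [v, w] => 2 * ⟪stdOp p v, w⟫
  | _ => 0

theorem contr_stdCurv (v : Cn m) : contr v (stdCurv p) = (2 : ℝ) • normalCoch (stdOp p v) := by
  ext l
  match l with
  | [] => exact (mul_zero _).symm
  | [w] => rfl
  | w :: w' :: l => exact (mul_zero _).symm

/-- The connection is `v ↦ ⟪T x, v⟫` with `T = stdOp p` linear and skew, so its differential is `⟪T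
v, w⟫ - ⟪T w, v⟫ = 2 ⟪T v, w⟫`, independently of `x`. -/
theorem extD_stdConn (x : Cn m) : extD (coch (stdConn p)) x = stdCurv p := by
  refine ext_contr rfl fun v => ?_
  rw [contr_extD, contr_stdCurv]
  have h1 : (fun y => contr v (coch (stdConn p) y)) =
      fun y => ⟪stdOp p y, v⟫ • (1 : Coch (Cn m)) := by
    funext y; rw [coch_stdConn, contr_normalCoch]
  have h2 : ∀ u w, dirDeriv w (fun y => ⟪stdOp p y, v⟫ • (1 : Coch (Cn m))) x u =
      ⟪stdOp p w, v⟫ * (1 : Coch (Cn m)) u := by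
    intro u w
    have hd : HasFDerivAt (fun y => ⟪stdOp p y, v⟫ * (1 : Coch (Cn m)) u)
        (((1 : Coch (Cn m)) u) • (innerSL ℝ v).comp (stdOp p)) x := by
      have : (fun y => ⟪stdOp p y, v⟫ * (1 : Coch (Cn m)) u) =
          fun y => (((1 : Coch (Cn m)) u) • (innerSL ℝ v).comp (stdOp p)) y := by
        funext y; simp [real_inner_comm, mul_comm]
      rw [this]
      exact ContinuousLinearMap.hasFDerivAt _
    change fderiv ℝ (fun y => ⟪stdOp p y, v⟫ * (1 : Coch (Cn m)) u) x w = _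
    rw [hd.fderiv]
    simp [real_inner_comm, mul_comm]
  rw [h1]
  ext l
  match l with
  | [] =>
    have : ∀ y, coch (stdConn p) y [] = 0 := fun y => by rw [coch_stdConn]; rfl
    simp [dirDeriv, this]
  | w :: l =>
    rw [sub_apply, extD_cons, h2]
    have h3 : (fun y => contr w (⟪stdOp p y, v⟫ • (1 : Coch (Cn m)))) = fun _ => 0 := by
      funext y; simp
    rw [h3, extD_const]
    have h4 : dirDeriv v (coch (stdConn p)) x (w :: l) =
        ⟪stdOp p v, w⟫ * (1 : Coch (Cn m)) l := by
      have hd : HasFDerivAt (fun y => coch (stdConn p) y (w :: l))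
          (((1 : Coch (Cn m)) l) • (innerSL ℝ w).comp (stdOp p)) x := by
        have : (fun y => coch (stdConn p) y (w :: l)) =
            fun y => (((1 : Coch (Cn m)) l) • (innerSL ℝ w).comp (stdOp p)) y := by
          funext y
          rw [coch_stdConn, ← contr_apply w (normalCoch _) l, contr_normalCoch]
          simp [real_inner_comm, mul_comm]
        rw [this]
        exact ContinuousLinearMap.hasFDerivAt _
      rw [dirDeriv, hd.fderiv]
      simp [real_inner_comm, mul_comm]
    rw [h4, inner_stdOp_comm p w v, smul_apply, ← contr_apply w (normalCoch _) l, contr_normalCoch]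
    simp
    ring

theorem isAlt_stdCurv : IsAlt 2 (stdCurv p) := by
  refine ⟨extDeriv (stdConn p) 0, ?_⟩
  rw [← extD_stdConn p 0, extD_ofForm ((contDiff_stdConn p).differentiable (by simp) 0)]

/-- The pairs `e_j, i e_j` for `j` in a list. -/
def pairList (js : List (Fin (m + 1))) : List (Cn m) :=
  js.flatMap fun j => [EuclideanSpace.single j 1, EuclideanSpace.single j Complex.I]

theorem frameList_eq : frameList m = pairList (List.finRange (m + 1)) := by
  have h : ∀ n : ℕ, (List.range (2 * n)).map (realFrame m) =
      (List.range n).flatMap fun j => [realFrame m (2 * j), realFrame m (2 * j + 1)] := by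
    intro n
    induction n with
    | zero => rfl
    | succ n ih =>
      rw [List.range_succ, List.flatMap_append, ← ih, show 2 * (n + 1) = 2 * n + 1 + 1 by ring,
        List.range_succ, List.range_succ]
      simp
  rw [frameList, show 2 * m + 2 = 2 * (m + 1) by ring, h, ← List.map_coe_finRange_eq_range,
    List.flatMap_map, pairList]
  simp only [realFrame_even, realFrame_odd]

/-- Contracting `ω^(n+1)` with `e_j` gives `(n + 1) (ι_{e_j} ω) ∧ ω^n`, and `ι_{e_j} ω = dy_j / (π
p_j)` is nonzero only on `i e_j` among the remaining vectors. Each coordinate plane therefore splits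
off one factor. -/
theorem stdCurv_pow_pairList (js : List (Fin (m + 1))) (hjs : js.Nodup) :
    (stdCurv p ^ js.length) (pairList js) =
      js.length.factorial * (js.map fun j => 1 / (Real.pi * p j)).prod := by
  induction js with
  | nil => simp [pairList]
  | cons j js ih =>
    rw [List.nodup_cons] at hjs
    have hl : pairList (j :: js) =
        EuclideanSpace.single j 1 :: EuclideanSpace.single j Complex.I :: pairList js := rfl
    have hmem : ∀ v ∈ pairList js, ∀ i, v i ≠ 0 → i ∈ js := by
      intro v hv i hi
      obtain ⟨k, hk, hv⟩ := List.mem_flatMap.1 hv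
      have : i = k := by
        by_contra hik
        rcases List.mem_cons.1 hv with rfl | hv
        · simp [hik] at hi
        · rw [List.mem_singleton.1 hv] at hi
          simp [hik] at hi
      exact this ▸ hk
    have hinner : ∀ w : Cn m, ⟪stdOp p (EuclideanSpace.single j 1), w⟫ =
        1 / (2 * Real.pi * p j) * (w j).im := by
      intro w
      rw [inner_stdOp, Finset.sum_eq_single j]
      · simp
      · intro i _ hi; simp [hi]
      · simp
    have hz : EqOn {v | v ∈ pairList js}
        (normalCoch (stdOp p (EuclideanSpace.single j 1))) 0 := by
      refine normalCoch_eqOn_zero _ fun v hv => ?_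
      have : v j = 0 := by
        by_contra h
        exact hjs.1 (hmem v hv j h)
      rw [hinner, this]; simp
    rw [hl, List.length_cons]
    change (contr _ (stdCurv p ^ (js.length + 1))) (_ :: pairList js) = _
    rw [contr_pow_succ (isAlt_stdCurv p).even, contr_stdCurv, smul_mul_assoc, smul_apply, smul_apply,
      normalCoch_mul_cons, (hz.mul (.refl _)) _ fun v hv => hv, zero_mul, hinner, ih hjs.2,
      List.map_cons, List.prod_cons, Nat.factorial_succ]
    simp
    field_simp

/-- The top exterior power of the curvature on the standard frame. -/
theorem stdCurv_pow_frameList : (stdCurv p ^ (m + 1)) (frameList m) =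
    (m + 1).factorial * ∏ j, (1 / (Real.pi * p j)) := by
  have := stdCurv_pow_pairList p (List.finRange (m + 1)) (List.nodup_finRange _)
  rw [List.length_finRange] at this
  rw [frameList_eq, this, Fin.prod_univ_def]

/-- `ν ∧ ω^(m+1)` has degree `2m + 3`, above the dimension, so it is zero. Contracting it with `x`,
where `ν(x) = 1` and `ι_x ω = 2α`, gives `ω^(m+1) = 2(m + 1) ν ∧ α ∧ ω^m`. -/
theorem normalCoch_mul_stdConn {x : Cn m} (hx : ‖x‖ = 1) :
    (normalCoch x * (coch (stdConn p) x * stdCurv p ^ m)) (frameList m) =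
      m.factorial / 2 * ∏ j, (1 / (Real.pi * p j)) := by
  have h1 : normalCoch x * stdCurv p ^ (m + 1) = 0 :=
    ((isAlt_normalCoch x).mul ((isAlt_stdCurv p).pow_two (m + 1))).eq_zero_of_lt (by omega)
  have h2 := congrArg (contr x) h1
  rw [contr_mul, contr_pow_succ (isAlt_stdCurv p).even, contr_stdCurv, contr_normalCoch,
    hat_normalCoch, real_inner_self_eq_norm_sq, hx, map_zero] at h2
  have h3 := congrFun h2 (frameList m)
  simp only [one_pow, one_smul, one_mul, smul_mul_assoc, mul_smul_comm, neg_mul, add_apply,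
    smul_apply, neg_apply] at h3
  rw [stdCurv_pow_frameList, Nat.factorial_succ, ← coch_stdConn] at h3
  simp only [zero_apply] at h3
  push_cast at h3
  have h4 : ((m : ℝ) + 1) ≠ 0 := by positivity
  apply mul_left_cancel₀ h4
  linarith

theorem measureReal_toSphere (m : ℕ) :
    (volume : Measure (Cn m)).toSphere.real univ = 2 * Real.pi ^ (m + 1) / m.factorial := by
  rw [Measure.toSphere_real_apply_univ, measureReal_def,
    InnerProductSpace.volume_ball_of_dim_even (k := m + 1) (by rw [finrank_Cn]; ring)]
  rw [finrank_Cn]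
  simp
  rw [ENNReal.toReal_ofReal (by positivity), Nat.factorial_succ]
  push_cast
  field_simp

variable {p} in
theorem integral_stdConn (hp : ∀ i, p i ≠ 0) :
    ∫ x : sphere (0 : Cn m) 1, (normalCoch (x : Cn m) *
      (coch (stdConn p) x * extD (coch (stdConn p)) x ^ m)) (frameList m)
      ∂(volume : Measure (Cn m)).toSphere = 1 / ∏ i, (p i : ℝ) := by
  have h : ∀ x : sphere (0 : Cn m) 1, (normalCoch (x : Cn m) *
      (coch (stdConn p) x * extD (coch (stdConn p)) x ^ m)) (frameList m) =
      m.factorial / 2 * ∏ j, (1 / (Real.pi * p j)) := by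
    intro x
    rw [extD_stdConn]
    exact normalCoch_mul_stdConn p (by simp)
  simp only [h]
  rw [integral_const, measureReal_toSphere, smul_eq_mul]
  have h1 : ∏ j, (1 / (Real.pi * p j)) = 1 / (Real.pi ^ (m + 1) * ∏ j, (p j : ℝ)) := by
    rw [Finset.prod_div_distrib, Finset.prod_mul_distrib]
    simp
  have h2 : ∏ j, (p j : ℝ) ≠ 0 := Finset.prod_ne_zero_iff.2 fun j _ => by exact_mod_cast hp j
  have h3 : (m.factorial : ℝ) ≠ 0 := by positivity
  rw [h1]
  have := Real.pi_ne_zero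
  field_simp

variable {p} in
theorem sphereIntegral_connection (hp : ∀ i, p i ≠ 0) {α : Form m 1}
    (hα : IsNormalizedConnection p α) :
    sphereIntegral (fun x => wedge (α x) (wedgePow (extDeriv α x) m)) = 1 / ∏ i, (p i : ℝ) := by
  rw [sphereIntegral_eq, ← integral_stdConn hp,
    ← integral_connection_eq hp hα (stdConn_isNormalizedConnection hp)]
  refine integral_congr_ae (Filter.Eventually.of_forall fun x => ?_)
  simp only
  rw [ofForm_wedge, ofForm_wedgePow, extD_ofForm (hα.smooth.differentiableAt x.2)]

end

section

open Coch

/-! ### Pull-back of cochains by the action -/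

namespace Coch

/-- Pull-back of a cochain. -/
def pull {E : Type*} (U : E → E) (f : Coch E) : Coch E := fun l => f (l.map U)

theorem pull_apply {E : Type*} (U : E → E) (f : Coch E) (l : List E) : pull U f l = f (l.map U) := rfl

theorem pull_hat {E : Type*} (U : E → E) (f : Coch E) : pull U (hat f) = hat (pull U f) := by
  ext l
  simp [pull_apply, hat_apply]

theorem contr_pull {E : Type*} (U : E → E) (v : E) (f : Coch E) :
    contr v (pull U f) = pull U (contr (U v) f) := rfl

theorem pull_mul {E : Type*} (U : E → E) (f g : Coch E) :
    pull U (f * g) = pull U f * pull U g := by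
  ext l
  induction l generalizing f g with
  | nil => rfl
  | cons v l ih =>
    rw [mul_cons, contr_pull, contr_pull, ← pull_hat, ← ih, ← ih]
    rfl

theorem pull_pow {E : Type*} (U : E → E) (f : Coch E) (n : ℕ) : pull U (f ^ n) = pull U f ^ n := by
  induction n with
  | zero => ext l; cases l <;> rfl
  | succ n ih => rw [pow_succ, pow_succ, pull_mul, ih]

end Coch

variable {m : ℕ} {p : Fin (m + 1) → ℤ}

theorem coch_ofFn {k : ℕ} (η : Form m k) (x : Cn m) (v : Fin k → Cn m) :
    coch η x (List.ofFn v) = η x v := ofForm_ofFn _ _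

theorem coch_of_length_ne {k : ℕ} (η : Form m k) (x : Cn m) {l : List (Cn m)} (hl : l.length ≠ k) :
    coch η x l = 0 := homog_ofForm _ _ hl

theorem IsAlt.pull {k : ℕ} {f : Coch (Cn m)} (hf : IsAlt k f) (U : Cn m →L[ℝ] Cn m) :
    IsAlt k (pull U f) := by
  obtain ⟨a, rfl⟩ := hf
  refine ⟨a.compContinuousLinearMap U, Homog.ext (k := k) (fun l hl => ?_) (homog_ofForm _) fun v => ?_⟩
  · exact homog_ofForm a _ (by simpa using hl)
  · rw [pull_apply, List.map_ofFn, ofForm_ofFn, ofForm_ofFn]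
    rfl

theorem pull_normalCoch (t : Circle) (x : Cn m) :
    pull (actOp p t) (normalCoch (actOp p t x)) = normalCoch x := by
  ext l
  match l with
  | [] => rfl
  | [v] => exact inner_actOp p t x v
  | _ :: _ :: _ => rfl

theorem pull_stdCurv (t : Circle) : pull (actOp p t) (stdCurv p) = stdCurv p := by
  ext l
  match l with
  | [] => rfl
  | [_] => rfl
  | [v, w] =>
    change 2 * ⟪stdOp p (actOp p t v), actOp p t w⟫ = 2 * ⟪stdOp p v, w⟫
    rw [stdOp_actOp, inner_actOp]
  | _ :: _ :: _ :: _ => rfl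

theorem stdCurv_pow_frameList_ne_zero (hp : ∀ i, p i ≠ 0) :
    (stdCurv p ^ (m + 1)) (frameList m) ≠ 0 := by
  rw [stdCurv_pow_frameList]
  refine mul_ne_zero (by positivity) (Finset.prod_ne_zero_iff.2 fun j _ => ?_)
  have := hp j
  simp [Real.pi_ne_zero, this]

/-- The action preserves the orientation and the volume. -/
theorem IsAlt.map_actOp_frameList (hp : ∀ i, p i ≠ 0) {f : Coch (Cn m)}
    (hf : IsAlt (2 * m + 2) f) (t : Circle) :
    f ((frameList m).map (actOp p t)) = f (frameList m) := by
  have key : ∀ {g : Coch (Cn m)}, IsAlt (2 * m + 2) g → g ((frameList m).map (actOp p t)) =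
      Matrix.det (Matrix.of fun a b : Fin (2 * m + 2) =>
        ⟪realFrame m a, actOp p t (realFrame m b)⟫) * g (frameList m) := by
    intro g hg
    rw [← hg.top_eq_det]
    congr 1
    rw [frameList, ← ofFn_realFrame, List.map_ofFn]
    rfl
  -- The form `ω^(m+1)` is a nonzero invariant volume form, which forces the determinant of the
  -- action to be `1`.
  have h := key ((isAlt_stdCurv p).pow_two (m + 1))
  rw [← pull_apply (actOp p t) (stdCurv p ^ (m + 1)), pull_pow, pull_stdCurv] at h
  rw [key hf, (mul_right_cancel₀ (stdCurv_pow_frameList_ne_zero hp) ((one_mul _).trans h)).symm, one_mul]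

theorem Invariant.pull_eqOn {k : ℕ} {η : Form m k} (h : Invariant p η) (t : Circle) {x : Cn m}
    (hx : x ∈ sphere (0 : Cn m) 1) :
    EqOn (tangentSet x) (pull (actOp p t) (coch η (actOp p t x))) (coch η x) := by
  intro l hl
  by_cases hk : l.length = k
  · obtain ⟨v, rfl⟩ := exists_ofFn_of_length hk
    rw [pull_apply, List.map_ofFn, coch_ofFn, coch_ofFn]
    exact h t x hx v fun i => hl _ (by simp [List.mem_ofFn'])
  · rw [pull_apply, coch_of_length_ne _ _ hk, coch_of_length_ne _ _ (by simpa using hk)]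

theorem Horizontal.contr_eqOn {k : ℕ} {η : Form m k} (hη : Horizontal p η) {x : Cn m}
    (hx : x ∈ sphere (0 : Cn m) 1) : EqOn (tangentSet x) (contr (genOp p x) (coch η x)) 0 := by
  intro l hl
  by_cases hk : (genOp p x :: l).length = k
  · obtain ⟨v, hv⟩ := exists_ofFn_of_length hk
    change coch η x (genOp p x :: l) = 0
    rw [hv, coch_ofFn]
    refine hη x hx v (fun i => ?_) ?_
    · have : v i ∈ genOp p x :: l := by rw [hv]; simp [List.mem_ofFn']
      rcases List.mem_cons.1 this with h | h
      · rw [h]; exact inner_genOp_self p x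
      · exact hl _ h
    · have : genOp p x ∈ List.ofFn v := by rw [← hv]; simp
      rw [fundField_eq]
      exact (List.mem_ofFn' _ _).1 this
  · exact homog_ofForm _ _ hk

/-- The density of the top form `α ∧ η` on the sphere. -/
def density (α : Form m 1) (η : Form m (2 * m)) (x : Cn m) : ℝ :=
  (normalCoch x * (coch α x * coch η x)) (frameList m)

theorem isAlt_conn_mul (α : Form m 1) (η : Form m (2 * m)) (x : Cn m) :
    IsAlt (1 + 2 * m) (coch α x * coch η x) := (IsAlt.of_form _).mul (IsAlt.of_form _)

/-- The action preserves `ν` and the volume. Invariance of `α` and `η` is known on tangent vectors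
only, but wedging with `ν` discards everything else. -/
theorem density_actOp (hp : ∀ i, p i ≠ 0) {α : Form m 1} {η : Form m (2 * m)}
    (hα : Invariant p α) (hη : Invariant p η) (t : Circle) {x : Cn m}
    (hx : x ∈ sphere (0 : Cn m) 1) : density α η (actOp p t x) = density α η x := by
  have hx1 : ‖x‖ = 1 := by simpa using hx
  have h1 := (((isAlt_normalCoch (actOp p t x)).mul (isAlt_conn_mul α η (actOp p t x))).cast
    (by ring)).map_actOp_frameList hp t
  rw [density, ← h1, ← pull_apply (actOp p t) (normalCoch _ * _), pull_mul, pull_mul, pull_normalCoch, density]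
  have h2 := normalCoch_mul_eq_zero hx1
    ((((IsAlt.of_form _).pull (actOp p t)).mul ((IsAlt.of_form _).pull (actOp p t))).sub
      (isAlt_conn_mul α η x)) (by
        intro l hl
        have := ((hα.pull_eqOn t hx).mul (hη.pull_eqOn t hx)) l hl
        rw [sub_apply, this, sub_self]; rfl)
  rw [mul_sub, sub_eq_zero] at h2
  rw [h2]

theorem contDiffAt_density {α : Form m 1} {η : Form m (2 * m)} {x : Cn m}
    (hα : ContDiffAt ℝ ∞ α x) (hη : ContDiffAt ℝ ∞ η x) : ContDiffAt ℝ ∞ (density α η) x :=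
  ((smoothAt_normalCoch x).mul ((smoothAt_ofForm hα).mul (smoothAt_ofForm hη))) _

/-! ### The integrand of the orbifold integral -/

namespace SliceChart
variable (c : SliceChart p)

theorem contDiffAt {u : Model m} (hu : u ∈ c.D) : ContDiffAt ℝ ∞ c.φ u :=
  c.smooth.contDiffAt (c.isOpen.mem_nhds hu)

theorem hasFDerivAt {u : Model m} (hu : u ∈ c.D) : HasFDerivAt c.φ (fderiv ℝ c.φ u) u :=
  ((c.contDiffAt hu).differentiableAt (by simp)).hasFDerivAt

theorem inner_fderiv {u : Model m} (hu : u ∈ c.D) (w : Model m) :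
    ⟪c.φ u, fderiv ℝ c.φ u w⟫ = 0 := by
  have h := (c.hasFDerivAt hu).inner ℝ (c.hasFDerivAt hu)
  have h1 : (fun v => ⟪c.φ v, c.φ v⟫) =ᶠ[nhds u] fun _ => (1 : ℝ) := by
    filter_upwards [c.isOpen.mem_nhds hu] with v hv
    rw [real_inner_self_eq_norm_sq, mem_sphere_zero_iff_norm.1 (c.mem_sphere v hv), one_pow]
  have h2 := h.unique ((hasFDerivAt_const (1 : ℝ) u).congr_of_eventuallyEq h1)
  have h3 := congrArg (fun L => L w) h2
  simpa [real_inner_comm] using h3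

/-- Evaluate `ν ∧ α ∧ η` on `x`, `X` and the pushed frame. As a top-degree form it gives determinant
times density; expanding, `ν(x) = 1`, `α(X) = 1` and `ι_X η = 0` leave only `η` on the pushed frame.
-/
theorem transverseDet_mul_density {α : Form m 1} (hα : IsNormalizedConnection p α)
    {η : Form m (2 * m)} (hη : Horizontal p η) {u : Model m} (hu : u ∈ c.D) :
    transverseDet p c.φ u * density α η (c.φ u) = η (c.φ u) (pushFrame c.φ u) := by
  set x := c.φ u with hx
  have hxs := c.mem_sphere u hu
  have hx1 : ‖x‖ = 1 := by simpa using hxs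
  set X := fundField p x with hX
  have hXt : X ∈ tangentSet x := by
    rw [hX, fundField_eq]; exact inner_genOp_self p x
  have hpush : ∀ v ∈ List.ofFn (pushFrame c.φ u), v ∈ tangentSet x := by
    intro v hv
    obtain ⟨i, rfl⟩ := (List.mem_ofFn' _ _).1 hv
    exact c.inner_fderiv hu _
  have h1 := ((((isAlt_normalCoch x).mul (isAlt_conn_mul α η x))).cast
    (by ring)).top_eq_det (Matrix.vecCons x (Matrix.vecCons X (pushFrame c.φ u)))
  change _ = transverseDet p c.φ u * density α η x at h1
  rw [← h1]
  have h2 : List.ofFn (Matrix.vecCons x (Matrix.vecCons X (pushFrame c.φ u)) :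
      Fin (2 * m + 2) → Cn m) = x :: X :: List.ofFn (pushFrame c.φ u) := by
    rw [List.ofFn_succ, List.ofFn_succ]; rfl
  have h3 : contr X (coch α x) = 1 := by
    ext l
    match l with
    | [] => exact (coch_one_apply α x X).trans (hα.normalized x hxs)
    | v :: l => exact (IsAlt.of_form (α x)).homog (X :: v :: l) (by simp)
  have h4 : EqOn (tangentSet x) (contr X (coch η x)) 0 := by
    rw [hX, fundField_eq]; exact hη.contr_eqOn hxs
  rw [h2, normalCoch_mul_cons_self hx1, mul_cons, h3, one_mul,
    ((EqOn.refl (hat (coch α x))).mul h4) _ hpush, mul_zero,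
    zero_apply, add_zero, coch_ofFn]
  · intro v hv
    rcases List.mem_cons.1 hv with rfl | h
    · exact hXt
    · exact hpush _ h

end SliceChart

end

section

open Coch

/-! ### Polar coordinates -/

/-- Polar coordinates separate direction from radius. With a radial cutoff for `h`, this turns a
sphere integral into a volume integral, to which the change of variables formula applies. -/
theorem integral_norm_mul_direction {E : Type*} [NormedAddCommGroup E] [NormedSpace ℝ E]
    [FiniteDimensional ℝ E] [Nontrivial E] [MeasurableSpace E] [BorelSpace E] (μ : Measure E)
    [μ.IsAddHaarMeasure] (h : ℝ → ℝ) (G : E → ℝ) :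
    ∫ x, G (‖x‖⁻¹ • x) * h ‖x‖ ∂μ = (∫ x : sphere (0 : E) 1, G x ∂μ.toSphere) *
      ∫ y in Ioi (0 : ℝ), y ^ (Module.finrank ℝ E - 1) * h y :=
  calc
    ∫ x, G (‖x‖⁻¹ • x) * h ‖x‖ ∂μ =
        ∫ x : ({(0)}ᶜ : Set E), G (‖x.1‖⁻¹ • x.1) * h ‖x.1‖ ∂(μ.comap (↑)) := by
      rw [integral_subtype_comap (measurableSet_singleton _).compl
        fun x => G (‖x‖⁻¹ • x) * h ‖x‖, restrict_compl_singleton]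
    _ = ∫ x, G x.1 * h x.2 ∂μ.toSphere.prod (.volumeIoiPow (Module.finrank ℝ E - 1)) := by
      simpa using μ.measurePreserving_homeomorphUnitSphereProd.integral_comp
        (Homeomorph.measurableEmbedding _)
        (fun z : sphere (0 : E) 1 × Ioi (0 : ℝ) => G z.1 * h z.2)
    _ = (∫ x : sphere (0 : E) 1, G x ∂μ.toSphere) *
        ∫ x : Ioi (0 : ℝ), h x ∂.volumeIoiPow (Module.finrank ℝ E - 1) :=
      integral_prod_mul (fun x : sphere (0 : E) 1 => G x) fun y : Ioi (0 : ℝ) => h y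
    _ = _ := by
      congr 1
      simp only [Measure.volumeIoiPow, ENNReal.ofReal]
      rw [integral_withDensity_eq_integral_smul,
        integral_subtype_comap measurableSet_Ioi
          fun a => Real.toNNReal (a ^ (Module.finrank ℝ E - 1)) • h a,
        setIntegral_congr_fun measurableSet_Ioi fun x hx => ?_]
      · simp only [NNReal.smul_def]
        rw [Real.coe_toNNReal _ (pow_nonneg (le_of_lt hx) _)]
        rfl
      · exact (measurable_subtype_coe.pow_const _).real_toNNReal

/-! ### Coordinates on `ℂ^{m+1}` -/

variable {m : ℕ} (p : Fin (m + 1) → ℤ)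

/-- The coordinates of `ℂ^{m+1}` in the standard frame, as elements of `ℝ × ℝ × ℝ^{2m}`. -/
def coordEquiv (m : ℕ) : Cn m ≃ᵐ ℝ × ℝ × Model m :=
  (frameBasis m).measurableEquiv.trans <|
    (MeasurableEquiv.toLp 2 (Fin (2 * m + 2) → ℝ)).symm.trans <|
    (MeasurableEquiv.piFinSuccAbove (fun _ : Fin (2 * m + 1 + 1) => ℝ) 0).trans <|
    MeasurableEquiv.prodCongr (.refl ℝ) <|
    (MeasurableEquiv.piFinSuccAbove (fun _ : Fin (2 * m + 1) => ℝ) 0).trans <|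
    MeasurableEquiv.prodCongr (.refl ℝ) (MeasurableEquiv.toLp 2 (Fin (2 * m) → ℝ))

theorem measurePreserving_coordEquiv (m : ℕ) : MeasurePreserving (coordEquiv m) := by
  refine (MeasurePreserving.prod (.id volume) (MeasurePreserving.comp
    (MeasurePreserving.prod (.id volume) (PiLp.volume_preserving_toLp _))
    (volume_preserving_piFinSuccAbove (fun _ : Fin (2 * m + 1) => ℝ) 0))).comp ?_
  exact (volume_preserving_piFinSuccAbove (fun _ : Fin (2 * m + 1 + 1) => ℝ) 0).comp
    ((PiLp.volume_preserving_ofLp _).comp (frameBasis m).measurePreserving_repr)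

theorem coordEquiv_apply (x : Cn m) : coordEquiv m x =
    (⟪realFrame m 0, x⟫, ⟪realFrame m 1, x⟫,
      WithLp.toLp 2 fun i : Fin (2 * m) => ⟪realFrame m (i + 2), x⟫) := by
  have h : ∀ k : Fin (2 * m + 2), (frameBasis m).repr x k = ⟪realFrame m k, x⟫ := fun k => by
    rw [OrthonormalBasis.repr_apply_apply, frameBasis_apply]
  have h2 : coordEquiv m x = ((frameBasis m).repr x 0, (frameBasis m).repr x 1,
      WithLp.toLp 2 fun i : Fin (2 * m) => (frameBasis m).repr x i.succ.succ) := rfl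
  rw [h2]
  simp only [h]
  rfl

/-- `coordEquiv` as a linear map. -/
def coordCLM (m : ℕ) : Cn m →L[ℝ] ℝ × ℝ × Model m :=
  LinearMap.toContinuousLinearMap
    { toFun := coordEquiv m
      map_add' := fun x y => by
        simp only [coordEquiv_apply, inner_add_right]; rfl
      map_smul' := fun r x => by
        simp only [coordEquiv_apply, inner_smul_right]; rfl }

theorem coordCLM_apply (x : Cn m) : coordCLM m x = coordEquiv m x := rfl

theorem coordCLM_realFrame (b : Fin (2 * m + 2)) : coordCLM m (realFrame m b) =
    Matrix.vecCons (1, 0, 0) (Matrix.vecCons (0, 1, 0)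
      fun i => (0, 0, EuclideanSpace.single i 1)) b := by
  have h : ∀ a b : Fin (2 * m + 2), ⟪realFrame m a, realFrame m b⟫ = if a = b then (1 : ℝ) else 0 :=
    fun a b => orthonormal_iff_ite.1 (orthonormal_realFrame m) a b
  rw [coordCLM_apply, coordEquiv_apply]
  have h0 := h 0 b
  have h1 := h 1 b
  have hi : ∀ i : Fin (2 * m), ⟪realFrame m (i + 2), realFrame m b⟫ =
      if i.succ.succ = b then (1 : ℝ) else 0 := fun i => h i.succ.succ b
  rw [Fin.val_zero] at h0
  rw [show ((1 : Fin (2 * m + 2)) : ℕ) = 1 from rfl] at h1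
  rw [h0, h1]
  simp only [hi]
  refine Fin.cases ?_ (fun b => Fin.cases ?_ (fun b => ?_) b) b
  · refine Prod.ext rfl (Prod.ext (by simp) ?_)
    ext i; simp
  · refine Prod.ext (by simp) (Prod.ext (by simp) ?_)
    ext i
    change (if i.succ.succ = 1 then (1 : ℝ) else 0) = 0
    exact if_neg (Fin.succ_succ_ne_one i)
  · have e0 : (if 0 = b.succ.succ then (1 : ℝ) else 0) = 0 := if_neg (Fin.succ_ne_zero _).symm
    have e1 : (if 1 = b.succ.succ then (1 : ℝ) else 0) = 0 := if_neg (Fin.succ_succ_ne_one b).symm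
    refine Prod.ext e0 (Prod.ext e1 ?_)
    ext i; simp

/-! ### The flow as a family of operators -/

theorem contDiff_actOp_circ : ContDiff ℝ ∞ fun θ : ℝ => actOp p (circ θ) := by
  rw [contDiff_clm_apply_iff]
  intro x
  rw [contDiff_piLp]
  intro j
  simp only [actOp_apply, coe_circ_zpow]
  exact ((contDiff_const.mul Complex.ofRealCLM.contDiff).cexp).mul contDiff_const

theorem hasDerivAt_actOp_circ_op (θ : ℝ) :
    HasDerivAt (fun θ : ℝ => actOp p (circ θ)) ((actOp p (circ θ)).comp (genOp p)) θ := by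
  have h := ((contDiff_actOp_circ p).differentiable (by simp) θ).hasDerivAt
  refine h.congr_deriv (ContinuousLinearMap.ext fun x => ?_)
  have h1 := h.clm_apply (hasDerivAt_const θ x)
  simpa using h1.unique (hasDerivAt_actOp_circ p x θ)

variable {p}

theorem det_inner_actOp (hp : ∀ i, p i ≠ 0) (t : Circle) (v : Fin (2 * m + 2) → Cn m) :
    Matrix.det (Matrix.of fun a b : Fin (2 * m + 2) => ⟪realFrame m a, actOp p t (v b)⟫) =
      Matrix.det (Matrix.of fun a b : Fin (2 * m + 2) => ⟪realFrame m a, v b⟫) := by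
  have ha := (isAlt_stdCurv p).pow_two (m + 1)
  have h0 := stdCurv_pow_frameList_ne_zero hp
  refine mul_right_cancel₀ h0 ?_
  rw [← IsAlt.top_eq_det ha, ← IsAlt.top_eq_det ha v]
  have : List.ofFn (fun b => actOp p t (v b)) = (List.ofFn v).map (actOp p t) := by
    rw [List.map_ofFn]; rfl
  rw [this, ← pull_apply (actOp p t) (stdCurv p ^ (m + 1)), pull_pow, pull_stdCurv]

/-! ### Orbit coordinates -/

/-- The map `(r, θ, u) ↦ r e^{2πiθ} · φ(u)`. -/
def orbitMap (p : Fin (m + 1) → ℤ) (φ : Model m → Cn m) (w : ℝ × ℝ × Model m) : Cn m :=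
  w.1 • actOp p (circ w.2.1) (φ w.2.2)

/-- The derivative of `orbitMap`. -/
def orbitDeriv (p : Fin (m + 1) → ℤ) (φ : Model m → Cn m) (w : ℝ × ℝ × Model m) :
    ℝ × ℝ × Model m →L[ℝ] Cn m :=
  (ContinuousLinearMap.fst ℝ ℝ (ℝ × Model m)).smulRight (actOp p (circ w.2.1) (φ w.2.2)) +
  w.1 • (((ContinuousLinearMap.fst ℝ ℝ (Model m)).smulRight
      (actOp p (circ w.2.1) (genOp p (φ w.2.2))) +
    (actOp p (circ w.2.1)).comp ((fderiv ℝ φ w.2.2).comp (ContinuousLinearMap.snd ℝ ℝ (Model m)))).comp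
      (ContinuousLinearMap.snd ℝ ℝ (ℝ × Model m)))

theorem hasFDerivAt_orbitMap {φ : Model m → Cn m} {w : ℝ × ℝ × Model m}
    (hu : HasFDerivAt φ (fderiv ℝ φ w.2.2) w.2.2) :
    HasFDerivAt (orbitMap p φ) (orbitDeriv p φ w) w := by
  have hA : HasFDerivAt (fun w : ℝ × ℝ × Model m => actOp p (circ w.2.1))
      ((ContinuousLinearMap.toSpanSingleton ℝ ((actOp p (circ w.2.1)).comp (genOp p))).comp
        ((ContinuousLinearMap.fst ℝ ℝ (Model m)).comp (ContinuousLinearMap.snd ℝ ℝ _))) w :=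
    HasFDerivAt.comp (g := fun θ => actOp p (circ θ)) w
      (hasDerivAt_actOp_circ_op p w.2.1).hasFDerivAt
      ((ContinuousLinearMap.fst ℝ ℝ (Model m)).comp (ContinuousLinearMap.snd ℝ ℝ _)).hasFDerivAt
  have hφ : HasFDerivAt (fun w : ℝ × ℝ × Model m => φ w.2.2)
      ((fderiv ℝ φ w.2.2).comp
        ((ContinuousLinearMap.snd ℝ ℝ (Model m)).comp (ContinuousLinearMap.snd ℝ ℝ _))) w :=
    HasFDerivAt.comp w hu
      ((ContinuousLinearMap.snd ℝ ℝ (Model m)).comp (ContinuousLinearMap.snd ℝ ℝ _)).hasFDerivAt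
  have h5 := hA.clm_apply hφ
  have h1 : HasFDerivAt (fun w : ℝ × ℝ × Model m => w.1)
    (ContinuousLinearMap.fst ℝ ℝ (ℝ × Model m)) w := hasFDerivAt_fst
  refine (h1.smul h5).congr_fderiv (ContinuousLinearMap.ext fun v => ?_)
  change w.1 • (actOp p (circ w.2.1) (fderiv ℝ φ w.2.2 v.2.2) +
      v.2.1 • actOp p (circ w.2.1) (genOp p (φ w.2.2))) +
      v.1 • actOp p (circ w.2.1) (φ w.2.2) =
    v.1 • actOp p (circ w.2.1) (φ w.2.2) + w.1 • (v.2.1 • actOp p (circ w.2.1)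
      (genOp p (φ w.2.2)) + actOp p (circ w.2.1) (fderiv ℝ φ w.2.2 v.2.2))
  rw [add_comm, add_comm (actOp p (circ w.2.1) (fderiv ℝ φ w.2.2 v.2.2))]

/-- The columns are `φ`, `r X` and `r ∂φ`, all moved by the action. The action has determinant `1`,
and the `2m + 1` columns other than the radial one each contribute a factor `r`. -/
theorem det_orbitDeriv (hp : ∀ i, p i ≠ 0) (φ : Model m → Cn m) (w : ℝ × ℝ × Model m) :
    ((orbitDeriv p φ w).comp (coordCLM m)).det =
      w.1 ^ (2 * m + 1) * transverseDet p φ w.2.2 := by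
  have e1 : ((orbitDeriv p φ w).comp (coordCLM m)).det = Matrix.det
      (Matrix.of fun a b : Fin (2 * m + 2) =>
        ⟪realFrame m a, orbitDeriv p φ w (coordCLM m (realFrame m b))⟫) := by
    rw [ContinuousLinearMap.det, ← LinearMap.det_toMatrix (frameBasis m).toBasis]
    congr 1
    ext a b
    rw [LinearMap.toMatrix_apply, OrthonormalBasis.coe_toBasis_repr_apply,
      OrthonormalBasis.repr_apply_apply, frameBasis_apply]
    simp
  have e2 : ∀ b : Fin (2 * m + 2), orbitDeriv p φ w (coordCLM m (realFrame m b)) =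
      (Matrix.vecCons 1 (fun _ => w.1) : Fin (2 * m + 2) → ℝ) b •
        actOp p (circ w.2.1) ((Matrix.vecCons (φ w.2.2)
          (Matrix.vecCons (fundField p (φ w.2.2)) (pushFrame φ w.2.2)) :
            Fin (2 * m + 2) → Cn m) b) := by
    intro b
    rw [coordCLM_realFrame]
    refine Fin.cases ?_ (fun b => Fin.cases ?_ (fun b => ?_) b) b
    · simp [orbitDeriv]
    · simp [orbitDeriv, fundField_eq]
    · simp [orbitDeriv, pushFrame]
  rw [e1]
  simp only [e2, inner_smul_right]
  refine (Matrix.det_mul_row (Matrix.vecCons 1 (fun _ => w.1) : Fin (2 * m + 2) → ℝ)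
    (Matrix.of fun a b : Fin (2 * m + 2) => ⟪realFrame m a, actOp p (circ w.2.1)
      ((Matrix.vecCons (φ w.2.2) (Matrix.vecCons (fundField p (φ w.2.2))
        (pushFrame φ w.2.2)) : Fin (2 * m + 2) → Cn m) b)⟫)).trans ?_
  rw [det_inner_actOp hp]
  congr 1
  rw [Fin.prod_univ_succ]
  simp

/-! ### Sphere integrals over the saturation of a slice -/

namespace SliceChart
variable (c : SliceChart p)

/-- The domain of injectivity of `orbitMap`. -/
def orbitDomain : Set (ℝ × ℝ × Model m) :=
  Ioo 1 2 ×ˢ (Ico 0 (1 / (c.order : ℝ)) ×ˢ c.D)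

theorem measurableSet_orbitDomain : MeasurableSet c.orbitDomain :=
  measurableSet_Ioo.prod (measurableSet_Ico.prod c.isOpen.measurableSet)

theorem norm_φ {u : Model m} (hu : u ∈ c.D) : ‖c.φ u‖ = 1 := by
  simpa using c.mem_sphere u hu

theorem norm_orbitMap {w : ℝ × ℝ × Model m} (hr : 0 < w.1) (hu : w.2.2 ∈ c.D) :
    ‖orbitMap p c.φ w‖ = w.1 := by
  rw [orbitMap, norm_smul, norm_actOp, c.norm_φ hu, mul_one, Real.norm_of_nonneg hr.le]

theorem circ_pow_eq_one {θ : ℝ} {k : ℕ} : circ θ ^ k = 1 ↔ ∃ j : ℤ, k * θ = j := by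
  have : circ θ ^ k = Circle.exp (k * (2 * Real.pi * θ)) := by
    rw [circ]
    induction k with
    | zero => simp
    | succ k ih => rw [pow_succ, ih, ← Circle.exp_add]; congr 1; push_cast; ring
  rw [this, Circle.exp_eq_one]
  refine exists_congr fun j => ?_
  have := Real.pi_pos
  constructor
  · intro h
    have : (k * θ - j) * (2 * Real.pi) = 0 := by linarith
    have := (mul_eq_zero.1 this).resolve_right (by positivity)
    linarith
  · intro h; rw [← h]; ring

/-- The norm recovers `r`. If two points of the slice are related by `e^{2πi(θ-θ')}`, the slice
property puts this element in `Γ`, so `|Γ| (θ - θ')` is an integer; the half-open range of length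
`1/|Γ|` makes it zero. -/
theorem injOn_orbitMap : InjOn (orbitMap p c.φ) c.orbitDomain := by
  rintro ⟨r, θ, u⟩ ⟨hr, hθ, hu⟩ ⟨r', θ', u'⟩ ⟨hr', hθ', hu'⟩ h
  dsimp only at hr hθ hu hr' hθ' hu'
  have hr0 : 0 < r := by linarith [hr.1]
  have hr0' : 0 < r' := by linarith [hr'.1]
  have e1 : r = r' := by
    have := congrArg norm h
    rwa [c.norm_orbitMap hr0 hu, c.norm_orbitMap hr0' hu'] at this
  subst e1
  have h2 : actOp p (circ θ) (c.φ u) = actOp p (circ θ') (c.φ u') :=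
    smul_right_injective _ hr0.ne' h
  have h3 : actOp p (circ (θ - θ')) (c.φ u) = c.φ u' := by
    rw [sub_eq_neg_add, circ_add, actOp_mul, h2, ← actOp_mul, ← circ_add, neg_add_cancel,
      circ_zero, actOp_one]
  have h4 : circ (θ - θ') ^ c.order = 1 := (c.slice u hu _).1 ⟨u', hu', h3.symm⟩
  obtain ⟨j, hj⟩ := circ_pow_eq_one.1 h4
  have hk : (0 : ℝ) < c.order := by exact_mod_cast c.order_pos
  have b1 : c.order * θ < 1 := by
    have := hθ.2; rwa [lt_div_iff₀ hk, mul_comm] at this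
  have b2 : c.order * θ' < 1 := by
    have := hθ'.2; rwa [lt_div_iff₀ hk, mul_comm] at this
  have b3 : 0 ≤ c.order * θ := mul_nonneg hk.le hθ.1
  have b4 : 0 ≤ c.order * θ' := mul_nonneg hk.le hθ'.1
  have hj0 : j = 0 := by
    have h5 : (j : ℝ) < 1 := by rw [← hj]; linarith
    have h6 : (-1 : ℝ) < j := by rw [← hj]; linarith
    have h5' : j < 1 := by exact_mod_cast h5
    have h6' : -1 < j := by exact_mod_cast h6
    omega
  rw [hj0, Int.cast_zero] at hj
  have e2 : θ = θ' := by
    have := (mul_eq_zero.1 hj).resolve_left hk.ne'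
    linarith
  subst e2
  rw [sub_self, circ_zero, actOp_one] at h3
  rw [c.injOn hu hu' h3]

/-- Every orbit meeting the chart is reached by `orbitMap`. -/
theorem mem_image_orbitDomain {x : Cn m} (hx1 : 1 < ‖x‖) (hx2 : ‖x‖ < 2)
    (h : ∃ t : Circle, actOp p t (‖x‖⁻¹ • x) ∈ c.φ '' c.D) : x ∈ orbitMap p c.φ '' c.orbitDomain := by
  obtain ⟨t, u, hu, ht⟩ := h
  obtain ⟨s, hs⟩ := Circle.exp_surjective t⁻¹
  have hpi := Real.pi_pos
  set θ := s / (2 * Real.pi) with hθ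
  have hcirc : circ θ = t⁻¹ := by
    rw [circ, hθ, mul_div_cancel₀ _ (by positivity), hs]
  have hk : (0 : ℝ) < c.order := by exact_mod_cast c.order_pos
  -- Reduce `θ` modulo `1/|Γ|`: the removed element lies in `Γ` and is absorbed by moving `u` to
  -- another point `u'` of the slice.
  set j := ⌊c.order * θ⌋ with hj
  have hjθ : circ (j / c.order) ^ c.order = 1 :=
    circ_pow_eq_one.2 ⟨j, mul_div_cancel₀ _ hk.ne'⟩
  obtain ⟨u', hu', hu2⟩ := (c.slice u hu _).2 hjθ
  refine ⟨(‖x‖, θ - j / c.order, u'), ⟨⟨hx1, hx2⟩, ⟨?_, ?_⟩, hu'⟩, ?_⟩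
  · have := Int.floor_le (c.order * θ)
    change 0 ≤ θ - j / c.order
    rw [sub_nonneg, div_le_iff₀ hk, mul_comm]; exact this
  · have := Int.lt_floor_add_one (c.order * θ)
    change θ - j / c.order < 1 / c.order
    rw [sub_lt_iff_lt_add, ← add_div, lt_div_iff₀ hk, mul_comm]; linarith
  · change ‖x‖ • actOp p (circ (θ - j / c.order)) (c.φ u') = x
    rw [hu2, act_eq, ← actOp_mul, ← circ_add, sub_add_cancel, hcirc, ht, actOp_inv_actOp,
      smul_inv_smul₀ (by linarith)]

/-- Integration over the sphere of an invariant function supported in the chart. -/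
theorem integral_sphere_eq (hp : ∀ i, p i ≠ 0) {G : Cn m → ℝ}
    (hG : ∀ t, ∀ x ∈ sphere (0 : Cn m) 1, G (actOp p t x) = G x)
    (hs : ∀ x ∈ sphere (0 : Cn m) 1, G x ≠ 0 → ∃ t : Circle, actOp p t x ∈ c.φ '' c.D) :
    ∫ x : sphere (0 : Cn m) 1, G x ∂(volume : Measure (Cn m)).toSphere =
      1 / (c.order : ℝ) * ∫ u in c.D, |transverseDet p c.φ u| * G (c.φ u) := by
  -- Extend `G` to be constant along rays and cut off radially. The resulting volume integral is
  -- computed in polar and in orbit coordinates; both contain the same radial factor `C`, which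
  -- cancels.
  set h : ℝ → ℝ := (Ioo 1 2).indicator fun _ => 1 with hh
  set H : Cn m → ℝ := fun x => G (‖x‖⁻¹ • x) * h ‖x‖ with hH
  set C : ℝ := ∫ y in Ioo (1 : ℝ) 2, y ^ (2 * m + 1) with hC
  have hCpos : C ≠ 0 := by
    rw [hC, ← integral_Ioc_eq_integral_Ioo, ← intervalIntegral.integral_of_le (by norm_num)]
    simp only [integral_pow]
    have : (1 : ℝ) < 2 ^ (2 * m + 1 + 1) := one_lt_pow₀ (by norm_num) (by omega)
    have h2 : (0 : ℝ) < ((2 * m + 1 : ℕ) : ℝ) + 1 := by positivity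
    rw [one_pow]
    exact (div_pos (by linarith) h2).ne'
  have hk : (0 : ℝ) < c.order := by exact_mod_cast c.order_pos
  have s1 : ∫ x, H x = (∫ x : sphere (0 : Cn m) 1, G x ∂(volume : Measure (Cn m)).toSphere) * C := by
    rw [hH, integral_norm_mul_direction, finrank_Cn]
    congr 1
    have : (fun y : ℝ => y ^ (2 * m + 2 - 1) * h y) =
        (Ioo 1 2).indicator fun y => y ^ (2 * m + 1) := by
      funext y
      by_cases hy : y ∈ Ioo (1 : ℝ) 2
      · simp [hh, hy]
      · simp [hh, hy]
    rw [this, setIntegral_indicator measurableSet_Ioo, hC]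
    congr 2
    refine inter_eq_right.2 fun y hy => ?_
    exact lt_trans one_pos hy.1
  have hsupp : ∀ x, x ∉ orbitMap p c.φ '' c.orbitDomain → H x = 0 := by
    intro x hx
    by_contra hne
    have h1 : h ‖x‖ ≠ 0 := right_ne_zero_of_mul hne
    have h2 : ‖x‖ ∈ Ioo (1 : ℝ) 2 := by
      by_contra h3; exact h1 (indicator_of_notMem h3 _)
    refine hx (c.mem_image_orbitDomain h2.1 h2.2 (hs _ ?_ (left_ne_zero_of_mul hne)))
    rw [mem_sphere_zero_iff_norm]
    exact norm_smul_inv_norm (𝕜 := ℝ) (norm_pos_iff.1 (by linarith [h2.1]))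
  have hpre : (orbitMap p c.φ ∘ coordEquiv m) '' (coordEquiv m ⁻¹' c.orbitDomain) =
      orbitMap p c.φ '' c.orbitDomain := by
    rw [image_comp, image_preimage_eq _ (coordEquiv m).surjective]
  have s2 : ∫ x, H x = ∫ w in c.orbitDomain,
      |w.1 ^ (2 * m + 1) * transverseDet p c.φ w.2.2| * H (orbitMap p c.φ w) := by
    rw [← setIntegral_eq_integral_of_forall_compl_eq_zero hsupp, ← hpre,
      integral_image_eq_integral_abs_det_fderiv_smul (μ := volume)
        (f' := fun x => (orbitDeriv p c.φ (coordEquiv m x)).comp (coordCLM m))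
        ((coordEquiv m).measurable c.measurableSet_orbitDomain) ?_ ?_ H,
      ← (measurePreserving_coordEquiv m).setIntegral_preimage_emb
        (coordEquiv m).measurableEmbedding]
    · simp only [det_orbitDeriv hp, smul_eq_mul, Function.comp_apply]
    · intro x hx
      exact ((hasFDerivAt_orbitMap (c.hasFDerivAt hx.2.2)).comp x (coordCLM m).hasFDerivAt).hasFDerivWithinAt
    · intro x hx y hy hxy
      exact (coordEquiv m).injective (c.injOn_orbitMap hx hy hxy)
  have s3 : ∫ x, H x = ∫ w in c.orbitDomain,
      w.1 ^ (2 * m + 1) * (1 * (|transverseDet p c.φ w.2.2| * G (c.φ w.2.2))) := by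
    rw [s2]
    refine setIntegral_congr_fun c.measurableSet_orbitDomain fun w hw => ?_
    obtain ⟨hr, hθ, hu⟩ := hw
    have hr0 : 0 < w.1 := by linarith [hr.1]
    have : H (orbitMap p c.φ w) = G (c.φ w.2.2) := by
      simp only [hH]
      rw [c.norm_orbitMap hr0 hu, orbitMap, inv_smul_smul₀ hr0.ne', hG _ _ (c.mem_sphere _ hu), hh,
        indicator_of_mem hr, mul_one]
    rw [this, abs_mul, abs_of_pos (pow_pos hr0 _)]
    ring
  have s4 : ∫ x, H x = C * (1 / c.order * ∫ u in c.D, |transverseDet p c.φ u| * G (c.φ u)) := by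
    rw [s3, orbitDomain]
    have e1 := setIntegral_prod_mul (μ := (volume : Measure ℝ)) (ν := (volume : Measure (ℝ × Model m)))
      (fun r : ℝ => r ^ (2 * m + 1))
      (fun z : ℝ × Model m => 1 * (|transverseDet p c.φ z.2| * G (c.φ z.2)))
      (Ioo 1 2) (Ico 0 (1 / (c.order : ℝ)) ×ˢ c.D)
    -- The integrand does not depend on `θ`, so this variable only contributes the length `1/|Γ|`:
    -- this is the weight of an orbifold chart.
    have e2 := setIntegral_prod_mul (μ := (volume : Measure ℝ)) (ν := (volume : Measure (Model m)))
      (fun _ : ℝ => (1 : ℝ)) (fun u : Model m => |transverseDet p c.φ u| * G (c.φ u))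
      (Ico 0 (1 / (c.order : ℝ))) c.D
    refine e1.trans ?_
    congr 1
    refine e2.trans ?_
    congr 1
    simp [hk.le]
  refine mul_right_cancel₀ hCpos ?_
  rw [← s1, s4, mul_comm]

end SliceChart

/-- The orbifold integral of a basic form of top degree is the integral over the sphere of its
product with a connection form. -/
theorem ChartPartition.integral_eq (hp : ∀ i, p i ≠ 0) (P : ChartPartition p) {α : Form m 1}
    (hα : IsNormalizedConnection p α) {η : Form m (2 * m)} (hη : η ∈ basicForms p (2 * m)) :
    P.integral η = ∫ x : sphere (0 : Cn m) 1, density α η x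
      ∂(volume : Measure (Cn m)).toSphere := by
  have hcont : ∀ x ∈ sphere (0 : Cn m) 1, ContinuousAt (density α η) x := fun x hx =>
    (contDiffAt_density (hα.smooth x hx) (hη.1 x hx)).continuousAt
  have h1 : ∀ i, (1 / ((P.chart i).order : ℝ)) * ∫ u in (P.chart i).D,
      (SignType.sign (transverseDet p (P.chart i).φ u) : ℝ) *
        (P.χ i ((P.chart i).φ u) * η ((P.chart i).φ u) (pushFrame (P.chart i).φ u)) =
      ∫ x : sphere (0 : Cn m) 1, P.χ i x * density α η x
        ∂(volume : Measure (Cn m)).toSphere := by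
    intro i
    set c := P.chart i
    rw [c.integral_sphere_eq hp (G := fun x => P.χ i x * density α η x)]
    · congr 1
      refine setIntegral_congr_fun c.isOpen.measurableSet fun u hu => ?_
      -- The orientation sign times the determinant is the absolute Jacobian in
      -- `integral_sphere_eq`.
      rw [← c.transverseDet_mul_density hα hη.2.2 hu, ← sign_mul_self (transverseDet p c.φ u)]
      ring_nf
    · intro t x hx
      rw [density_actOp hp hα.invariant hη.2.1 t hx, ← act_eq, P.invariant i t x hx]
    · intro x hx hne
      obtain ⟨K, hKD, -, hK⟩ := P.support i
      obtain ⟨t, ht⟩ := hK x hx (left_ne_zero_of_mul hne)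
      exact ⟨t, image_mono hKD ht⟩
  rw [ChartPartition.integral, Finset.sum_congr rfl fun i _ => h1 i, ← integral_finsetSum]
  · refine integral_congr_ae (Filter.Eventually.of_forall fun x => ?_)
    simp only
    rw [← Finset.sum_mul, P.sum_eq_one x x.2, one_mul]
  · intro i _
    exact integrable_on_sphere fun x hx => ((P.smooth i x hx).continuousAt).mul (hcont x hx)

end

section

variable {m : ℕ} {p : Fin (m + 1) → ℤ}

/-! ### Isotropy groups -/

theorem exists_circ (t : Circle) : ∃ θ ∈ Icc (0 : ℝ) 1, circ θ = t := by
  obtain ⟨s, hs⟩ := Circle.exp_surjective t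
  have hpi := Real.pi_pos
  set θ := s / (2 * Real.pi) with hθ
  have hcirc : circ θ = t := by rw [circ, hθ, mul_div_cancel₀ _ (by positivity), hs]
  refine ⟨Int.fract θ, ⟨Int.fract_nonneg θ, (Int.fract_lt_one θ).le⟩, ?_⟩
  have h1 : circ ⌊θ⌋ = 1 := by
    have := (SliceChart.circ_pow_eq_one (θ := ⌊θ⌋) (k := 1)).2 ⟨⌊θ⌋, by simp⟩
    simpa using this
  rw [← hcirc]
  conv_rhs => rw [← Int.floor_add_fract θ, circ_add, h1, one_mul]

/-- The isotropy group consists of the `t` with `t^(p j) = 1` whenever `x j ≠ 0`, that is, of the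
roots of unity whose order divides the gcd of these `p j`. The gcd is positive because some
coordinate of `x` is nonzero and no weight is zero. -/
theorem exists_isotropy_order (hp : ∀ i, p i ≠ 0) {x : Cn m} (hx : x ≠ 0) :
    ∃ k : ℕ, 0 < k ∧ ∀ t : Circle, actOp p t x = x ↔ t ^ k = 1 := by
  classical
  set s : Finset (Fin (m + 1)) := Finset.univ.filter fun j => x j ≠ 0 with hs
  refine ⟨s.gcd fun j => (p j).natAbs, Nat.pos_of_ne_zero fun h => hx ?_, fun t => ?_⟩
  · ext j
    by_contra hj
    have := Finset.gcd_eq_zero_iff.1 h j (by simpa [hs] using hj)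
    exact hp j (Int.natAbs_eq_zero.1 this)
  · rw [← orderOf_dvd_iff_pow_eq_one, Finset.dvd_gcd_iff]
    have h1 : ∀ j, orderOf t ∣ (p j).natAbs ↔ (t : ℂ) ^ p j = 1 := by
      intro j
      rw [← Int.natCast_dvd, orderOf_dvd_iff_zpow_eq_one, ← Circle.coe_zpow, Circle.coe_eq_one]
    constructor
    · intro h j hj
      rw [h1]
      have h2 : (t : ℂ) ^ p j * x j = x j := congrArg (fun y : Cn m => y j) h
      have h3 : x j ≠ 0 := by simpa [hs] using hj
      exact mul_right_cancel₀ h3 (h2.trans (one_mul _).symm)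
    · intro h
      ext j
      rw [actOp_apply]
      by_cases hj : x j = 0
      · rw [hj, mul_zero]
      · rw [(h1 j).1 (h j (by simpa [hs] using hj)), one_mul]

/-! ### Slices -/

section Slice

variable (b : OrthonormalBasis (Fin (2 * m + 2)) ℝ (Cn m))

/-- The isometric embedding of `ℝ^{2m}` as the span of all but the first two vectors of a basis. -/
def sliceLin : Model m →L[ℝ] Cn m :=
  ∑ i : Fin (2 * m), (EuclideanSpace.proj i : Model m →L[ℝ] ℝ).smulRight (b i.succ.succ)

theorem sliceLin_apply (u : Model m) : sliceLin b u = ∑ i, u i • b i.succ.succ := by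
  simp [sliceLin]

theorem inner_basis_sliceLin (u : Model m) (i : Fin (2 * m)) :
    ⟪b i.succ.succ, sliceLin b u⟫ = u i := by
  rw [sliceLin_apply, inner_sum, Finset.sum_eq_single i]
  · simp [inner_smul_right]
  · intro j _ hj
    rw [inner_smul_right, b.orthonormal.2 (by simpa [Fin.succ_inj] using hj.symm), mul_zero]
  · simp

theorem inner_zero_sliceLin (u : Model m) : ⟪b 0, sliceLin b u⟫ = 0 := by
  rw [sliceLin_apply, inner_sum]
  refine Finset.sum_eq_zero fun j _ => ?_
  rw [inner_smul_right, b.orthonormal.2 (Fin.succ_ne_zero _).symm, mul_zero]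

theorem inner_one_sliceLin (u : Model m) : ⟪b 1, sliceLin b u⟫ = 0 := by
  rw [sliceLin_apply, inner_sum]
  refine Finset.sum_eq_zero fun j _ => ?_
  rw [inner_smul_right, b.orthonormal.2 (Fin.succ_succ_ne_one j).symm, mul_zero]

theorem norm_sliceLin (u : Model m) : ‖sliceLin b u‖ = ‖u‖ := by
  have h : ⟪sliceLin b u, sliceLin b u⟫ = ⟪u, u⟫ := by
    nth_rewrite 1 [sliceLin_apply]
    rw [sum_inner, PiLp.inner_apply]
    refine Finset.sum_congr rfl fun i _ => ?_
    rw [real_inner_smul_left, inner_basis_sliceLin]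
    simp [sq]
  rw [real_inner_self_eq_norm_sq, real_inner_self_eq_norm_sq] at h
  exact (sq_eq_sq₀ (norm_nonneg _) (norm_nonneg _)).1 h

theorem exists_sliceLin_eq {v : Cn m} (h0 : ⟪b 0, v⟫ = 0) (h1 : ⟪b 1, v⟫ = 0) :
    ∃ u, sliceLin b u = v := by
  refine ⟨WithLp.toLp 2 fun i => ⟪b i.succ.succ, v⟫, ?_⟩
  rw [sliceLin_apply]
  conv_rhs => rw [← b.sum_repr' v, Fin.sum_univ_succ, Fin.sum_univ_succ]
  have h1' : ⟪b (Fin.succ 0), v⟫ = 0 := h1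
  rw [h0, h1', zero_smul, zero_smul, zero_add, zero_add]

/-- The slice at `b 0`. -/
def sliceMap (u : Model m) : Cn m := (√(1 + ‖u‖ ^ 2))⁻¹ • (b 0 + sliceLin b u)

theorem contDiff_sliceScale : ContDiff ℝ ∞ fun u : Model m => (√(1 + ‖u‖ ^ 2))⁻¹ :=
  ((contDiff_const.add (contDiff_norm_sq ℝ)).sqrt fun u => by positivity).inv fun u => by positivity

theorem contDiff_sliceMap : ContDiff ℝ ∞ (sliceMap b) :=
  contDiff_sliceScale.smul (contDiff_const.add (sliceLin b).contDiff)

theorem sliceMap_zero : sliceMap b 0 = b 0 := by simp [sliceMap]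

theorem norm_sliceMap (u : Model m) : ‖sliceMap b u‖ = 1 := by
  have h : ‖b 0 + sliceLin b u‖ = √(1 + ‖u‖ ^ 2) := by
    rw [eq_comm, Real.sqrt_eq_iff_mul_self_eq (by positivity) (norm_nonneg _),
      norm_add_sq_eq_norm_sq_add_norm_sq_of_inner_eq_zero _ _ (inner_zero_sliceLin b u),
      norm_sliceLin, b.orthonormal.1]
    ring
  rw [sliceMap, norm_smul, h, norm_inv, Real.norm_of_nonneg (Real.sqrt_nonneg _)]
  exact inv_mul_cancel₀ (by positivity)

theorem injective_sliceMap : Function.Injective (sliceMap b) := by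
  intro u v h
  have hin : ∀ u, ⟪b 0, sliceMap b u⟫ = (√(1 + ‖u‖ ^ 2))⁻¹ := fun u => by
    rw [sliceMap, inner_smul_right, inner_add_right, inner_zero_sliceLin,
      real_inner_self_eq_norm_sq, b.orthonormal.1]
    simp
  have h1 : (√(1 + ‖u‖ ^ 2))⁻¹ = (√(1 + ‖v‖ ^ 2))⁻¹ := by rw [← hin, ← hin, h]
  rw [sliceMap, sliceMap, h1] at h
  have h2 := add_left_cancel (smul_right_injective (Cn m)
    (show (√(1 + ‖v‖ ^ 2))⁻¹ ≠ 0 by positivity) h)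
  ext i
  rw [← inner_basis_sliceLin b, h2, inner_basis_sliceLin]

theorem fderiv_sliceMap_zero : fderiv ℝ (sliceMap b) 0 = sliceLin b := by
  have hs : HasFDerivAt (fun u : Model m => (√(1 + ‖u‖ ^ 2))⁻¹)
      (0 : Model m →L[ℝ] ℝ) 0 := by
    have hd := (contDiff_sliceScale (m := m)).differentiable (by simp) 0
    -- The normalizing factor is largest at `0`, so its derivative vanishes there and only the
    -- linear embedding contributes.
    have hmax : IsLocalMax (fun u : Model m => (√(1 + ‖u‖ ^ 2))⁻¹) 0 := by
      refine Filter.Eventually.of_forall fun u => ?_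
      simp only [norm_zero]
      refine inv_anti₀ (by positivity) (Real.sqrt_le_sqrt ?_)
      nlinarith [sq_nonneg ‖u‖]
    rw [← hmax.fderiv_eq_zero]
    exact hd.hasFDerivAt
  have hl : HasFDerivAt (fun u => b 0 + sliceLin b u) (sliceLin b) 0 :=
    (sliceLin b).hasFDerivAt.const_add _
  refine ((hs.smul hl).congr_fderiv ?_).fderiv
  ext1 v
  simp

end Slice

section LocalStructure

variable {b : OrthonormalBasis (Fin (2 * m + 2)) ℝ (Cn m)}

theorem contDiff_orbitMap {φ : Model m → Cn m} (hφ : ContDiff ℝ ∞ φ) :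
    ContDiff ℝ ∞ (orbitMap p φ) :=
  contDiff_fst.smul (((contDiff_actOp_circ p).comp (contDiff_fst.comp contDiff_snd)).clm_apply
    (hφ.comp (contDiff_snd.comp contDiff_snd)))

theorem orbitDeriv_sliceMap (w : ℝ × ℝ × Model m) :
    orbitDeriv p (sliceMap b) (1, 0, 0) w =
      w.1 • b 0 + (w.2.1 • genOp p (b 0) + sliceLin b w.2.2) := by
  simp [orbitDeriv, sliceMap_zero, fderiv_sliceMap_zero, actOp_one]

theorem injective_orbitDeriv_sliceMap {c : ℝ} (hc : c ≠ 0) (hb : genOp p (b 0) = c • b 1) :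
    Function.Injective (orbitDeriv p (sliceMap b) (1, 0, 0)) := by
  rw [injective_iff_map_eq_zero]
  rintro ⟨r, θ, u⟩ h
  rw [orbitDeriv_sliceMap, hb] at h
  dsimp only at h
  have n01 : ⟪b 0, b 1⟫ = 0 := b.orthonormal.2 (by simp)
  have n11 : ⟪b 1, b 1⟫ = 1 := by rw [real_inner_self_eq_norm_sq, b.orthonormal.1, one_pow]
  have n00 : ⟪b 0, b 0⟫ = 1 := by rw [real_inner_self_eq_norm_sq, b.orthonormal.1, one_pow]
  have h0 := congrArg (fun y => ⟪b 0, y⟫) h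
  simp only [inner_add_right, inner_smul_right, inner_zero_sliceLin, n01, n00, inner_zero_right]
    at h0
  have h1 := congrArg (fun y => ⟪b 1, y⟫) h
  simp only [inner_add_right, inner_smul_right, inner_one_sliceLin, real_inner_comm, n01, n11,
    inner_zero_right] at h1
  have hr : r = 0 := by linarith
  have hθ : θ = 0 := by
    have : θ * c = 0 := by linarith
    exact (mul_eq_zero.1 this).resolve_right hc
  rw [hr, hθ, zero_smul, zero_smul, zero_add, zero_add] at h
  have hu : u = 0 := by rw [← norm_eq_zero, ← norm_sliceLin b, h, norm_zero]
  rw [hr, hθ, hu]; rfl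

/-- At `r = 1` the Jacobian of `orbitMap` is `transverseDet`, so injectivity of the derivative gives
transversality. -/
theorem transverseDet_sliceMap_zero (hp : ∀ i, p i ≠ 0) {c : ℝ} (hc : c ≠ 0)
    (hb : genOp p (b 0) = c • b 1) : transverseDet p (sliceMap b) 0 ≠ 0 := by
  have h := det_orbitDeriv hp (sliceMap b) (1, 0, 0)
  rw [one_pow, one_mul] at h
  rw [← h]
  intro h0
  obtain ⟨v, hv, hv0⟩ := (Submodule.ne_bot_iff _).1 (LinearMap.bot_lt_ker_of_det_eq_zero h0).ne'
  refine hv0 ((coordEquiv m).injective ?_)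
  rw [← coordCLM_apply, ← coordCLM_apply]
  exact injective_orbitDeriv_sliceMap hc hb (by rw [map_zero, map_zero]; exact hv)

theorem continuous_transverseDet {φ : Model m → Cn m} (hφ : ContDiff ℝ ∞ φ) :
    Continuous (transverseDet p φ) := by
  refine Continuous.matrix_det (continuous_pi fun a => continuous_pi fun i => ?_)
  suffices h : Continuous fun u => (Matrix.vecCons (φ u) (Matrix.vecCons (fundField p (φ u))
      (pushFrame φ u)) : Fin (2 * m + 2) → Cn m) i from continuous_const.inner h
  refine Fin.cases ?_ (fun i => Fin.cases ?_ (fun i => ?_) i) i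
  · exact hφ.continuous
  · simp only [fundField_eq]
    exact (genOp p).continuous.comp hφ.continuous
  · exact (hφ.continuous_fderiv (by simp)).clm_apply continuous_const

/-- `orbitMap` is a local diffeomorphism at the centre of the slice. -/
theorem orbitMap_sliceMap_local {c : ℝ} (hc : c ≠ 0) (hb : genOp p (b 0) = c • b 1) :
    (∃ V ∈ nhds ((1, 0, 0) : ℝ × ℝ × Model m), InjOn (orbitMap p (sliceMap b)) V) ∧
      Filter.map (orbitMap p (sliceMap b)) (nhds (1, 0, 0)) = nhds (b 0) := by
  have hfin : Module.finrank ℝ (ℝ × ℝ × Model m) = Module.finrank ℝ (Cn m) := by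
    rw [finrank_Cn]; simp; ring
  have hinj := injective_orbitDeriv_sliceMap hc hb
  set e : (ℝ × ℝ × Model m) ≃L[ℝ] Cn m := (LinearMap.linearEquivOfInjective
    (orbitDeriv p (sliceMap b) (1, 0, 0)).toLinearMap hinj hfin).toContinuousLinearEquiv
  have he : (e : (ℝ × ℝ × Model m) →L[ℝ] Cn m) = orbitDeriv p (sliceMap b) (1, 0, 0) := by
    exact ContinuousLinearMap.ext fun w => rfl
  have h1 : HasStrictFDerivAt (orbitMap p (sliceMap b)) (e : (ℝ × ℝ × Model m) →L[ℝ] Cn m)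
      (1, 0, 0) := by
    rw [he]
    refine (contDiff_orbitMap (contDiff_sliceMap b)).contDiffAt.hasStrictFDerivAt'
      (hasFDerivAt_orbitMap ?_) (by simp)
    exact ((contDiff_sliceMap b).differentiable (by simp) _).hasFDerivAt
  refine ⟨⟨_, (h1.toOpenPartialHomeomorph _).open_source.mem_nhds
    h1.mem_toOpenPartialHomeomorph_source, (h1.toOpenPartialHomeomorph _).injOn⟩, ?_⟩
  rw [h1.map_nhds_eq_of_equiv]
  congr 1
  simp [orbitMap, sliceMap_zero, actOp_one]

/-- An isotropy element fixes `b 0` and commutes with the generator, so it also fixes `b 1`. Being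
an isometry it preserves the orthogonal complement of both, on which the slice is modelled, and the
normalizing factor depends only on the norm. -/
theorem exists_actOp_sliceMap {c : ℝ} (hc : c ≠ 0) (hb : genOp p (b 0) = c • b 1) {t : Circle}
    (ht : actOp p t (b 0) = b 0) (u : Model m) :
    ∃ v, ‖v‖ = ‖u‖ ∧ actOp p t (sliceMap b u) = sliceMap b v := by
  have hgen : actOp p t (genOp p (b 0)) = genOp p (actOp p t (b 0)) := by
    ext j
    simp only [actOp_apply, genOp_apply]
    ring
  have ht1 : actOp p t (b 1) = b 1 := by
    rw [ht, hb, map_smul] at hgen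
    exact smul_right_injective _ hc hgen
  obtain ⟨v, hv⟩ := exists_sliceLin_eq b (v := actOp p t (sliceLin b u))
    (by rw [← ht, inner_actOp, inner_zero_sliceLin])
    (by rw [← ht1, inner_actOp, inner_one_sliceLin])
  have hn : ‖v‖ = ‖u‖ := by rw [← norm_sliceLin b, hv, norm_actOp, norm_sliceLin]
  refine ⟨v, hn, ?_⟩
  rw [sliceMap, sliceMap, map_smul, map_add, ht, hv, hn]

/-- Points of a small slice are only related by elements of the isotropy group. -/
theorem exists_slice_radius {c : ℝ} (hc : c ≠ 0) (hb : genOp p (b 0) = c • b 1) {k : ℕ}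
    (hk : 0 < k) (hiso : ∀ t : Circle, actOp p t (b 0) = b 0 ↔ t ^ k = 1) :
    ∃ ε > 0, ∀ ε' ≤ ε, ∀ u ∈ ball (0 : Model m) ε', ∀ t : Circle,
      actOp p t (sliceMap b u) ∈ sliceMap b '' ball 0 ε' ↔ t ^ k = 1 := by
  obtain ⟨⟨V, hV, hinj⟩, -⟩ := orbitMap_sliceMap_local hc hb
  obtain ⟨δ, hδ, hδV⟩ := Metric.mem_nhds_iff.1 hV
  have hk0 : (0 : ℝ) < k := by exact_mod_cast hk
  -- Parameters at distance at least `δ` from every `j/k`. None of them fixes `b 0`, so by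
  -- compactness each moves `b 0` by at least some `d > 0`.
  set T : Set ℝ := Icc 0 1 ∩ ⋂ j : ℤ, {θ | δ ≤ |θ - j / k|} with hT
  have hTc : IsCompact T := isCompact_Icc.inter_right
    (isClosed_iInter fun j => isClosed_le continuous_const (by fun_prop))
  obtain ⟨d, hd0, hd⟩ := hTc.exists_forall_le' (f := fun θ => ‖actOp p (circ θ) (b 0) - b 0‖) (a := 0)
    (by
      refine Continuous.continuousOn ?_
      exact (((contDiff_actOp_circ p).continuous.clm_apply continuous_const).sub
        continuous_const).norm)
    (by
      intro θ hθ
      rw [norm_pos_iff, sub_ne_zero]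
      intro h
      obtain ⟨j, hj⟩ := SliceChart.circ_pow_eq_one.1 ((hiso _).1 h)
      have h1 : δ ≤ |θ - j / k| := mem_iInter.1 hθ.2 j
      have h2 : θ = j / k := by rw [← hj]; field_simp
      rw [h2, sub_self, abs_zero] at h1
      linarith)
  have hcont := (contDiff_sliceMap b).continuous.continuousAt (x := 0)
  obtain ⟨ε1, hε1, hε1c⟩ := Metric.continuousAt_iff.1 hcont (d / 2) (by positivity)
  refine ⟨min δ ε1, lt_min hδ hε1, fun ε' hε' u hu t => ⟨?_, fun ht => ?_⟩⟩
  · rintro ⟨v, hv, hvt⟩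
    have hnear : ∀ w ∈ ball (0 : Model m) ε', ‖sliceMap b w - b 0‖ < d / 2 := by
      intro w hw
      have := hε1c (lt_of_lt_of_le (mem_ball.1 hw) (hε'.trans (min_le_right _ _)))
      rwa [dist_eq_norm, sliceMap_zero] at this
    obtain ⟨θ, hθ, rfl⟩ := exists_circ t
    have hθT : θ ∉ T := by
      intro h
      have h1 := hd θ h
      have h2 : actOp p (circ θ) (b 0) - b 0 =
          (sliceMap b v - b 0) - actOp p (circ θ) (sliceMap b u - b 0) := by
        rw [map_sub, hvt]; abel
      rw [h2] at h1
      have h3 := norm_sub_le (sliceMap b v - b 0) (actOp p (circ θ) (sliceMap b u - b 0))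
      rw [norm_actOp] at h3
      linarith [hnear u hu, hnear v hv]
    -- Since `θ ∉ T`, it is within `δ` of some `j/k`. The element `e^{2πi j/k}` preserves the slice
    -- and can be divided out; local injectivity of `orbitMap` then forces `θ = j/k`.
    obtain ⟨j, hj⟩ : ∃ j : ℤ, |θ - j / k| < δ := by
      by_contra! h
      exact hθT ⟨hθ, mem_iInter.2 h⟩
    have hγ : circ (j / k) ^ k = 1 := SliceChart.circ_pow_eq_one.2 ⟨j, mul_div_cancel₀ _ hk0.ne'⟩
    have hγ' : actOp p (circ (j / k))⁻¹ (b 0) = b 0 := (hiso _).2 (by rw [inv_pow, hγ, inv_one])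
    obtain ⟨v', hv', hvv'⟩ := exists_actOp_sliceMap hc hb hγ' v
    have hθ2 : circ (j / k) * circ (θ - j / k) = circ θ := by rw [← circ_add]; congr 1; ring
    have h1 : orbitMap p (sliceMap b) (1, θ - j / k, u) = orbitMap p (sliceMap b) (1, 0, v') := by
      simp only [orbitMap, one_smul, circ_zero, actOp_one]
      rw [← hvv', hvt, ← hθ2, actOp_mul, actOp_inv_actOp]
    have hmem : ∀ (s : ℝ) (w : Model m), |s| < δ → ‖w‖ < ε' → ((1, s, w) : ℝ × ℝ × Model m) ∈ V := by
      intro s w hs hw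
      refine hδV ?_
      rw [mem_ball, Prod.dist_eq, Prod.dist_eq]
      refine max_lt (by simpa using hδ) (max_lt ?_ ?_)
      · simpa using hs
      · simpa using hw.trans_le (hε'.trans (min_le_left _ _))
    have h2 := hinj (hmem _ _ hj (by simpa using hu))
      (hmem 0 v' (by simpa using hδ) (by rw [hv']; simpa using hv)) h1
    have h3 : θ - j / k = 0 := congrArg (fun w : ℝ × ℝ × Model m => w.2.1) h2
    rw [sub_eq_zero] at h3
    rw [h3, hγ]
  · obtain ⟨v, hv, hvt⟩ := exists_actOp_sliceMap hc hb ((hiso t).2 ht) u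
    exact ⟨v, by simpa [hv] using hu, hvt.symm⟩

end LocalStructure

/-- The slice theorem: every orbit meets an orbifold chart, with a neighbourhood. -/
theorem exists_sliceChart (hp : ∀ i, p i ≠ 0) {x : Cn m} (hx : x ∈ sphere (0 : Cn m) 1) :
    ∃ (c : SliceChart p) (K : Set (Model m)), K ⊆ c.D ∧ IsCompact K ∧
      ∀ᶠ y in nhds x, y ∈ sphere (0 : Cn m) 1 → ∃ t : Circle, actOp p t y ∈ c.φ '' K := by
  have hx1 : ‖x‖ = 1 := by simpa using hx
  have hx0 : x ≠ 0 := norm_ne_zero_iff.1 (by rw [hx1]; exact one_ne_zero)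
  have hX := genOp_ne_zero hp hx0
  obtain ⟨b, rfl, hb1⟩ := exists_adapted_basis hx1 hX (inner_genOp_self p x)
  set c := ‖genOp p (b 0)‖ with hc
  have hc0 : c ≠ 0 := norm_ne_zero_iff.2 hX
  have hb : genOp p (b 0) = c • b 1 := by rw [hb1, smul_inv_smul₀ hc0]
  obtain ⟨k, hk, hiso⟩ := exists_isotropy_order hp hx0
  obtain ⟨ε1, hε1, hslice⟩ := exists_slice_radius hc0 hb hk hiso
  obtain ⟨ε2, hε2, htr⟩ := Metric.eventually_nhds_iff_ball.1
    ((continuous_transverseDet (p := p) (contDiff_sliceMap b)).continuousAt.eventually_ne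
      (transverseDet_sliceMap_zero hp hc0 hb))
  -- The slice property holds at every smaller radius, so the ball can be shrunk to where
  -- transversality persists.
  set ε := min ε1 ε2 with hε
  have hε0 : 0 < ε := lt_min hε1 hε2
  refine ⟨{ D := ball 0 ε, φ := sliceMap b, order := k, isOpen := isOpen_ball,
            smooth := (contDiff_sliceMap b).contDiffOn,
            mem_sphere := fun u _ => by simpa using norm_sliceMap b u,
            injOn := (injective_sliceMap b).injOn,
            transverse := fun u hu => htr u (ball_subset_ball (min_le_right _ _) hu),
            order_pos := hk,
            slice := hslice ε (min_le_left _ _) },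
    closedBall 0 (ε / 2), closedBall_subset_ball (by linarith), isCompact_closedBall _ _, ?_⟩
  -- The image of this set under the local diffeomorphism `orbitMap` is a neighbourhood of the
  -- centre; on the sphere the norm forces `r = 1`, so the point lies on an orbit through the
  -- smaller ball.
  have hW : {w : ℝ × ℝ × Model m | 0 < w.1 ∧ ‖w.2.2‖ < ε / 2} ∈ nhds (1, 0, 0) := by
    refine IsOpen.mem_nhds ?_ (by simpa using hε0)
    exact (isOpen_lt continuous_const continuous_fst).inter
      (isOpen_lt (continuous_snd.comp continuous_snd).norm continuous_const)
  have hW' := Filter.image_mem_map (m := orbitMap p (sliceMap b)) hW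
  rw [(orbitMap_sliceMap_local hc0 hb).2] at hW'
  filter_upwards [hW']
  rintro y ⟨⟨r, θ, u⟩, ⟨hr, hu⟩, rfl⟩ hy
  have hn : r = 1 := by
    have h1 : ‖orbitMap p (sliceMap b) (r, θ, u)‖ = 1 := by simpa using hy
    rwa [orbitMap, norm_smul, norm_actOp, norm_sliceMap, mul_one, Real.norm_of_nonneg hr.le] at h1
  refine ⟨(circ θ)⁻¹, u, by simpa using hu.le, ?_⟩
  rw [hn, orbitMap]
  dsimp only
  rw [one_smul, actOp_inv_actOp]

end

section

variable {m : ℕ} {p : Fin (m + 1) → ℤ}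

/-! ### Averaging over orbits -/

/-- The average of `f` over the orbits. -/
def orbitAverage (p : Fin (m + 1) → ℤ) (f : Cn m → ℝ) (y : Cn m) : ℝ :=
  ∫ θ in (0 : ℝ)..1, f (actOp p (circ θ) y)

/-- The average is the value at `0` of a convolution in `θ` depending smoothly on the parameter `y`.
The bump `β` makes the kernel compactly supported and equals `1` on `[-1, 1]`, which contains all
parameters that matter. -/
theorem contDiff_orbitAverage {f : Cn m → ℝ} (hf : ContDiff ℝ ∞ f) :
    ContDiff ℝ ∞ (orbitAverage p f) := by
  let β : ContDiffBump (0 : ℝ) := ⟨1, 2, one_pos, one_lt_two⟩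
  set g : Cn m → ℝ → ℝ := fun y s => β s * f (actOp p (circ (-s)) y) with hg
  set h : ℝ → ℝ := (Ioc 0 1).indicator fun _ => 1 with hh
  have h1 := contDiffOn_convolution_right_with_param (μ := (volume : Measure ℝ)) (f := h) (n := ⊤)
    (ContinuousLinearMap.mul ℝ ℝ) (g := g) (s := univ) (k := closedBall 0 2) isOpen_univ
    (isCompact_closedBall _ _) (fun y s _ hs => by
      have : β s = 0 := β.zero_of_le_dist (le_of_lt (by simpa [mem_closedBall] using hs))
      simp only [hg]
      rw [this, zero_mul])
    ((integrable_indicator_iff measurableSet_Ioc).2 (by simp)).locallyIntegrable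
    (by
      refine ContDiff.contDiffOn ?_
      refine (β.contDiff.comp contDiff_snd).mul (hf.comp ?_)
      exact ((contDiff_actOp_circ p).comp contDiff_snd.neg).clm_apply contDiff_fst)
  rw [univ_prod_univ, contDiffOn_univ] at h1
  have h2 : orbitAverage p f =
      (fun q : Cn m × ℝ => (convolution h (g q.1) (ContinuousLinearMap.mul ℝ ℝ) volume) q.2) ∘
        fun y => (y, 0) := by
    funext y
    rw [Function.comp_apply, orbitAverage, intervalIntegral.integral_of_le zero_le_one,
      ← integral_indicator measurableSet_Ioc]
    refine integral_congr_ae (Filter.Eventually.of_forall fun θ => ?_)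
    by_cases hθ : θ ∈ Ioc (0 : ℝ) 1
    · have : β (-θ) = 1 := β.one_of_mem_closedBall (by
        rw [mem_closedBall, dist_zero_right, norm_neg, Real.norm_of_nonneg hθ.1.le]; exact hθ.2)
      simp [hh, hg, hθ, this]
    · simp [hh, hθ]
  rw [h2]
  exact h1.comp (contDiff_id.prodMk contDiff_const)

theorem circ_add_one (θ : ℝ) : circ (θ + 1) = circ θ := by
  have : circ 1 = 1 := by
    have := (SliceChart.circ_pow_eq_one (θ := 1) (k := 1)).2 ⟨1, by simp⟩
    simpa using this
  rw [circ_add, this, mul_one]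

theorem orbitAverage_actOp (f : Cn m → ℝ) (t : Circle) (y : Cn m) :
    orbitAverage p f (actOp p t y) = orbitAverage p f y := by
  obtain ⟨s, -, rfl⟩ := exists_circ t
  have hper : Function.Periodic (fun θ : ℝ => f (actOp p (circ θ) y)) 1 := fun θ => by
    simp only [circ_add_one]
  have h1 := hper.intervalIntegral_add_eq s 0
  rw [zero_add] at h1
  rw [orbitAverage, orbitAverage, ← h1]
  have h2 := intervalIntegral.integral_comp_add_right (a := 0) (b := 1)
    (fun θ : ℝ => f (actOp p (circ θ) y)) s
  rw [zero_add, add_comm 1 s] at h2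
  rw [← h2]
  simp only [circ_add, actOp_mul]

theorem orbitAverage_nonneg {f : Cn m → ℝ} (hf : ∀ y, 0 ≤ f y) (y : Cn m) :
    0 ≤ orbitAverage p f y :=
  intervalIntegral.integral_nonneg zero_le_one fun _ _ => hf _

theorem orbitAverage_pos {f : Cn m → ℝ} (hc : Continuous f) (hf : ∀ y, 0 ≤ f y) {y : Cn m}
    (hy : 0 < f y) : 0 < orbitAverage p f y := by
  refine intervalIntegral.integral_pos one_pos (Continuous.continuousOn ?_) (fun _ _ => hf _)
    ⟨0, by simp, by rwa [circ_zero, actOp_one]⟩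
  exact hc.comp ((contDiff_actOp_circ p).continuous.clm_apply continuous_const)

theorem exists_of_orbitAverage_ne_zero {f : Cn m → ℝ} {y : Cn m} (h : orbitAverage p f y ≠ 0) :
    ∃ t, f (actOp p t y) ≠ 0 := by
  by_contra! h1
  refine h ?_
  simp [orbitAverage, h1]

/-! ### Existence of partitions of unity -/

/-- Take a bump function at `x` supported where orbits meet the compact part of a chart. Averaging
over orbits makes it invariant, keeps it positive at `x`, and only enlarges its support to the union
of orbits meeting the old one. -/
theorem exists_sliceChart_bump (hp : ∀ i, p i ≠ 0) (x : sphere (0 : Cn m) 1) :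
    ∃ (c : SliceChart p) (F : Cn m → ℝ), ContDiff ℝ ∞ F ∧ (∀ t y, F (actOp p t y) = F y) ∧
      (∀ y, 0 ≤ F y) ∧ 0 < F x ∧ ∃ K ⊆ c.D, IsCompact K ∧ ∀ y ∈ sphere (0 : Cn m) 1, F y ≠ 0 →
        ∃ t : Circle, actOp p t y ∈ c.φ '' K := by
  obtain ⟨c, K, hK, hKc, hU⟩ := exists_sliceChart hp x.2
  obtain ⟨ρ, hρ, hball⟩ := Metric.eventually_nhds_iff_ball.1 hU
  let β : ContDiffBump (x : Cn m) := ⟨ρ / 2, ρ, by linarith, by linarith⟩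
  refine ⟨c, orbitAverage p β, contDiff_orbitAverage β.contDiff, orbitAverage_actOp β,
    orbitAverage_nonneg fun _ => β.nonneg,
    orbitAverage_pos β.continuous (fun _ => β.nonneg) (β.pos_of_mem_ball (by simpa using hρ)), K, hK, hKc, fun y hy hne => ?_⟩
  obtain ⟨t, ht⟩ := exists_of_orbitAverage_ne_zero hne
  have hmem : actOp p t y ∈ ball (x : Cn m) ρ := by
    by_contra h
    exact ht (β.zero_of_le_dist (by simpa using h))
  obtain ⟨s, hs⟩ := hball _ hmem (actOp_mem_sphere p hy)
  exact ⟨s * t, by rwa [actOp_mul]⟩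

theorem nonempty_chartPartition (hp : ∀ i, p i ≠ 0) : Nonempty (ChartPartition p) := by
  choose c F hF hinv hnonneg hpos hsupp using exists_sliceChart_bump hp
  obtain ⟨s, hs⟩ := CompactSpace.elim_nhds_subcover
    (fun x : sphere (0 : Cn m) 1 => {y : sphere (0 : Cn m) 1 | 0 < F x y})
    fun x => (isOpen_lt continuous_const
      ((hF x).continuous.comp continuous_subtype_val)).mem_nhds (hpos x)
  set e := s.equivFin.symm
  set G : Fin s.card → Cn m → ℝ := fun i => F (e i) with hG
  have hsum : ∀ y ∈ sphere (0 : Cn m) 1, 0 < ∑ i, G i y := by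
    intro y hy
    have : (⟨y, hy⟩ : sphere (0 : Cn m) 1) ∈ ⋃ x ∈ s, {y : sphere (0 : Cn m) 1 | 0 < F x y} := by
      rw [hs]; trivial
    obtain ⟨x, hx, hxy⟩ := mem_iUnion₂.1 this
    refine Finset.sum_pos' (fun i _ => hnonneg _ _) ⟨e.symm ⟨x, hx⟩, Finset.mem_univ _, ?_⟩
    simpa [hG] using hxy
  exact ⟨{
    N := s.card
    chart := fun i => c (e i)
    χ := fun i y => G i y / ∑ j, G j y
    smooth := fun i y hy => (hF _).contDiffAt.div
      (ContDiffAt.sum fun j _ => (hF _).contDiffAt) (hsum y hy).ne'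
    invariant := fun i t y _ => by simp only [act_eq, hG, hinv]
    nonneg := fun i y hy => div_nonneg (hnonneg _ _) (hsum y hy).le
    sum_eq_one := fun y hy => by rw [← Finset.sum_div, div_self (hsum y hy).ne']
    support := fun i => by
      obtain ⟨K, hK, hKc, h⟩ := hsupp (e i)
      exact ⟨K, hK, hKc, fun y hy hne => h y hy fun h0 => hne (by simp only [hG, h0, zero_div])⟩ }⟩

end

section

open Coch

variable {m : ℕ} {p : Fin (m + 1) → ℤ}

/-! ### Basic forms from connections -/

theorem IsNormalizedConnection.sub_mem_basicForms {α β : Form m 1}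
    (hα : IsNormalizedConnection p α) (hβ : IsNormalizedConnection p β) :
    α - β ∈ basicForms p 1 := by
  refine ⟨fun x hx => (hα.smooth x hx).sub (hβ.smooth x hx), fun t x hx v hv => ?_,
    fun x hx v _ hi => ?_⟩
  · simp [hα.invariant t x hx v hv, hβ.invariant t x hx v hv]
  · obtain ⟨i, hi⟩ := hi
    have hv : v = fun _ => fundField p x := by
      funext j; rw [← hi, Subsingleton.elim j i]
    rw [hv]
    simp [hα.normalized x hx, hβ.normalized x hx]

/-- Changing a curvature by an exact basic form `dγ` gives the curvature of another connection, so
every representative of the Chern class restricts on the sphere to a curvature. -/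
theorem IsNormalizedConnection.add_basic {α γ : Form m 1} (hα : IsNormalizedConnection p α)
    (hγ : γ ∈ basicForms p 1) : IsNormalizedConnection p (α + γ) where
  smooth x hx := (hα.smooth x hx).add (hγ.1 x hx)
  invariant t x hx v hv := by simp [hα.invariant t x hx v hv, hγ.2.1 t x hx v hv]
  normalized x hx := by
    have h1 : γ x (fun _ => fundField p x) = 0 :=
      hγ.2.2 x hx _ (fun _ => by rw [fundField_eq]; exact inner_genOp_self p x) ⟨0, rfl⟩
    simp [hα.normalized x hx, h1]

/-! ### Constant coefficient forms -/

theorem ofForm_injective {k : ℕ} {a b : Cn m [⋀^Fin k]→L[ℝ] ℝ} (h : ofForm a = ofForm b) :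
    a = b := by
  ext v
  rw [← ofForm_ofFn, h, ofForm_ofFn]

theorem const_mem_closedForms {k : ℕ} {a : Cn m [⋀^Fin k]→L[ℝ] ℝ}
    (hinv : ∀ t, pull (actOp p t) (ofForm a) = ofForm a)
    (hhor : ∀ x ∈ sphere (0 : Cn m) 1, EqOn (tangentSet x) (contr (genOp p x) (ofForm a)) 0) :
    (fun _ => a : Form m k) ∈ closedForms p k := by
  refine ⟨⟨fun _ _ => contDiffAt_const, fun t x _ v _ => ?_, fun x hx v hv hi => ?_⟩, ?_⟩
  · have := congrFun (hinv t) (List.ofFn v)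
    rw [pull_apply, List.map_ofFn, ofForm_ofFn, ofForm_ofFn] at this
    exact this
  · obtain ⟨i, hi⟩ := hi
    cases k with
    | zero => exact i.elim0
    | succ k =>
      have hX : ∀ w : Fin (k + 1) → Cn m, w 0 = genOp p x → (∀ j, w j ∈ tangentSet x) →
          a w = 0 := by
        intro w hw0 hw
        rw [← ofForm_ofFn, List.ofFn_succ, hw0]
        refine hhor x hx _ fun u hu => ?_
        obtain ⟨j, rfl⟩ := (List.mem_ofFn' _ _).1 hu
        exact hw _
      by_cases h0 : i = 0
      · exact hX v (by rw [← h0, hi, fundField_eq]) hv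
      -- Vanishing is known with `X` in the first slot; a transposition brings it there.
      · have h1 := a.toAlternatingMap.map_swap v h0
        have h2 : a (v ∘ Equiv.swap i 0) = 0 :=
          hX _ (by simp [hi, fundField_eq]) fun j => hv _
        have h3 : a v = -a (v ∘ Equiv.swap i 0) := by
          rw [eq_neg_iff_add_eq_zero, add_comm, ← eq_neg_iff_add_eq_zero]; exact h1
        rw [h3, h2, neg_zero]
  · intro x _ v _
    have h : extDeriv (fun _ => a : Form m k) x = 0 := by
      refine ofForm_injective ?_
      rw [← extD_ofForm (differentiableAt_const a), extD_const, ofForm_zero]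
    rw [h]; rfl

variable (p) in
/-- The curvature form of the standard connection. -/
def stdCurvForm : Cn m [⋀^Fin 2]→L[ℝ] ℝ := extDeriv (stdConn p) 0

theorem extDeriv_stdConn_coch (x : Cn m) : ofForm (extDeriv (stdConn p) x) = stdCurv p := by
  rw [← extD_ofForm ((contDiff_stdConn p).differentiable (by simp) x)]
  exact extD_stdConn p x

theorem ofForm_stdCurvForm : ofForm (stdCurvForm p) = stdCurv p := extDeriv_stdConn_coch 0

theorem extDeriv_stdConn (x : Cn m) : extDeriv (stdConn p) x = stdCurvForm p :=
  ofForm_injective ((extDeriv_stdConn_coch x).trans ofForm_stdCurvForm.symm)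

theorem contr_genOp_stdCurv (hp : ∀ i, p i ≠ 0) {x : Cn m} (hx : x ∈ sphere (0 : Cn m) 1) :
    EqOn (tangentSet x) (contr (genOp p x) (stdCurv p)) 0 := by
  rw [← extD_stdConn p x]
  exact (stdConn_isNormalizedConnection hp).contr_extD hx

theorem wedgePow_stdCurvForm_mem (hp : ∀ i, p i ≠ 0) (r : ℕ) :
    (fun _ => wedgePow (stdCurvForm p) r : Form m (2 * r)) ∈ closedForms p (2 * r) := by
  refine const_mem_closedForms (fun t => ?_) fun x hx => ?_
  · rw [ofForm_wedgePow, ofForm_stdCurvForm, pull_pow, pull_stdCurv]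
  · rw [ofForm_wedgePow, ofForm_stdCurvForm]
    exact contr_pow_eqOn_zero (contr_genOp_stdCurv hp hx) r

theorem stdCurvForm_mem (hp : ∀ i, p i ≠ 0) :
    (fun _ => stdCurvForm p : Form m 2) ∈ closedForms p 2 :=
  const_mem_closedForms (fun t => by rw [ofForm_stdCurvForm, pull_stdCurv]) fun x hx => by
    rw [ofForm_stdCurvForm]; exact contr_genOp_stdCurv hp hx

/-! ### The first Chern class -/

theorem deRhamClass_eq_iff {k : ℕ} {η β : closedForms p k} :
    deRhamClass p η = deRhamClass p β ↔ (η : Form m k) - β ∈ exactForms p k := by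
  rw [deRhamClass, deRhamClass, Submodule.Quotient.eq]
  rfl

/-- The standard connection provides a class. For any other connection the difference from it is
basic, so the curvatures differ by an exact form on `B`. -/
theorem existsUnique_firstChernClass (hp : ∀ i, p i ≠ 0) :
    ∃! c : DeRham p 2, IsFirstChernClass p c := by
  refine ⟨deRhamClass p ⟨_, stdCurvForm_mem hp⟩, ⟨stdConn p, stdConn_isNormalizedConnection hp,
    ⟨_, stdCurvForm_mem hp⟩, fun x _ v _ => by rw [extDeriv_stdConn], rfl⟩, ?_⟩
  rintro _ ⟨α, hα, Θ, hΘ, rfl⟩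
  refine deRhamClass_eq_iff.2 ⟨α - stdConn p,
    hα.sub_mem_basicForms (stdConn_isNormalizedConnection hp), fun x hx v hv => ?_⟩
  have h1 : extDeriv (α - stdConn p) x = extDeriv α x - stdCurvForm p := by
    refine ofForm_injective ?_
    have hs := (contDiff_stdConn p).contDiffAt (x := x)
    rw [ofForm_sub, ofForm_stdCurvForm, ← extD_stdConn p x,
      ← extD_ofForm (hα.smooth.differentiableAt hx),
      ← extD_sub (smoothAt_ofForm (hα.smooth x hx)) (smoothAt_ofForm hs),
      ← extD_ofForm ((hα.smooth.differentiableAt hx).sub (hs.differentiableAt (by simp)))]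
    congr 1
    funext y
    exact ofForm_sub _ _
  rw [h1]
  simp [hΘ x hx v hv]

/-! ### The pairing with the fundamental class -/

theorem density_eq {α : Form m 1} {η : Form m (2 * m)} {x : Cn m} (hx : x ∈ sphere (0 : Cn m) 1)
    {f : Coch (Cn m)} (hf : IsAlt (2 * m) f) (h : EqOn (tangentSet x) (coch η x) f) :
    density α η x = (normalCoch x * (coch α x * f)) (frameList m) := by
  have h1 := normalCoch_mul_eq_zero (by simpa using hx)
    ((isAlt_conn_mul α η x).sub ((IsAlt.of_form (α x)).mul hf)) (by
      intro l hl
      rw [sub_apply, ((EqOn.refl (coch α x)).mul h) l hl, sub_self]; rfl)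
  rw [mul_sub, sub_eq_zero] at h1
  rw [density, h1]

/-- A primitive on `B` is horizontal, so `integral_connection_mul_extD` applies. For `m = 0` the
form has degree `0`, where exact means zero on the sphere. -/
theorem integral_density_exact (hp : ∀ i, p i ≠ 0) {α : Form m 1}
    (hα : IsNormalizedConnection p α) {η : Form m (2 * m)} (hη : η ∈ exactForms p (2 * m)) :
    ∫ x : sphere (0 : Cn m) 1, density α η x ∂(volume : Measure (Cn m)).toSphere = 0 := by
  cases m with
  | zero =>
    have h : ∀ x : sphere (0 : Cn 0) 1, density α η x = 0 := fun x => by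
      rw [density_eq x.2 IsAlt.zero (by
        have := sphereEq_iff.1 (show SphereEq η 0 from hη) x x.2
        rwa [Pi.zero_apply, ofForm_zero] at this)]
      simp
    simp [h]
  | succ m =>
    obtain ⟨δ, hδ, h⟩ : ∃ δ ∈ basicForms p (2 * m + 1), SphereEq η (extDeriv δ) := hη
    have h1 : ∀ x : sphere (0 : Cn (m + 1)) 1, density α η x =
        (normalCoch (x : Cn (m + 1)) * (coch α x * extD (coch δ) x)) (frameList (m + 1)) := by
      intro x
      rw [extD_ofForm (hδ.1.differentiableAt x.2)]
      exact density_eq x.2 (IsAlt.of_form _) (sphereEq_iff.1 h x x.2)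
    simp only [h1]
    refine integral_connection_mul_extD hp (fun x hx => smoothAt_ofForm (hα.smooth x hx))
      (fun x => IsAlt.of_form _) (fun x hx => hα.contr_extD hx)
      (fun x hx => smoothAt_ofForm (hδ.1 x hx)) (fun x hx => ?_) (fun x hx => ?_) _
    · exact hδ.2.2.contr_eqOn hx
    · rw [extD_ofForm (hα.smooth.differentiableAt hx)]
      exact ((IsAlt.of_form _).mul (IsAlt.of_form _)).cast (by ring)

/-- A representative `Θ` of the class restricts to the curvature of a modified connection `α + γ`.
Using this connection to pass from `B` to the sphere, the representative `Θ^m` gives the Chern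
integral of `α + γ`, and any other representative differs by an exact form of zero integral. -/
theorem hasPairing_cupPower (hp : ∀ i, p i ≠ 0) {c : DeRham p 2} (hc : IsFirstChernClass p c)
    {C : DeRham p (2 * m)} (hC : IsCupPower p c m C) :
    HasPairing p C (1 / ∏ i, (p i : ℝ)) := by
  refine ⟨nonempty_chartPartition hp, fun P Ω' hΩ' => ?_⟩
  obtain ⟨α, hα, Θ', hΘ', rfl⟩ := hc
  obtain ⟨Θ, Ω, hΘ, hΩ, rfl⟩ := hC
  obtain ⟨γ, hγ, hγΘ⟩ : ∃ γ ∈ basicForms p 1, SphereEq ((Θ : Form m 2) - (Θ' : Form m 2)) (extDeriv γ) :=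
    deRhamClass_eq_iff.1 hΘ
  have hA := hα.add_basic hγ
  have hcurv : ∀ x ∈ sphere (0 : Cn m) 1,
      EqOn (tangentSet x) (coch (Θ : Form m 2) x) (extD (coch (α + γ)) x) := by
    intro x hx
    rw [extD_ofForm (hA.smooth.differentiableAt hx),
      extDeriv_add (hα.smooth.differentiableAt hx) (hγ.1.differentiableAt hx)]
    refine (EqOn.ofForm_iff (T := tangentSet x) _ _).2 fun v hv => ?_
    have h1 := hγΘ x hx v hv
    have h2 := hΘ' x hx v hv
    simp only [Pi.sub_apply, ContinuousAlternatingMap.sub_apply] at h1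
    simp only [ContinuousAlternatingMap.add_apply]
    linarith
  have h1 : ∀ x : sphere (0 : Cn m) 1, density (α + γ) Ω x =
      (normalCoch (x : Cn m) * (coch (α + γ) x * extD (coch (α + γ)) x ^ m)) (frameList m) := by
    intro x
    have halt : IsAlt 2 (extD (coch (α + γ)) x) :=
      ⟨_, extD_ofForm (hA.smooth.differentiableAt x.2)⟩
    refine density_eq x.2 (halt.pow_two m) ?_
    have h2 := sphereEq_iff.1 hΩ x x.2
    rw [ofForm_wedgePow] at h2
    exact h2.trans ((hcurv x x.2).pow m)
  have h2 : ∀ x : sphere (0 : Cn m) 1, density (α + γ) Ω' x =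
      density (α + γ) Ω x + density (α + γ) ((Ω' : Form m (2 * m)) - (Ω : Form m (2 * m))) x := by
    intro x
    have e : coch (Ω' : Form m (2 * m)) x =
        coch (Ω : Form m (2 * m)) x + coch ((Ω' : Form m (2 * m)) - (Ω : Form m (2 * m))) x :=
      (congrArg ofForm (add_sub_cancel ((Ω : Form m (2 * m)) x) ((Ω' : Form m (2 * m)) x)).symm).trans
        (ofForm_add _ _)
    rw [density, e, mul_add, mul_add]
    rfl
  have hint : ∀ η : Form m (2 * m), SmoothOnSphere η →
      Integrable (fun x : sphere (0 : Cn m) 1 => density (α + γ) η x)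
        (volume : Measure (Cn m)).toSphere := fun η hη =>
    integrable_on_sphere fun x hx => (contDiffAt_density (hA.smooth x hx) (hη x hx)).continuousAt
  have hbas : (Ω' : Form m (2 * m)) - (Ω : Form m (2 * m)) ∈ basicForms p (2 * m) := sub_mem Ω'.2.1 Ω.2.1
  rw [P.integral_eq hp hA Ω'.2.1]
  simp only [h2]
  rw [integral_add (hint _ Ω.2.1.1) (hint _ hbas.1),
    integral_density_exact hp hA (deRhamClass_eq_iff.1 hΩ'), add_zero]
  simp only [h1]
  rw [integral_connection_eq hp hA (stdConn_isNormalizedConnection hp), integral_stdConn hp]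

/-- The standard curvature represents the class and has constant coefficients; its power is
constant, invariant and horizontal, hence a closed form on `B`. -/
theorem exists_cupPower (hp : ∀ i, p i ≠ 0) {c : DeRham p 2} (hc : IsFirstChernClass p c) (r : ℕ) :
    ∃ C : DeRham p (2 * r), IsCupPower p c r C := by
  have h0 : IsFirstChernClass p (deRhamClass p ⟨_, stdCurvForm_mem hp⟩) :=
    ⟨stdConn p, stdConn_isNormalizedConnection hp, ⟨_, stdCurvForm_mem hp⟩,
      fun x _ v _ => by rw [extDeriv_stdConn], rfl⟩
  exact ⟨_, ⟨_, stdCurvForm_mem hp⟩, ⟨_, wedgePow_stdCurvForm_mem hp r⟩,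
    (existsUnique_firstChernClass hp).unique h0 hc, fun _ _ _ _ => rfl, rfl⟩

end

end LinearCircleAction

end

theorem mainTheorem9 (m : ℕ) (p : Fin (m + 1) → ℤ) (hp : ∀ i, p i ≠ 0) :
    (∃! c : LinearCircleAction.DeRham p 2, LinearCircleAction.IsFirstChernClass p c) ∧
    (∀ c : LinearCircleAction.DeRham p 2, LinearCircleAction.IsFirstChernClass p c →
      (∃ C : LinearCircleAction.DeRham p (2 * m), LinearCircleAction.IsCupPower p c m C) ∧
      ∀ C : LinearCircleAction.DeRham p (2 * m), LinearCircleAction.IsCupPower p c m C →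
        LinearCircleAction.HasPairing p C (1 / ∏ i, (p i : ℝ))) ∧
    (∀ α : LinearCircleAction.Form m 1, LinearCircleAction.IsNormalizedConnection p α →
      LinearCircleAction.sphereIntegral
        (fun x => LinearCircleAction.wedge (α x)
          (LinearCircleAction.wedgePow (extDeriv α x) m)) = 1 / ∏ i, (p i : ℝ)) :=
  ⟨LinearCircleAction.existsUnique_firstChernClass hp,
    fun _ hc => ⟨LinearCircleAction.exists_cupPower hp hc m,
      fun _ hC => LinearCircleAction.hasPairing_cupPower hp hc hC⟩,
    fun _ hα => LinearCircleAction.sphereIntegral_connection hp hα⟩
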